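/- Let $m,n$ be integers with $1\le n\le m$, let $\mathbb F$ be a field, and let $\mathcal U_{n,m}$ be a generic central arrangement, i.e. an arrangement of $m$ hyperplanes $H_1,\dots,H_m$ through the origin in $\mathbb F^n$ such that for each $k\le n$ the intersection of any $k$ of the $H_i$ has codimension $k$. Definitions. For a hyperplane arrangement $\mathcal A$ let $\mathcal L(\mathcal A)$ be the poset of nonempty intersections of hyperplanes of $\mathcal A$, ordered by reverse inclusion, with bottom element $\hat 0$ (the ambient space), and let $\widetilde{\mathcal L}(\mathcal A)=\mathcal L(\mathcal A)\setminus\{\hat 0\}$. Put $\mathcal A_x=\{H\in\mathcal A: x\subseteq H\}$ (so $\mathcal A_\varnothing=\mathcal A$), $\mathcal A^x=\{x\cap H: H\in\mathcal A\setminus\mathcal A_x,\ x\cap H\neq\varnothing\}$ (an arrangement in $x$), $\mathcal A^x_y=(\mathcal A^x)_y$ and $\pi_{\mathcal A}(Y)=\sum_{x\in\mathcal L(\mathcal A)}\mu(\hat 0,x)(-Y)^{\mathrm{rk}(x)}$. For a (possibly empty) chain $F=(x_1<\dots<x_\ell)$ in $\widetilde{\mathcal L}(\mathcal A)$ put $\pi_F(Y)=\prod_{k=0}^{\ell}\pi_{\mathcal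 A^{x_k}_{x_{k+1}}}(Y)$, where $x_0=\hat 0$ and $x_{\ell+1}=\varnothing$. With indeterminates $\mathbf T=(T_x)_{x\in\widetilde{\mathcal L}(\mathcal A)}$, the flag Hilbert–Poincaré series is $$\mathsf{fHP}_{\mathcal A}(Y,\mathbf T)=\sum_F \pi_F(Y)\prod_{x\in F}\frac{T_x}{1-T_x}\in\mathbb Q(\mathbf T)[Y],$$ summed over all chains $F$ in $\widetilde{\mathcal L}(\mathcal A)$. Suppose that $\mathcal A$ is an arrangement over a field of characteristic zero. Represent $\mathcal L(\mathcal A)$ as the intersection poset of an arrangement in $K^d$, $K$ a number field, whose hyperplanes are the zero sets of affine linear polynomials $L_H$ over the ring of integers $\mathcal O_K$. For a compact discrete valuation ring $\mathfrak o$ that is an $\mathcal O_K$-algebra, with residue field of cardinality $q$ and absolute value $|\cdot|=q^{-v(\cdot)}$, let $$\zeta_{\mathcal A(\mathfrak o)}(\mathbf s)=\int_{\mathfrak o^d}\prod_{x\in\widetilde{\mathcal L}(\mathcal A)}\Big(\max_{H\supseteq x}|L_H(X)|\Big)^{s_x}\,|\mathrm dX|,$$ with respect to the Haar measure of total mass $1$.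 For $f\ge 1$ let $\mathfrak o^{(f)}$ be the unramified extension of $\mathfrak o$ of degree $f$. The multivariate topological zeta function $\zeta^{\mathrm{top}}_{\mathcal A}(\mathbf s)\in\mathbb Q(\mathbf s)$ is the limit of $\zeta_{\mathcal A(\mathfrak o^{(f)})}(\mathbf s)$ as $f\to 0$, for all $\mathfrak o$ whose residue characteristic avoids a finite set of primes. This means: there is a rational function $W(Y,\mathbf T)$ over $\mathbb Q$ with $\zeta_{\mathcal A(\mathfrak o^{(f)})}(\mathbf s)=W(-q^{-f},(q^{-fs_x})_x)$ for all $f\ge 1$, and $\zeta^{\mathrm{top}}_{\mathcal A}(\mathbf s)$ is the constant term of $W(-Q^{-1},(Q^{-s_x})_x)$ expanded as a power series in $Q-1$ over $\mathbb Q(\mathbf s)$, where $Q^a=\sum_{k\ge 0}\binom ak(Q-1)^k$. For a finite set $I$ let $\widetilde{\mathrm{WO}}(I)$ be the set of all (possibly empty) chains of nonempty subsets of $I$, and let $$\mathcal I^{\mathrm{WO}}_{I}(\mathbf T)=\sum_{F\in\widetilde{\mathrm{WO}}(I)}\prod_{J\in F}\frac{T_J}{1-T_J}$$ be the weak order zeta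 function. For $\mathcal A=\mathcal U_{n,m}$ and $\varnothing\ne I\subseteq[m]$ with $|I|\le n-1$ write $T_I$ and $s_I$ for the variables of the intersection $\bigcap_{i\in I}H_i$, and $T_{\hat 1}$ and $s_{\hat 1}$ for those of $\hat 1=\bigcap_{i=1}^mH_i$. Claim. Firstly, $$\mathsf{fHP}_{\mathcal U_{n,m}}(Y,\mathbf T)=\frac{1+Y}{1-T_{\hat 1}}\sum_{k=0}^{n-1}\binom{m-1}{k}Y^k+\sum_{\ell=1}^{n-1}\sum_{k=0}^{n-\ell-1}\frac{(1+Y)^{\ell+1}}{1-T_{\hat 1}}\binom{m-\ell-1}{k}Y^k\sum_{\substack{I\subseteq[m]\\ |I|=\ell}}T_I\,\mathcal I^{\mathrm{WO}}_{I}\big((T_J)_{\varnothing\ne J\subseteq I}\big).$$ Secondly, if $\mathbb F$ has characteristic zero, then, with $Q(\mathbf s)=n+s_{\hat 1}+\sum_{J\subseteq[m],\,1\le|J|\le n-1}s_J$, $$\zeta^{\mathrm{top}}_{\mathcal U_{n,m}}(\mathbf s)\cdot Q(\mathbf s)=\sum_{k=0}^{n-1}(-1)^k\binom{m-1}{k}+\sum_{\ell=1}^{n-1}\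 \sum_{\substack{I\subseteq[m]\\|I|=\ell}}\ \sum_{\substack{F\in\widetilde{\mathrm{WO}}(I)\\|F|=\ell}}\frac{\sum_{k=0}^{n-\ell-1}(-1)^k\binom{m-\ell-1}{k}}{\prod_{J\in F}\big(|J|+\sum_{\varnothing\ne M\subseteq J}s_M\big)}.$$ -/

import Mathlib

noncomputable section

/-- A hyperplane arrangement: a finite set of affine hyperplanes in a (nonempty) affine space
`ambient`.  The ambient space is allowed to be any affine subspace of `V`, so that restrictions of
arrangements to their flats are again arrangements. -/
structure HyperplaneArrangement (F V : Type*) [Field F] [AddCommGroup V] [Module F V] where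
  ambient : AffineSubspace F V
  hyperplanes : Finset (AffineSubspace F V)
  ambient_nonempty : (ambient : Set V).Nonempty
  nonempty : ∀ H ∈ hyperplanes, (H : Set V).Nonempty
  le_ambient : ∀ H ∈ hyperplanes, H ≤ ambient
  covBy : ∀ H ∈ hyperplanes, H.direction ⋖ ambient.direction

namespace HyperplaneArrangement

variable {F V : Type*} [Field F] [AddCommGroup V] [Module F V]

/-- The intersection poset `L(A)`: all nonempty intersections of hyperplanes of `A` (the empty
intersection being the ambient space), ordered by reverse inclusion. -/
def Flat (A : HyperplaneArrangement F V) : Type _ :=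
  {x : (AffineSubspace F V)ᵒᵈ // ((OrderDual.ofDual x : AffineSubspace F V) : Set V).Nonempty ∧
    ∃ B ⊆ A.hyperplanes, A.ambient ⊓ B.inf id = OrderDual.ofDual x}

instance (A : HyperplaneArrangement F V) : PartialOrder A.Flat :=
  inferInstanceAs (PartialOrder {_x : (AffineSubspace F V)ᵒᵈ // _})

/-- The affine subspace underlying a flat. -/
def Flat.space {A : HyperplaneArrangement F V} (x : A.Flat) : AffineSubspace F V :=
  OrderDual.ofDual x.1

instance (A : HyperplaneArrangement F V) : OrderBot A.Flat where
  bot := ⟨OrderDual.toDual A.ambient, A.ambient_nonempty, ∅, by simp, by simp⟩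
  bot_le := by
    rintro ⟨x, hx, B, hB, h⟩
    change OrderDual.ofDual x ≤ A.ambient
    rw [← h]
    exact inf_le_left

instance (A : HyperplaneArrangement F V) : Finite A.Flat := by
  refine Set.Finite.to_subtype (s := {x : (AffineSubspace F V)ᵒᵈ | _ ∧ _}) ?_
  refine ((A.hyperplanes.powerset.finite_toSet).image
    fun B => OrderDual.toDual (A.ambient ⊓ B.inf id)).subset ?_
  rintro x ⟨-, B, hB, h⟩
  exact ⟨B, by simpa using hB, congrArg OrderDual.toDual h⟩

instance (A : HyperplaneArrangement F V) : Fintype A.Flat := Fintype.ofFinite _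

open Classical in
instance (A : HyperplaneArrangement F V) : LocallyFiniteOrder A.Flat :=
  Fintype.toLocallyFiniteOrder

/-- The set of flats different from the bottom element. -/
abbrev PosFlat (A : HyperplaneArrangement F V) : Type _ := {x : A.Flat // x ≠ ⊥}

instance (A : HyperplaneArrangement F V) : Fintype A.PosFlat := Fintype.ofFinite _

open Classical in
/-- The subarrangement `A_y = {H ∈ A | y ⊆ H}`; in particular `A_∅ = A`. -/
def sub (A : HyperplaneArrangement F V) (y : AffineSubspace F V) : HyperplaneArrangement F V where
  ambient := A.ambient
  hyperplanes := A.hyperplanes.filter fun H => y ≤ H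
  ambient_nonempty := A.ambient_nonempty
  nonempty H hH := A.nonempty H (Finset.mem_filter.1 hH).1
  le_ambient H hH := A.le_ambient H (Finset.mem_filter.1 hH).1
  covBy H hH := A.covBy H (Finset.mem_filter.1 hH).1

open Classical in
/-- The restriction `A^x = {x ∩ H | H ∈ A \ A_x, x ∩ H ≠ ∅}`, an arrangement in the space `x`. -/
def restrict (A : HyperplaneArrangement F V) (x : A.Flat) : HyperplaneArrangement F V where
  ambient := x.space
  hyperplanes := (A.hyperplanes.filter fun H =>
    ¬ x.space ≤ H ∧ ((x.space ⊓ H : AffineSubspace F V) : Set V).Nonempty).image (x.space ⊓ ·)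
  ambient_nonempty := x.2.1
  nonempty := by
    intro H hH
    obtain ⟨H, hH', rfl⟩ := Finset.mem_image.1 hH
    exact (Finset.mem_filter.1 hH').2.2
  le_ambient := by
    intro H hH
    obtain ⟨H, hH, rfl⟩ := Finset.mem_image.1 hH
    exact inf_le_left
  covBy := by
    intro H hH
    obtain ⟨H, hH', rfl⟩ := Finset.mem_image.1 hH
    obtain ⟨hA, hle, p, hp⟩ := Finset.mem_filter.1 hH'
    have hp : p ∈ x.space ∧ p ∈ H := hp
    rw [AffineSubspace.direction_inf_of_mem hp.1 hp.2]
    have hcov := A.covBy H hA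
    have hxW : x.space.direction ≤ A.ambient.direction :=
      AffineSubspace.direction_le (show x.space ≤ A.ambient from bot_le (a := x))
    have hnle : ¬ x.space.direction ≤ H.direction := by
      intro h
      apply hle
      intro r hr
      have := h (AffineSubspace.vsub_mem_direction hr hp.1)
      simpa using AffineSubspace.vadd_mem_of_mem_direction this hp.2
    have hsup : x.space.direction ⊔ H.direction = A.ambient.direction := by
      rcases hcov.eq_or_eq le_sup_right (sup_le hxW hcov.le) with h | h
      · exact absurd (sup_eq_right.1 h) hnle
      · exact h
    rw [← hsup] at hcov
    exact inf_covBy_of_covBy_sup_right hcov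

open Classical in
/-- The Poincaré polynomial `π_A(Y) = ∑_{x ∈ L(A)} μ(x) (-Y)^{rk x}`. -/
def poincare (A : HyperplaneArrangement F V) : Polynomial ℤ :=
  ∑ x : A.Flat, Polynomial.C (IncidenceAlgebra.mu ℤ (⊥ : A.Flat) x) *
    (-Polynomial.X) ^ (Order.height x).toNat

open Classical in
/-- The order complex of the poset of flats different from the bottom element: its finite chains,
the empty one included. -/
def flags (A : HyperplaneArrangement F V) : Finset (Finset A.PosFlat) :=
  Finset.univ.filter fun Φ => IsChain (· ≤ ·) (Φ : Set A.PosFlat)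

/-- For a flag `x₁ < ⋯ < x_ℓ`, with `x₀` the bottom element and `x_{ℓ+1} = ∅`, this is the space
`x_{k+1}` that follows `x = x_k`: the largest of the spaces of the elements of the flag that are
greater than `x`, which is the empty affine space if there are none. -/
def flagNext {A : HyperplaneArrangement F V} (Φ : Finset A.PosFlat) (x : A.Flat) :
    AffineSubspace F V :=
  ⨆ y ∈ Φ, ⨆ _ : x < y.1, y.1.space

open Classical in
/-- `π_Φ(Y) = ∏_{k=0}^{ℓ} π_{A^{x_k}_{x_{k+1}}}(Y)` for a flag `Φ = (x₁ < ⋯ < x_ℓ)`, with `x₀` the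
bottom element and `x_{ℓ+1} = ∅`. -/
def flagPoincare {A : HyperplaneArrangement F V} (Φ : Finset A.PosFlat) : Polynomial ℤ :=
  ∏ x ∈ insert (⊥ : A.Flat) (Φ.image Subtype.val), ((A.restrict x).sub (flagNext Φ x)).poincare

/-- The field of rational functions over `ℚ` in indeterminates indexed by the flats of `A`
different from the bottom element. -/
abbrev RatFun (A : HyperplaneArrangement F V) : Type _ :=
  FractionRing (MvPolynomial A.PosFlat ℚ)

/-- The indeterminate of a flat different from the bottom element. -/
def var (A : HyperplaneArrangement F V) (x : A.PosFlat) : A.RatFun :=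
  algebraMap (MvPolynomial A.PosFlat ℚ) A.RatFun (MvPolynomial.X x)

open Classical in
/-- The indeterminate attached to an affine subspace `x` that is a flat of `A` different from the
bottom element (and `0` for all other affine subspaces). -/
def varOf (A : HyperplaneArrangement F V) (x : AffineSubspace F V) : A.RatFun :=
  if h : ∃ y : A.PosFlat, y.1.space = x then A.var h.choose else 0

/-- The flag Hilbert–Poincaré series of `A`, a polynomial in `Y` over the field of rational
functions in the indeterminates `T_x`. -/
def fHP (A : HyperplaneArrangement F V) : Polynomial A.RatFun :=
  ∑ Φ ∈ A.flags, (flagPoincare Φ).map (Int.castRingHom A.RatFun) *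
    Polynomial.C (∏ x ∈ Φ, A.var x / (1 - A.var x))

end HyperplaneArrangement

/-! ### Analytic zeta functions -/

section Analytic

open MeasureTheory

/-- The normalized absolute value `|x| = q ^ (-v x)` on a discrete valuation ring with residue
field of cardinality `q`. -/
def dvrAbs {o : Type*} [CommRing o] [IsDomain o] [IsDiscreteValuationRing o] (x : o) : NNReal :=
  open Classical in
  if x = 0 then 0 else
    ((Nat.card (IsLocalRing.ResidueField o) : NNReal)⁻¹) ^
      (IsDiscreteValuationRing.addVal o x).toNat

variable {K : Type*} [Field K] [NumberField K] {d : ℕ}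

/-- A choice, for every hyperplane of an arrangement in `K ^ d`, of an affine linear polynomial
`c_H + ∑ α_{H,j} X_j` with coefficients in the ring of integers of `K` whose zero set is `H`. -/
structure HyperplaneArrangement.IntegralForms (B : HyperplaneArrangement K (Fin d → K)) where
  coeff : B.hyperplanes → Fin d → NumberField.RingOfIntegers K
  const : B.hyperplanes → NumberField.RingOfIntegers K
  mem_iff : ∀ (H : B.hyperplanes) (z : Fin d → K),
    z ∈ H.1 ↔ (const H : K) + ∑ j, (coeff H j : K) * z j = 0

/-- The value at `z ∈ o ^ d` of the chosen affine linear polynomial of `H`. -/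
def HyperplaneArrangement.IntegralForms.eval {B : HyperplaneArrangement K (Fin d → K)}
    (L : B.IntegralForms) {o : Type*} [CommRing o] [Algebra (NumberField.RingOfIntegers K) o]
    (H : B.hyperplanes) (z : Fin d → o) : o :=
  algebraMap _ o (L.const H) + ∑ j, algebraMap _ o (L.coeff H j) * z j

open Classical in
/-- `‖B_x‖(z)`, the maximum of the `|L_H(z)|` over the hyperplanes `H` of `B` that contain `x`. -/
def HyperplaneArrangement.IntegralForms.maxAbs {B : HyperplaneArrangement K (Fin d → K)}
    (L : B.IntegralForms) {o : Type*} [CommRing o] [IsDomain o] [IsDiscreteValuationRing o]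
    [Algebra (NumberField.RingOfIntegers K) o] (x : B.PosFlat) (z : Fin d → o) : NNReal :=
  (Finset.univ.filter fun H : B.hyperplanes => x.1.space ≤ H.1).sup fun H => dvrAbs (L.eval H z)

/-- The analytic zeta function `∫_{o^d} ∏_x ‖B_x‖^{s_x} dX` of `B` over the compact discrete
valuation ring `o`, with respect to the Haar measure on `o ^ d` of total mass `1`. -/
def HyperplaneArrangement.IntegralForms.analyticZeta
    {B : HyperplaneArrangement K (Fin d → K)} (L : B.IntegralForms) (o : Type*) [CommRing o]
    [IsDomain o] [IsDiscreteValuationRing o] [TopologicalSpace o] [IsTopologicalRing o]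
    [CompactSpace o] [Algebra (NumberField.RingOfIntegers K) o] (s : B.PosFlat → ℂ) : ℂ :=
  letI : MeasurableSpace o := borel o
  haveI : BorelSpace o := ⟨rfl⟩
  ∫ z : Fin d → o, ∏ x : B.PosFlat, (((L.maxAbs x z : NNReal) : ℝ) : ℂ) ^ s x
    ∂(Measure.pi fun _ : Fin d => Measure.addHaarMeasure (⊤ : TopologicalSpace.PositiveCompacts o))

/-- `o'` is an unramified extension of degree `f` of the discrete valuation ring `o`. -/
def IsUnramifiedOfDegree (o o' : Type*) [CommRing o] [IsDomain o] [IsDiscreteValuationRing o]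
    [CommRing o'] [IsDomain o'] [IsDiscreteValuationRing o'] [Algebra o o'] (f : ℕ) : Prop :=
  Module.Finite o o' ∧ Module.finrank o o' = f ∧
    (IsLocalRing.maximalIdeal o).map (algebraMap o o') = IsLocalRing.maximalIdeal o'

end Analytic

/-! ### Topological zeta functions -/

/-- For `a` in a field `k` of characteristic zero, the power
`Q ^ a = ∑_j a (a - 1) ⋯ (a - j + 1) / j! * (Q - 1) ^ j`, as a power series in `Q - 1`. -/
def qPow {k : Type*} [Field k] (a : k) : PowerSeries k :=
  PowerSeries.mk fun j => (∏ i ∈ Finset.range j, (a - i)) / (j.factorial : k)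

namespace HyperplaneArrangement

variable {F V : Type*} [Field F] [AddCommGroup V] [Module F V]

/-- The substitution `W(Y, T) ↦ W(-Q⁻¹, Q ^ (-s))` into power series in `Q - 1` over `ℚ(s)`; the
variable `none` stands for `Y` and `some x` for `T_x`. -/
def expand (A : HyperplaneArrangement F V) (W : MvPolynomial (Option A.PosFlat) ℚ) :
    PowerSeries A.RatFun :=
  MvPolynomial.eval₂ (algebraMap ℚ (PowerSeries A.RatFun))
    (fun i => i.elim (-qPow (-1)) fun x => qPow (-A.var x)) W

/-- The value `W(-q⁻¹, q ^ (-s))` for a positive integer `q` and complex numbers `s_x`. -/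
def evalAt (A : HyperplaneArrangement F V) (W : MvPolynomial (Option A.PosFlat) ℚ) (q : ℕ)
    (s : A.PosFlat → ℂ) : ℂ :=
  MvPolynomial.eval₂ (algebraMap ℚ ℂ)
    (fun i => i.elim (-(q : ℂ)⁻¹) fun x => (q : ℂ) ^ (-s x)) W

/-- The bijection on the flats different from the bottom elements given by an isomorphism of
intersection posets. -/
def posMap {F' V' : Type*} [Field F'] [AddCommGroup V'] [Module F' V']
    {A : HyperplaneArrangement F V} {B : HyperplaneArrangement F' V'} (φ : B.Flat ≃o A.Flat)
    (x : B.PosFlat) : A.PosFlat :=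
  ⟨φ x.1, by simpa using x.2⟩

/-- `Z(s)` is the limit, as `f → 0`, of the analytic zeta functions of `B` over the unramified
extensions `o^(f)`, `f ≥ 1`, of `o`, the variables being renamed along `φ`.  That is: there is a
(necessarily unique) rational function `W = P / D` in `Y` and the `T_x` such that the analytic zeta
function over `o^(f)` is `W(-q ^ (-f), q ^ (-f s))` for all `f ≥ 1` (denominators cleared), with `q` the cardinality of the residue field
of `o`, and `Z(s)` is the constant term of the expansion of `W(-Q⁻¹, Q ^ (-s))` as a power series
in `Q - 1`. -/
def IsUnramifiedLimit {K : Type} [Field K] [NumberField K] {d : ℕ}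
    {A : HyperplaneArrangement F V} {B : HyperplaneArrangement K (Fin d → K)}
    (φ : B.Flat ≃o A.Flat) (L : B.IntegralForms) (o : Type) [CommRing o] [IsDomain o]
    [IsDiscreteValuationRing o] [Algebra (NumberField.RingOfIntegers K) o] (Z : A.RatFun) : Prop :=
  ∃ P D : MvPolynomial (Option A.PosFlat) ℚ,
    (∀ (f : ℕ), 1 ≤ f → ∀ (o' : Type) [CommRing o'] [IsDomain o'] [IsDiscreteValuationRing o']
      [TopologicalSpace o'] [IsTopologicalRing o'] [CompactSpace o'] [T2Space o']
      [Algebra (NumberField.RingOfIntegers K) o'] [Algebra o o']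
      [IsScalarTower (NumberField.RingOfIntegers K) o o'],
      IsUnramifiedOfDegree o o' f →
      ∀ s : A.PosFlat → ℂ, (∀ x, 0 < (s x).re) →
        A.evalAt D (Nat.card (IsLocalRing.ResidueField o) ^ f) s *
            L.analyticZeta o' (fun x => s (posMap φ x)) =
          A.evalAt P (Nat.card (IsLocalRing.ResidueField o) ^ f) s) ∧
    A.expand D ≠ 0 ∧
    ∃ z : PowerSeries A.RatFun, z * A.expand D = A.expand P ∧ PowerSeries.constantCoeff z = Z

/-- `Z` is the multivariate topological zeta function of the arrangement `A` over a field of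
characteristic zero: for all representations `B` of `A` over number fields `K`, given by affine
linear polynomials over the ring of integers, and all compact discrete valuation rings `o` over
the ring of integers whose residue characteristic avoids a finite set of primes, `Z` is the limit,
as `f → 0`, of the analytic zeta functions of `B` over the unramified extensions `o^(f)`. -/
def IsTopologicalZeta (A : HyperplaneArrangement F V) (Z : A.RatFun) : Prop :=
  ∀ (K : Type) [Field K] [NumberField K] (d : ℕ) (B : HyperplaneArrangement K (Fin d → K)),
    B.ambient = ⊤ → ∀ (φ : B.Flat ≃o A.Flat) (L : B.IntegralForms),
    ∃ S : Finset ℕ, ∀ (o : Type) [CommRing o] [IsDomain o] [IsDiscreteValuationRing o]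
      [TopologicalSpace o] [IsTopologicalRing o] [CompactSpace o] [T2Space o]
      [Algebra (NumberField.RingOfIntegers K) o],
      ringChar (IsLocalRing.ResidueField o) ∉ S → IsUnramifiedLimit φ L o Z

end HyperplaneArrangement

/-! ### Generic central arrangements -/

/-- `A` is a generic central arrangement `U_{n,m}`: it consists of the hyperplanes `H₁, …, H_m`
through the origin of `F ^ n`, and for each `k ≤ n` the intersection of any `k` of them has
codimension `k`. -/
structure IsGenericCentral {F : Type*} [Field F] {n m : ℕ}
    (A : HyperplaneArrangement F (Fin n → F)) (H : Fin m → AffineSubspace F (Fin n → F)) :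
    Prop where
  ambient_eq : A.ambient = ⊤
  mem_hyperplanes : ∀ X, X ∈ A.hyperplanes ↔ ∃ i, H i = X
  zero_mem : ∀ i, (0 : Fin n → F) ∈ H i
  codim : ∀ I : Finset (Fin m), I.card ≤ n →
    Module.finrank F (I.inf H).direction + I.card = n

/-- The chains of nonempty subsets of `I`. -/
def weakOrderChains {α : Type*} [DecidableEq α] (I : Finset α) : Finset (Finset (Finset α)) :=
  open Classical in
  (I.powerset.erase ∅).powerset.filter fun C => IsChain (· ⊆ ·) (C : Set (Finset α))

/-- The weak order zeta function of the variables `t_J`, for the nonempty subsets `J` of `I`. -/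
def weakOrderZeta {α k : Type*} [DecidableEq α] [Field k] (I : Finset α) (t : Finset α → k) : k :=
  ∑ C ∈ weakOrderChains I, ∏ J ∈ C, t J / (1 - t J)

end

/-!
In a generic central arrangement a flat is determined by the set of the hyperplanes containing it,
and the sets that occur are those with fewer than `n` elements and `univ`. Every interval of this
truncated Boolean lattice is again truncated Boolean, so the Poincaré polynomials occurring in
`fHP` are those of generic arrangements. The flags are chains of sets of fewer than `n` elements,
with the top flat optionally added; the two options together produce the factor `1 / (1 - t univ)`,
and summation over the largest set in the chain gives the first formula.

For almost all residue characteristics any `n` of the forms `L_H` are independent and uniformly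
distributed and generate the others. Sort the points of `𝔬^d` by the set `I` of the forms in `U`
that vanish in the residue field, and scale the part where all of them vanish by a uniformizer.
This expresses the integral over the forms in `U` through those over its proper subsets, by
coefficients rational in `q⁻¹` and the `q ^ (-s_x)`. In the topological limit the coefficient of `I`
becomes an alternating sum of binomial coefficients. While `#U ≤ n` it vanishes unless `I` omits a
single element of `U`, so that complete chains of subsets remain, and only the last step, to
`U = univ`, involves the other coefficients.
-/

/-! ### Truncated Boolean lattices -/

section

open Finset Polynomial

/-- The Poincaré polynomial of a generic central arrangement of `M` hyperplanes of rank `r`. -/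
noncomputable def genericPoincare (r M : ℕ) : ℤ[X] :=
  if r = 0 then 1 else (1 + X) * ∑ k ∈ range r, ((M - 1).choose k : ℤ[X]) * X ^ k

theorem genericPoincare_zero (M : ℕ) : genericPoincare 0 M = 1 := if_pos rfl

theorem genericPoincare_succ_succ (r M : ℕ) :
    genericPoincare (r + 1) (M + 1) =
      ∑ k ∈ range (r + 1), ((M + 1).choose k : ℤ[X]) * X ^ k +
        (M.choose r : ℤ[X]) * X ^ (r + 1) := by
  rw [genericPoincare, if_neg r.succ_ne_zero, Nat.add_sub_cancel]
  induction r with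
  | zero => simp
  | succ r ih =>
    rw [sum_range_succ, sum_range_succ _ (r + 1), mul_add, ih, Nat.choose_succ_succ]
    push_cast
    ring

theorem genericPoincare_self (M : ℕ) : genericPoincare M M = (1 + X) ^ M := by
  cases M with
  | zero => simp [genericPoincare_zero]
  | succ M =>
    rw [genericPoincare, if_neg M.succ_ne_zero, Nat.add_sub_cancel, pow_succ',
      add_comm (1 : ℤ[X]) X, add_pow]
    exact congrArg _ (sum_congr rfl fun k _ => by simp [mul_comm])

theorem mu_bot_eq_of_sum_Iic {P R : Type*} [Ring R] [PartialOrder P] [OrderBot P]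
    [LocallyFiniteOrder P] [DecidableEq P] {f : P → R}
    (hf : ∀ x, ∑ y ∈ Iic x, f y = if x = ⊥ then 1 else 0) (x : P) :
    IncidenceAlgebra.mu R ⊥ x = f x := by
  rw [IncidenceAlgebra.moebius_inversion_bot f _ (fun x => (hf x).symm) x]
  simp

theorem height_eq_of_strictMono_of_exists_lt {P : Type*} [Preorder P] {ρ : P → ℕ}
    (hρ : StrictMono ρ) (hpred : ∀ x, ρ x ≠ 0 → ∃ y < x, ρ x ≤ ρ y + 1) (x : P) :
    Order.height x = ρ x := by
  induction hk : ρ x using Nat.strong_induction_on generalizing x with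
  | _ k ih =>
    subst hk
    apply le_antisymm
    · rw [Order.height_le_coe_iff]
      intro y hy
      rw [ih _ (hρ hy) y rfl]
      exact_mod_cast hρ hy
    · rcases eq_or_ne (ρ x) 0 with h0 | h0
      · simp [h0]
      · obtain ⟨y, hy, hxy⟩ := hpred x h0
        calc (ρ x : ℕ∞) ≤ ρ y + 1 := by exact_mod_cast hxy
          _ = Order.height y + 1 := by rw [ih _ (hρ hy) y rfl]
          _ ≤ Order.height x := Order.height_add_one_le hy

section TruncatedPowerset

variable {ι : Type*} [DecidableEq ι] {U : Finset ι} {r : ℕ}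

theorem sum_powerset_filter_card_lt_or_eq {M : Type*} [AddCommMonoid M] (hr : r ≤ #U) (f : ℕ → M) :
    ∑ K ∈ U.powerset with #K < r ∨ K = U, f #K = ∑ k ∈ range r, (#U).choose k • f k + f #U := by
  have hfilter : (range (#U + 1)).filter (fun k => k < r ∨ k = #U) = insert #U (range r) := by
    grind
  calc ∑ K ∈ U.powerset with #K < r ∨ K = U, f #K
      = ∑ K ∈ U.powerset, if #K < r ∨ #K = #U then f #K else 0 := by
        rw [sum_filter]
        refine sum_congr rfl fun K hK => if_congr (or_congr_right ?_) rfl rfl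
        exact ⟨congrArg card, eq_of_subset_of_card_le (mem_powerset.1 hK) ∘ Eq.ge⟩
    _ = ∑ k ∈ insert #U (range r), (#U).choose k • f k := by
        rw [sum_powerset_apply_card (fun k => if k < r ∨ k = #U then f k else 0), ← hfilter,
          sum_filter]
        simp only [smul_ite, smul_zero]
    _ = _ := by rw [sum_insert (by simpa using hr), Nat.choose_self, one_smul, add_comm]

/-- The Möbius function `μ(∅, K)` for `#K = k`, in the lattice of those subsets of an `M`-element
set that have fewer than `r` elements or are the whole set. -/
def truncatedBooleanMu (r M k : ℕ) : ℤ :=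
  if k < r then (-1) ^ k else (-1) ^ r * (M - 1).choose (r - 1)

theorem sum_truncatedBooleanMu (hr : 1 ≤ r) (hrU : r ≤ #U) {L : Finset ι} (hL : #L < r ∨ L = U) :
    ∑ K ∈ L.powerset with #K < r ∨ K = U, truncatedBooleanMu r #U #K =
      if L = ∅ then 1 else 0 := by
  rcases hL with hL | rfl
  · have hlt : ∀ K ∈ L.powerset, #K < r := fun K hK =>
      (card_le_card (mem_powerset.1 hK)).trans_lt hL
    rw [filter_true_of_mem fun K hK => Or.inl (hlt K hK), ← sum_powerset_neg_one_pow_card]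
    exact sum_congr rfl fun K hK => if_pos (hlt K hK)
  · obtain ⟨r, rfl⟩ := Nat.exists_eq_add_of_le' hr
    obtain ⟨M, hM⟩ := Nat.exists_eq_add_of_le' (hr.trans hrU)
    have hlow : ∑ k ∈ range (r + 1), (M + 1).choose k • truncatedBooleanMu (r + 1) (M + 1) k =
        ∑ k ∈ range (r + 1), (-1) ^ k * ((M + 1).choose k : ℤ) :=
      sum_congr rfl fun k hk => by
        rw [truncatedBooleanMu, if_pos (mem_range.1 hk), nsmul_eq_mul, mul_comm]
    rw [sum_powerset_filter_card_lt_or_eq hrU, hM, hlow, Int.alternating_sum_range_choose_eq_choose,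
      truncatedBooleanMu, if_neg (by omega), if_neg (by rintro rfl; simp at hM)]
    simp only [Nat.add_sub_cancel, pow_succ]
    ring

theorem sum_C_truncatedBooleanMu_mul_pow (hr : 1 ≤ r) (hrU : r ≤ #U) :
    ∑ K ∈ U.powerset with #K < r ∨ K = U,
      C (truncatedBooleanMu r #U #K) * (-X : ℤ[X]) ^ min #K r = genericPoincare r #U := by
  rw [sum_powerset_filter_card_lt_or_eq hrU
    fun k => C (truncatedBooleanMu r #U k) * (-X : ℤ[X]) ^ min k r]
  obtain ⟨r, rfl⟩ := Nat.exists_eq_add_of_le' hr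
  obtain ⟨M, hM⟩ := Nat.exists_eq_add_of_le' (hr.trans hrU)
  rw [hM, genericPoincare_succ_succ]
  congr 1
  · refine sum_congr rfl fun k hk => ?_
    rw [truncatedBooleanMu, if_pos (mem_range.1 hk), min_eq_left (mem_range.1 hk).le, map_pow,
      ← mul_pow, nsmul_eq_mul]
    simp
  · rw [truncatedBooleanMu, if_neg (by omega), min_eq_right (by omega), map_mul, map_pow,
      mul_right_comm, ← mul_pow]
    simp [mul_comm]

end TruncatedPowerset

section TruncatedBoolean

variable {ι P : Type*} [PartialOrder P]

/-- The poset `P` is, by means of `σ`, a truncated Boolean lattice: it is the lattice of the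
subsets of `U` that have fewer than `r` elements or are equal to `U`. -/
structure IsTruncatedBoolean (P : Type*) [PartialOrder P] (σ : P → Finset ι) (U : Finset ι)
    (r : ℕ) : Prop where
  le_iff : ∀ x y, x ≤ y ↔ σ x ⊆ σ y
  exists_iff : ∀ K, (∃ x, σ x = K) ↔ K ⊆ U ∧ (#K < r ∨ K = U)

namespace IsTruncatedBoolean

variable {σ : P → Finset ι} {U : Finset ι} {r : ℕ}

theorem injective (h : IsTruncatedBoolean P σ U r) : Function.Injective σ := fun x y hxy =>
  le_antisymm ((h.le_iff x y).2 hxy.le) ((h.le_iff y x).2 hxy.ge)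

theorem subset (h : IsTruncatedBoolean P σ U r) (x : P) : σ x ⊆ U := ((h.exists_iff _).1 ⟨x, rfl⟩).1

theorem card_lt_or_eq (h : IsTruncatedBoolean P σ U r) (x : P) : #(σ x) < r ∨ σ x = U :=
  ((h.exists_iff _).1 ⟨x, rfl⟩).2

theorem lt_iff (h : IsTruncatedBoolean P σ U r) (x y : P) : x < y ↔ σ x ⊂ σ y := by
  rw [lt_iff_le_not_ge, h.le_iff, h.le_iff, Finset.ssubset_def]

theorem map_bot [OrderBot P] (h : IsTruncatedBoolean P σ U r) (hr : r = 0 → U = ∅) :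
    σ ⊥ = ∅ := by
  have h0 : #(∅ : Finset ι) < r ∨ ∅ = U :=
    r.eq_zero_or_pos.symm.imp (by simp) fun h0 => (hr h0).symm
  obtain ⟨x, hx⟩ := (h.exists_iff ∅).2 ⟨empty_subset _, h0⟩
  exact subset_empty.1 (hx ▸ (h.le_iff ⊥ x).1 bot_le)

theorem height_eq (h : IsTruncatedBoolean P σ U r) (x : P) :
    Order.height x = ((min #(σ x) r : ℕ) : ℕ∞) := by
  refine height_eq_of_strictMono_of_exists_lt (ρ := fun x => min #(σ x) r) ?_ ?_ x
  · intro y x hyx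
    have hssub := (h.lt_iff y x).1 hyx
    have hcard := card_lt_card hssub
    have hy := (h.card_lt_or_eq y).resolve_right fun hU =>
      not_ssubset_of_subset (h.subset x) (hU ▸ hssub)
    simp only
    omega
  · intro x hx
    have hle : min #(σ x) r - 1 ≤ #(σ x) := by omega
    obtain ⟨K, hK, hKc⟩ := exists_subset_card_eq hle
    obtain ⟨y, rfl⟩ := (h.exists_iff K).2 ⟨hK.trans (h.subset x), Or.inl (by omega)⟩
    have hne : σ y ≠ σ x := fun h => by rw [h] at hKc; omega
    exact ⟨y, (h.lt_iff y x).2 (ssubset_of_subset_of_ne hK hne), by omega⟩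

variable [OrderBot P] [LocallyFiniteOrder P]

theorem sum_Iic [DecidableEq ι] {M : Type*} [AddCommMonoid M]
    (h : IsTruncatedBoolean P σ U r) (f : Finset ι → M) (x : P) :
    ∑ y ∈ Iic x, f (σ y) = ∑ K ∈ (σ x).powerset with #K < r ∨ K = U, f K := by
  refine sum_bij (fun y _ => σ y) (fun y hy => ?_) (fun _ _ _ _ hyz => h.injective hyz)
    (fun K hK => ?_) (fun _ _ => rfl)
  · exact mem_filter.2 ⟨mem_powerset.2 ((h.le_iff _ _).1 (mem_Iic.1 hy)), h.card_lt_or_eq y⟩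
  · obtain ⟨hKx, hK⟩ := mem_filter.1 hK
    rw [mem_powerset] at hKx
    obtain ⟨y, rfl⟩ := (h.exists_iff K).2 ⟨hKx.trans (h.subset x), hK⟩
    exact ⟨y, mem_Iic.2 ((h.le_iff _ _).2 hKx), rfl⟩

theorem mu_bot_eq [DecidableEq P] (h : IsTruncatedBoolean P σ U r) (hr : 1 ≤ r) (hrU : r ≤ #U)
    (x : P) : IncidenceAlgebra.mu ℤ (⊥ : P) x = truncatedBooleanMu r #U #(σ x) := by
  classical
  refine mu_bot_eq_of_sum_Iic (f := fun x => truncatedBooleanMu r #U #(σ x)) (fun x => ?_) x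
  rw [h.sum_Iic (fun K => truncatedBooleanMu r #U #K),
    sum_truncatedBooleanMu hr hrU (h.card_lt_or_eq x)]
  exact if_congr (by rw [← h.map_bot (by omega), h.injective.eq_iff]) rfl rfl

theorem sum_mu_mul_pow_height [DecidableEq P] [Fintype P] (h : IsTruncatedBoolean P σ U r)
    (hr : r = 0 → U = ∅) (hrU : r ≤ #U) :
    ∑ x : P, C (IncidenceAlgebra.mu ℤ (⊥ : P) x) * (-X : ℤ[X]) ^ (Order.height x).toNat =
      genericPoincare r #U := by
  classical
  rcases Nat.eq_zero_or_pos r with h0 | h0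
  · have hbot : ∀ x : P, x = ⊥ := fun x => h.injective <| by
      rw [h.map_bot hr, ← subset_empty, ← hr h0]
      exact h.subset x
    rw [Fintype.sum_eq_single ⊥ fun x hx => absurd (hbot x) hx]
    simp [h0, genericPoincare_zero]
  · obtain ⟨x₁, hx₁⟩ := (h.exists_iff U).2 ⟨subset_rfl, Or.inr rfl⟩
    have huniv : (univ : Finset P) = Iic x₁ :=
      (eq_univ_of_forall fun x => mem_Iic.2 ((h.le_iff _ _).2 (hx₁ ▸ h.subset x))).symm
    simp only [h.mu_bot_eq h0 hrU, h.height_eq, ENat.toNat_natCast]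
    rw [huniv, h.sum_Iic (fun K => C (truncatedBooleanMu r #U #K) * (-X : ℤ[X]) ^ min #K r), hx₁,
      sum_C_truncatedBooleanMu_mul_pow h0 hrU]

end IsTruncatedBoolean

end TruncatedBoolean

end

/-! ### Flats of generic central arrangements -/

section

open Finset Polynomial

namespace HyperplaneArrangement

variable {F V : Type*} [Field F] [AddCommGroup V] [Module F V]

theorem Flat.space_injective (A : HyperplaneArrangement F V) :
    Function.Injective (Flat.space : A.Flat → AffineSubspace F V) := fun _ _ h =>
  Subtype.ext (congrArg OrderDual.toDual h)

theorem Flat.le_iff {A : HyperplaneArrangement F V} (x y : A.Flat) :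
    x ≤ y ↔ y.space ≤ x.space := Iff.rfl

theorem Flat.space_bot (A : HyperplaneArrangement F V) : (⊥ : A.Flat).space = A.ambient := rfl

theorem Flat.space_le_ambient {A : HyperplaneArrangement F V} (x : A.Flat) :
    x.space ≤ A.ambient := (Flat.le_iff _ _).1 bot_le

theorem mem_finset_inf {ι : Type*} {I : Finset ι} {G : ι → AffineSubspace F V} {p : V} :
    p ∈ I.inf G ↔ ∀ i ∈ I, p ∈ G i := by
  simp only [Finset.inf_eq_iInf, AffineSubspace.mem_iInf_iff]

theorem exists_flat_space_eq_iff {A : HyperplaneArrangement F V} {ι : Type*}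
    {G : ι → AffineSubspace F V} {D : Finset ι}
    (hG : ∀ X, X ∈ A.hyperplanes ↔ ∃ i ∈ D, A.ambient ⊓ G i = X) {S : AffineSubspace F V} :
    (∃ x : A.Flat, x.space = S) ↔ (S : Set V).Nonempty ∧ ∃ K ⊆ D, A.ambient ⊓ K.inf G = S := by
  classical
  have hinf (K : Finset ι) : A.ambient ⊓ (K.image (A.ambient ⊓ G ·)).inf id =
      A.ambient ⊓ K.inf G := by
    rw [inf_image]
    refine le_antisymm (le_inf inf_le_left ?_) (le_inf inf_le_left ?_) <;>
      refine Finset.le_inf fun i hi => ?_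
    · exact inf_le_right.trans ((Finset.inf_le hi).trans inf_le_right)
    · exact le_inf inf_le_left (inf_le_right.trans (Finset.inf_le hi))
  have himage : A.hyperplanes = D.image (A.ambient ⊓ G ·) := by
    ext X
    rw [hG, mem_image]
  constructor
  · rintro ⟨⟨x, hx, B, hB, h⟩, rfl⟩
    obtain ⟨K, hK, rfl⟩ := subset_image_iff.1 (himage ▸ hB)
    exact ⟨hx, K, hK, (hinf K).symm.trans h⟩
  · rintro ⟨hS, K, hK, rfl⟩
    exact ⟨⟨OrderDual.toDual _, hS, _, himage ▸ image_subset_image hK, hinf K⟩, rfl⟩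

open Classical in
/-- The set of the indices of the hyperplanes that contain an affine subspace. -/
noncomputable def support {ι : Type*} [Fintype ι] (H : ι → AffineSubspace F V)
    (S : AffineSubspace F V) : Finset ι := univ.filter fun i => S ≤ H i

section Support

variable {ι : Type*} [Fintype ι] {H : ι → AffineSubspace F V} {S T : AffineSubspace F V}

theorem mem_support {i : ι} : i ∈ support H S ↔ S ≤ H i := by simp [support]

theorem subset_support_iff {I : Finset ι} : I ⊆ support H S ↔ S ≤ I.inf H := by
  simp [subset_iff, mem_support, Finset.le_inf_iff]

theorem support_antitone (h : S ≤ T) : support H T ⊆ support H S := fun _ hi =>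
  mem_support.2 (h.trans (mem_support.1 hi))

theorem inf_support_inf (I : Finset ι) : (support H (I.inf H)).inf H = I.inf H :=
  le_antisymm (Finset.inf_mono (subset_support_iff.2 le_rfl)) (subset_support_iff.1 subset_rfl)

end Support

end HyperplaneArrangement

open HyperplaneArrangement

namespace IsGenericCentral

variable {F : Type*} [Field F] {n m : ℕ} {A : HyperplaneArrangement F (Fin n → F)}
  {H : Fin m → AffineSubspace F (Fin n → F)}

theorem zero_mem_inf (hA : IsGenericCentral A H) (I : Finset (Fin m)) :
    (0 : Fin n → F) ∈ I.inf H :=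
  mem_finset_inf.2 fun i _ => hA.zero_mem i

theorem support_inf_of_lt (hA : IsGenericCentral A H) {I : Finset (Fin m)} (hI : #I < n) :
    support H (I.inf H) = I := by
  classical
  ext i
  rw [mem_support]
  refine ⟨fun hle => ?_, fun hi => Finset.inf_le hi⟩
  by_contra hi
  have hcodim := hA.codim I hI.le
  have hcodim_insert := hA.codim (insert i I) (by rw [card_insert_of_notMem hi]; omega)
  rw [card_insert_of_notMem hi, inf_insert, inf_eq_right.2 hle] at hcodim_insert
  omega

theorem support_inf_of_le (hA : IsGenericCentral A H) {I : Finset (Fin m)} (hI : n ≤ #I) :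
    support H (I.inf H) = univ := by
  obtain ⟨J, hJ, hJn⟩ := exists_subset_card_eq hI
  have hcodim := hA.codim J hJn.le
  have hdir : (J.inf H).direction = ⊥ := Submodule.finrank_eq_zero.1 (by omega)
  refine eq_univ_of_forall fun i => mem_support.2 ((Finset.inf_mono hJ).trans fun x hx => ?_)
  obtain rfl : x = 0 := by
    simpa [hdir] using AffineSubspace.vsub_mem_direction hx (hA.zero_mem_inf J)
  exact hA.zero_mem i

theorem support_inf (hA : IsGenericCentral A H) (I : Finset (Fin m)) :
    support H (I.inf H) = if #I < n then I else univ := by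
  split_ifs with h
  · exact hA.support_inf_of_lt h
  · exact hA.support_inf_of_le (not_lt.1 h)

theorem exists_flat_space_eq_iff (hA : IsGenericCentral A H) {S : AffineSubspace F (Fin n → F)} :
    (∃ x : A.Flat, x.space = S) ↔ ∃ I : Finset (Fin m), I.inf H = S := by
  rw [HyperplaneArrangement.exists_flat_space_eq_iff (G := H) (D := univ) fun X => by
    simp [hA.mem_hyperplanes, hA.ambient_eq]]
  simp only [hA.ambient_eq, top_inf_eq, subset_univ, true_and]
  refine and_iff_right_of_imp ?_
  rintro ⟨I, rfl⟩
  exact ⟨0, hA.zero_mem_inf I⟩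

/-- The intersection of a set of hyperplanes of a generic central arrangement. -/
noncomputable def flat (hA : IsGenericCentral A H) (I : Finset (Fin m)) : A.Flat :=
  (hA.exists_flat_space_eq_iff.2 ⟨I, rfl⟩).choose

theorem flat_space (hA : IsGenericCentral A H) (I : Finset (Fin m)) :
    (hA.flat I).space = I.inf H := (hA.exists_flat_space_eq_iff.2 ⟨I, rfl⟩).choose_spec

theorem space_eq_inf (hA : IsGenericCentral A H) (x : A.Flat) :
    x.space = (support H x.space).inf H := by
  obtain ⟨I, hI⟩ := hA.exists_flat_space_eq_iff.1 ⟨x, rfl⟩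
  rw [← hI, inf_support_inf]

theorem card_support_lt_or_eq_univ (hA : IsGenericCentral A H) (x : A.Flat) :
    #(support H x.space) < n ∨ support H x.space = univ := by
  have h := hA.support_inf (support H x.space)
  rw [← hA.space_eq_inf] at h
  split_ifs at h with hlt
  exacts [Or.inl hlt, Or.inr h]

theorem isTruncatedBoolean (hA : IsGenericCentral A H) :
    IsTruncatedBoolean A.Flat (fun x => support H x.space) univ n where
  le_iff x y := by rw [Flat.le_iff, subset_support_iff, ← hA.space_eq_inf]
  exists_iff K := by
    refine ⟨?_, fun ⟨_, hK⟩ => ⟨hA.flat K, ?_⟩⟩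
    · rintro ⟨x, rfl⟩
      exact ⟨subset_univ _, hA.card_support_lt_or_eq_univ x⟩
    · rw [hA.flat_space, hA.support_inf]
      split_ifs with h
      exacts [rfl, (hK.resolve_left h).symm]

section RestrictSub

variable (hA : IsGenericCentral A H) {x : A.Flat} {y : AffineSubspace F (Fin n → F)}
  (hxy : y ≤ x.space)

include hA hxy

theorem mem_hyperplanes_restrict_sub {X : AffineSubspace F (Fin n → F)} :
    X ∈ ((A.restrict x).sub y).hyperplanes ↔
      ∃ i ∈ support H y \ support H x.space, x.space ⊓ H i = X := by
  simp only [HyperplaneArrangement.sub, HyperplaneArrangement.restrict, mem_filter, mem_image,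
    mem_sdiff, mem_support]
  constructor
  · rintro ⟨⟨Y, ⟨hYA, hxY, -⟩, rfl⟩, hy⟩
    obtain ⟨i, rfl⟩ := (hA.mem_hyperplanes _).1 hYA
    exact ⟨i, ⟨hy.trans inf_le_right, hxY⟩, rfl⟩
  · rintro ⟨i, ⟨hyi, hxi⟩, rfl⟩
    have hx0 : (0 : Fin n → F) ∈ x.space := by
      rw [hA.space_eq_inf]
      exact hA.zero_mem_inf _
    exact ⟨⟨H i, ⟨(hA.mem_hyperplanes _).2 ⟨i, rfl⟩, hxi, 0, hx0, hA.zero_mem i⟩, rfl⟩,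
      le_inf hxy hyi⟩

theorem exists_flat_restrict_sub_space_eq_iff {S : AffineSubspace F (Fin n → F)} :
    (∃ z : ((A.restrict x).sub y).Flat, z.space = S) ↔
      ∃ K ⊆ support H y \ support H x.space, (support H x.space ∪ K).inf H = S := by
  have hx (K : Finset (Fin m)) : x.space ⊓ K.inf H = (support H x.space ∪ K).inf H := by
    rw [inf_union, ← hA.space_eq_inf]
  rw [HyperplaneArrangement.exists_flat_space_eq_iff fun _ =>
    hA.mem_hyperplanes_restrict_sub hxy]
  change _ ∧ (∃ K ⊆ support H y \ support H x.space, x.space ⊓ K.inf H = S) ↔ _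
  simp only [hx]
  refine and_iff_right_of_imp ?_
  rintro ⟨K, -, rfl⟩
  exact ⟨0, hA.zero_mem_inf _⟩

theorem exists_support_flat_restrict_sub_iff (hy : #(support H y) < n ∨ support H y = univ)
    (K : Finset (Fin m)) :
    (∃ z : ((A.restrict x).sub y).Flat, support H z.space \ support H x.space = K) ↔
      K ⊆ support H y \ support H x.space ∧
        (#K < min #(support H y) n - #(support H x.space) ∨
          K = support H y \ support H x.space) := by
  have hsub := support_antitone (H := H) hxy
  have hspace : (∃ z : ((A.restrict x).sub y).Flat, support H z.space \ support H x.space = K) ↔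
      ∃ K' ⊆ support H y \ support H x.space,
        support H ((support H x.space ∪ K').inf H) \ support H x.space = K := by
    rw [← Function.Surjective.exists (p := fun S : {S // ∃ z : ((A.restrict x).sub y).Flat,
      z.space = S} => support H S.1 \ support H x.space = K)
      (f := fun z => ⟨z.space, z, rfl⟩) (by rintro ⟨_, z, rfl⟩; exact ⟨z, rfl⟩)]
    simp only [Subtype.exists, hA.exists_flat_restrict_sub_space_eq_iff hxy]
    grind
  have hcard {K' : Finset (Fin m)} (hK' : K' ⊆ support H y \ support H x.space) :
      #(support H x.space ∪ K') = #(support H x.space) + #K' :=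
    card_union_of_disjoint (disjoint_of_subset_right hK' disjoint_sdiff)
  have hcard_sdiff := card_sdiff_of_subset hsub
  have hcard_le := card_le_card hsub
  rw [hspace]
  constructor
  · rintro ⟨K', hK', rfl⟩
    rw [hA.support_inf, hcard hK']
    split_ifs with hlt
    · rw [union_sdiff_left, sdiff_eq_self_of_disjoint (disjoint_of_subset_left hK' sdiff_disjoint)]
      refine ⟨hK', (eq_or_ssubset_of_subset hK').symm.imp_left fun hss => ?_⟩
      have := card_lt_card hss
      omega
    · have := card_le_card hK'
      rw [hy.resolve_left (by omega)]
      exact ⟨subset_rfl, Or.inr rfl⟩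
  · rintro ⟨hK, hlt⟩
    refine ⟨K, hK, ?_⟩
    rw [hA.support_inf, hcard hK]
    split_ifs with hn
    · rw [union_sdiff_left, sdiff_eq_self_of_disjoint (disjoint_of_subset_left hK sdiff_disjoint)]
    · rcases hlt with hlt | rfl
      · omega
      · rw [hy.resolve_left (by omega)]

theorem isTruncatedBoolean_restrict_sub (hy : #(support H y) < n ∨ support H y = univ) :
    IsTruncatedBoolean ((A.restrict x).sub y).Flat
      (fun z => support H z.space \ support H x.space) (support H y \ support H x.space)
      (min #(support H y) n - #(support H x.space)) where
  le_iff z w := by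
    have hz : z.space = (support H z.space).inf H := by
      obtain ⟨K, -, hK⟩ := (hA.exists_flat_restrict_sub_space_eq_iff hxy).1 ⟨z, rfl⟩
      rw [← hK, inf_support_inf]
    have hxw : support H x.space ⊆ support H w.space := support_antitone w.space_le_ambient
    rw [Flat.le_iff, hz, ← subset_support_iff, ← hz]
    exact ⟨fun h => sdiff_subset_sdiff h subset_rfl, fun h =>
      le_sdiff_sup.trans (union_subset (h.trans sdiff_subset) hxw)⟩
  exists_iff := hA.exists_support_flat_restrict_sub_iff hxy hy

theorem poincare_restrict_sub (hnm : n ≤ m) (hy : #(support H y) < n ∨ support H y = univ) :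
    ((A.restrict x).sub y).poincare = genericPoincare
      (min #(support H y) n - #(support H x.space)) (#(support H y) - #(support H x.space)) := by
  classical
  have hcard := card_sdiff_of_subset (support_antitone (H := H) hxy)
  rw [poincare, (hA.isTruncatedBoolean_restrict_sub hxy hy).sum_mu_mul_pow_height, hcard]
  · intro hrank
    rcases hy with hy | hy
    · rw [← card_eq_zero, hcard]
      omega
    · rcases hA.card_support_lt_or_eq_univ x with hx | hx
      · rw [hy, card_fin] at hrank
        omega
      · rw [hx, sdiff_eq_empty_iff_subset]
        exact subset_univ _
  · rw [hcard]
    omega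

end RestrictSub

end IsGenericCentral

end

section

open Finset Polynomial

namespace HyperplaneArrangement

variable {F V : Type*} [Field F] [AddCommGroup V] [Module F V] {A : HyperplaneArrangement F V}
  {Φ : Finset A.PosFlat} {x : A.Flat}

theorem flagNext_le_space : flagNext Φ x ≤ x.space :=
  iSup₂_le fun _ _ => iSup_le fun hxy => (Flat.le_iff _ _).1 hxy.le

theorem flagNext_eq_space {y : A.PosFlat} (hy : y ∈ Φ) (hxy : x < y.1)
    (hmin : ∀ z ∈ Φ, x < z.1 → y ≤ z) : flagNext Φ x = y.1.space :=
  le_antisymm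
    (iSup₂_le fun z hz => iSup_le fun hxz => (Flat.le_iff y.1 z.1).1 (hmin z hz hxz))
    (le_iSup₂_of_le y hy (le_iSup_of_le hxy le_rfl))

theorem support_flagNext_eq_univ {ι : Type*} [Fintype ι] {H : ι → AffineSubspace F V}
    (h : ∀ y ∈ Φ, x < y.1 → support H y.1.space = univ) : support H (flagNext Φ x) = univ :=
  eq_univ_of_forall fun i => mem_support.2 <| iSup₂_le fun y hy => iSup_le fun hxy =>
    mem_support.1 ((h y hy hxy).symm ▸ mem_univ i)

open Classical in
/-- The flats of a flag, with the bottom element added. -/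
noncomputable def flagFlats (Φ : Finset A.PosFlat) : Finset A.Flat :=
  insert ⊥ (Φ.image Subtype.val)

theorem mem_flagFlats : x ∈ flagFlats Φ ↔ x = ⊥ ∨ ∃ y ∈ Φ, y.1 = x := by simp [flagFlats]

theorem bot_mem_flagFlats : ⊥ ∈ flagFlats Φ := mem_flagFlats.2 (Or.inl rfl)

theorem isChain_flagFlats (hΦ : IsChain (· ≤ ·) (Φ : Set A.PosFlat)) :
    IsChain (· ≤ ·) (flagFlats Φ : Set A.Flat) := by
  classical
  rw [flagFlats, coe_insert, coe_image]
  exact (hΦ.image_of_map_rel _ _ Subtype.val fun _ _ h => h).insert fun _ _ _ => Or.inl bot_le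

theorem exists_flagNext_eq_space (hΦ : IsChain (· ≤ ·) (Φ : Set A.PosFlat)) {y : A.PosFlat}
    (hy : y ∈ Φ) : ∃ N ∈ flagFlats Φ, N < y.1 ∧ flagNext Φ N = y.1.space ∧
      ∀ x ∈ flagFlats Φ, x < y.1 ↔ x ≤ N := by
  classical
  obtain ⟨N, hNmax⟩ := ((flagFlats Φ).filter (· < y.1)).exists_maximal
    ⟨⊥, mem_filter.2 ⟨bot_mem_flagFlats, bot_lt_iff_ne_bot.2 y.2⟩⟩
  obtain ⟨hN, hNy⟩ := mem_filter.1 hNmax.1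
  have hle {x : A.Flat} (hx : x ∈ flagFlats Φ) (hxy : x < y.1) : x ≤ N :=
    ((isChain_flagFlats hΦ).total hx hN).elim id fun h => hNmax.2 (mem_filter.2 ⟨hx, hxy⟩) h
  refine ⟨N, hN, hNy, flagNext_eq_space hy hNy fun z hz hNz => ?_,
    fun x hx => ⟨hle hx, fun h => h.trans_lt hNy⟩⟩
  refine (hΦ.total hz hy).elim (fun hzy => hzy.eq_or_lt.elim (fun h => h.ge) fun hzy => ?_) id
  exact (hNz.not_ge (hle (mem_flagFlats.2 (Or.inr ⟨z, hz, rfl⟩)) hzy)).elim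

theorem flagPoincare_eq_prod_flagFlats :
    flagPoincare Φ = ∏ x ∈ flagFlats Φ, ((A.restrict x).sub (flagNext Φ x)).poincare := rfl

end HyperplaneArrangement

open HyperplaneArrangement

namespace IsGenericCentral

variable {F : Type*} [Field F] {n m : ℕ} {A : HyperplaneArrangement F (Fin n → F)}
  {H : Fin m → AffineSubspace F (Fin n → F)} {Φ : Finset A.PosFlat} {M : A.Flat}

theorem support_bot_flat (hA : IsGenericCentral A H) (hn : 1 ≤ n) :
    support H (⊥ : A.Flat).space = ∅ :=
  hA.isTruncatedBoolean.map_bot (by omega)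

open Classical in
theorem prod_filter_lt_flagFlats (hA : IsGenericCentral A H) (hnm : n ≤ m)
    (hΦ : IsChain (· ≤ ·) (Φ : Set A.PosFlat)) (hM : M ∈ flagFlats Φ)
    (hMn : #(support H M.space) < n) :
    ∏ x ∈ flagFlats Φ with x < M, ((A.restrict x).sub (flagNext Φ x)).poincare =
      (1 + X) ^ #(support H M.space) := by
  induction M using WellFoundedLT.induction with
  | ind M ih =>
    rcases eq_or_ne M ⊥ with rfl | hne
    · simp [hA.support_bot_flat (by omega)]
    obtain ⟨y, hy, rfl⟩ := (mem_flagFlats.1 hM).resolve_left hne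
    obtain ⟨N, hN, hNy, hnext, hlt_iff⟩ := exists_flagNext_eq_space hΦ hy
    have hfilter : {x ∈ flagFlats Φ | x < y.1} = insert N {x ∈ flagFlats Φ | x < N} := by
      ext x
      simp only [mem_filter, mem_insert]
      grind [le_iff_eq_or_lt]
    have hspace := (Flat.le_iff _ _).1 hNy.le
    have hcard := card_le_card (support_antitone (H := H) hspace)
    rw [hfilter, prod_insert (by simp), ih N hNy hN (hcard.trans_lt hMn), hnext,
      hA.poincare_restrict_sub hspace hnm (Or.inl hMn), min_eq_left hMn.le, genericPoincare_self,
      ← pow_add, Nat.sub_add_cancel hcard]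

theorem flagPoincare_eq (hA : IsGenericCentral A H) (hnm : n ≤ m)
    (hΦ : IsChain (· ≤ ·) (Φ : Set A.PosFlat)) (hM : M ∈ flagFlats Φ)
    (hMn : #(support H M.space) < n)
    (hmax : ∀ y ∈ Φ, y.1 ≤ M ∨ support H y.1.space = univ) :
    flagPoincare Φ = (1 + X) ^ #(support H M.space) *
      genericPoincare (n - #(support H M.space)) (m - #(support H M.space)) := by
  classical
  have hpoincare (x : A.Flat) (hx : ∀ y ∈ Φ, x < y.1 → support H y.1.space = univ) :
      ((A.restrict x).sub (flagNext Φ x)).poincare =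
        genericPoincare (n - #(support H x.space)) (m - #(support H x.space)) := by
    have hnext := support_flagNext_eq_univ hx
    rw [hA.poincare_restrict_sub flagNext_le_space hnm (Or.inr hnext), hnext, card_fin,
      min_eq_right hnm]
  rw [flagPoincare_eq_prod_flagFlats, ← prod_filter_mul_prod_filter_not _ (· < M),
    hA.prod_filter_lt_flagFlats hnm hΦ hM hMn, prod_eq_single_of_mem M (by simp [hM])]
  · rw [hpoincare M fun y hy hMy => (hmax y hy).resolve_left hMy.not_ge]
  intro x hx hxM
  obtain ⟨hxΦ, hxM'⟩ := mem_filter.1 hx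
  have hx_univ : support H x.space = univ := by
    rcases mem_flagFlats.1 hxΦ with rfl | ⟨y, hy, rfl⟩
    · exact (hxM' (bot_lt_iff_ne_bot.2 hxM.symm)).elim
    · exact (hmax y hy).resolve_left fun hle => hxM' (hle.lt_of_ne hxM)
  rw [hpoincare x fun y _ hxy => univ_subset_iff.1
      (hx_univ ▸ support_antitone ((Flat.le_iff _ _).1 hxy.le)),
    hx_univ, card_fin, Nat.sub_eq_zero_of_le hnm, genericPoincare_zero]

end IsGenericCentral

end

/-! ### Flags as chains of sets -/

section

open Finset Polynomial

section WeakOrder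

theorem sum_filter_mem_eq_sum_insert {β M : Type*} [DecidableEq β] [AddCommMonoid M]
    {𝒞 : Finset (Finset β)} {a : β} (h : ∀ C, insert a C ∈ 𝒞 ↔ C ∈ 𝒞) (f : Finset β → M) :
    ∑ C ∈ 𝒞 with a ∈ C, f C = ∑ C ∈ 𝒞 with a ∉ C, f (insert a C) := by
  refine sum_nbij' (·.erase a) (insert a) ?_ ?_ ?_ ?_ ?_ <;> intro C hC <;>
    obtain ⟨hC𝒞, haC⟩ := mem_filter.1 hC
  · exact mem_filter.2 ⟨(h _).1 ((insert_erase haC).symm ▸ hC𝒞), notMem_erase _ _⟩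
  · exact mem_filter.2 ⟨(h _).2 hC𝒞, mem_insert_self _ _⟩
  · exact insert_erase haC
  · exact erase_insert haC
  · rw [insert_erase haC]

theorem sup_id_mem_of_isChain {β : Type*} [SemilatticeSup β] [OrderBot β] {C : Finset β}
    (hC : IsChain (· ≤ ·) (C : Set β)) (hne : C.Nonempty) : C.sup id ∈ C := by
  have hsup : SupClosed (C : Set β) := fun a ha b hb => (hC.total ha hb).elim
    (fun h => (sup_of_le_right h).symm ▸ hb) (fun h => (sup_of_le_left h).symm ▸ ha)
  exact hsup.finsetSup_mem hne fun _ h => h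

theorem sum_filter_card_lt {α M : Type*} [Fintype α] [AddCommMonoid M] {n : ℕ} (hn : 1 ≤ n)
    (f : Finset α → M) :
    ∑ I with #I < n, f I = f ∅ + ∑ ℓ ∈ Icc 1 (n - 1), ∑ I ∈ powersetCard ℓ univ, f I := by
  classical
  have hcard : ∑ I with #I < n, f I = ∑ ℓ ∈ Ico 0 n, ∑ I ∈ powersetCard ℓ univ, f I := by
    rw [← sum_biUnion fun ℓ _ ℓ' _ h => pairwise_disjoint_powersetCard _ h]
    refine sum_congr ?_ fun _ _ => rfl
    ext I
    simp
  rw [hcard, sum_eq_sum_Ico_succ_bot (by omega), powersetCard_zero, sum_singleton]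
  rfl

variable {α : Type*} [DecidableEq α]

theorem mem_weakOrderChains {I : Finset α} {C : Finset (Finset α)} :
    C ∈ weakOrderChains I ↔ (∀ J ∈ C, J ≠ ∅ ∧ J ⊆ I) ∧ IsChain (· ⊆ ·) (C : Set (Finset α)) := by
  simp only [weakOrderChains, mem_filter, mem_powerset, and_congr_left_iff]
  intro _
  simp only [subset_iff, mem_erase, mem_powerset]

theorem insert_mem_weakOrderChains_iff {I : Finset α} (hI : I ≠ ∅) (C : Finset (Finset α)) :
    insert I C ∈ weakOrderChains I ↔ C ∈ weakOrderChains I := by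
  simp only [mem_weakOrderChains, forall_mem_insert, coe_insert]
  refine ⟨fun h => ⟨h.1.2, h.2.mono (Set.subset_insert _ _)⟩, fun h =>
    ⟨⟨⟨hI, subset_rfl⟩, h.1⟩, h.2.insert fun J hJ _ => Or.inr (h.1 J hJ).2⟩⟩

theorem sup_id_eq_of_mem_weakOrderChains {I : Finset α} {C : Finset (Finset α)}
    (hC : C ∈ weakOrderChains I) (hI : I ∈ C) : C.sup id = I :=
  le_antisymm (Finset.sup_le fun J hJ => ((mem_weakOrderChains.1 hC).1 J hJ).2)
    (Finset.le_sup (f := id) hI)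

theorem sum_filter_mem_weakOrderChains {k : Type*} [Field k] {I : Finset α} (hI : I ≠ ∅)
    {t : Finset α → k} (ht : t I ≠ 1) :
    ∑ C ∈ weakOrderChains I with I ∈ C, ∏ J ∈ C, t J / (1 - t J) = t I * weakOrderZeta I t := by
  have hne : 1 - t I ≠ 0 := sub_ne_zero.2 ht.symm
  have hmem : ∑ C ∈ weakOrderChains I with I ∈ C, ∏ J ∈ C, t J / (1 - t J) =
      t I / (1 - t I) * ∑ C ∈ weakOrderChains I with I ∉ C, ∏ J ∈ C, t J / (1 - t J) := by
    rw [sum_filter_mem_eq_sum_insert (insert_mem_weakOrderChains_iff hI), mul_sum]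
    exact sum_congr rfl fun C hC => prod_insert (mem_filter.1 hC).2
  rw [weakOrderZeta, ← sum_filter_add_sum_filter_not (weakOrderChains I) (I ∈ ·), hmem]
  field_simp
  ring

/-- The chains of nonempty sets of fewer than `n` elements of `α`. -/
noncomputable def properChains (α : Type*) [Fintype α] [DecidableEq α] (n : ℕ) :
    Finset (Finset (Finset α)) := {C ∈ weakOrderChains (univ : Finset α) | ∀ J ∈ C, #J < n}

variable [Fintype α] {n : ℕ} {C : Finset (Finset α)}

theorem mem_properChains : C ∈ properChains α n ↔
    (∀ J ∈ C, J ≠ ∅ ∧ #J < n) ∧ IsChain (· ⊆ ·) (C : Set (Finset α)) := by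
  simp only [properChains, mem_filter, mem_weakOrderChains, subset_univ, and_true]
  grind

theorem empty_mem_properChains : ∅ ∈ properChains α n := by simp [mem_properChains]

theorem sup_id_mem_of_mem_properChains (hC : C ∈ properChains α n) (hne : C.Nonempty) :
    C.sup id ∈ C := sup_id_mem_of_isChain (mem_properChains.1 hC).2 hne

theorem card_sup_id_lt (hn : 1 ≤ n) (hC : C ∈ properChains α n) : #(C.sup id) < n := by
  rcases C.eq_empty_or_nonempty with rfl | hne
  · exact hn
  · exact ((mem_properChains.1 hC).1 _ (sup_id_mem_of_mem_properChains hC hne)).2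

theorem filter_sup_id_eq_properChains {I : Finset α} (hI : I ≠ ∅) (hIn : #I < n) :
    {C ∈ properChains α n | C.sup id = I} = {C ∈ weakOrderChains I | I ∈ C} := by
  ext C
  simp only [mem_filter]
  constructor
  · rintro ⟨hC, rfl⟩
    refine ⟨mem_weakOrderChains.2 ⟨fun J hJ => ?_, (mem_properChains.1 hC).2⟩,
      sup_id_mem_of_mem_properChains hC (nonempty_iff_ne_empty.2 ?_)⟩
    · exact ⟨((mem_properChains.1 hC).1 J hJ).1, Finset.le_sup (f := id) hJ⟩
    · rintro rfl
      exact hI rfl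
  · rintro ⟨hC, hIC⟩
    refine ⟨?_, sup_id_eq_of_mem_weakOrderChains hC hIC⟩
    obtain ⟨hsub, hchain⟩ := mem_weakOrderChains.1 hC
    exact mem_properChains.2 ⟨fun J hJ =>
      ⟨(hsub J hJ).1, (card_le_card (hsub J hJ).2).trans_lt hIn⟩, hchain⟩

theorem filter_sup_id_eq_empty_properChains : {C ∈ properChains α n | C.sup id = ∅} = {∅} := by
  ext C
  simp only [mem_filter, mem_singleton]
  constructor
  · rintro ⟨hC, hsup⟩
    by_contra hne
    have hmem := sup_id_mem_of_mem_properChains hC (nonempty_iff_ne_empty.2 hne)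
    exact ((mem_properChains.1 hC).1 _ hmem).1 hsup
  · rintro rfl
    exact ⟨empty_mem_properChains, rfl⟩

theorem sum_properChains {M : Type*} [AddCommMonoid M] (hn : 1 ≤ n)
    (f : Finset (Finset α) → M) :
    ∑ C ∈ properChains α n, f C = f ∅ + ∑ ℓ ∈ Icc 1 (n - 1), ∑ I ∈ powersetCard ℓ univ,
      ∑ C ∈ weakOrderChains I with I ∈ C, f C := by
  rw [← sum_fiberwise_of_maps_to (g := fun C => C.sup id)
      (t := univ.filter fun I : Finset α => #I < n) (by simpa using fun C => card_sup_id_lt hn),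
    sum_filter_card_lt hn, filter_sup_id_eq_empty_properChains, sum_singleton]
  congr 1
  refine sum_congr rfl fun ℓ hℓ => sum_congr rfl fun I hI => ?_
  have hIℓ := (mem_powersetCard.1 hI).2
  have hℓn := mem_Icc.1 hℓ
  rw [filter_sup_id_eq_properChains (card_pos.1 (by omega)).ne_empty (by omega)]

end WeakOrder

namespace HyperplaneArrangement

variable {F V : Type*} [Field F] [AddCommGroup V] [Module F V] (A : HyperplaneArrangement F V)

theorem mem_flags {A : HyperplaneArrangement F V} {Φ : Finset A.PosFlat} :
    Φ ∈ A.flags ↔ IsChain (· ≤ ·) (Φ : Set A.PosFlat) := by simp [flags]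

theorem varOf_space (x : A.PosFlat) : A.varOf x.1.space = A.var x := by
  have h : ∃ y : A.PosFlat, y.1.space = x.1.space := ⟨x, rfl⟩
  rw [varOf, dif_pos h]
  exact congrArg _ (Subtype.ext (Flat.space_injective A h.choose_spec))

theorem var_ne_one (x : A.PosFlat) : A.var x ≠ 1 := fun h => by
  rw [var, FaithfulSMul.algebraMap_eq_one_iff] at h
  simpa using congrArg (MvPolynomial.eval 0) h

end HyperplaneArrangement

open HyperplaneArrangement

namespace IsGenericCentral

variable {F : Type*} [Field F] {n m : ℕ} {A : HyperplaneArrangement F (Fin n → F)}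
  {H : Fin m → AffineSubspace F (Fin n → F)}

theorem support_flat (hA : IsGenericCentral A H) (I : Finset (Fin m)) :
    support H (hA.flat I).space = if #I < n then I else univ := by
  rw [hA.flat_space, hA.support_inf]

theorem flat_mono (hA : IsGenericCentral A H) {I J : Finset (Fin m)} (h : I ⊆ J) :
    hA.flat I ≤ hA.flat J := by
  rw [Flat.le_iff, hA.flat_space, hA.flat_space]
  exact Finset.inf_mono h

theorem flat_empty (hA : IsGenericCentral A H) : hA.flat ∅ = ⊥ :=
  Flat.space_injective A <| by rw [hA.flat_space, Flat.space_bot, hA.ambient_eq, inf_empty]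

theorem flat_support (hA : IsGenericCentral A H) (x : A.Flat) :
    hA.flat (support H x.space) = x :=
  Flat.space_injective A <| by rw [hA.flat_space, ← hA.space_eq_inf]

theorem univ_ne_empty (hn : 1 ≤ n) (hnm : n ≤ m) : (univ : Finset (Fin m)) ≠ ∅ :=
  haveI : NeZero m := ⟨by omega⟩
  univ_nonempty.ne_empty

theorem flat_ne_bot (hA : IsGenericCentral A H) (hn : 1 ≤ n) (hnm : n ≤ m) {I : Finset (Fin m)}
    (hI : I ≠ ∅) : hA.flat I ≠ ⊥ := fun h => by
  have hsupport := hA.support_flat I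
  rw [h, hA.support_bot_flat hn] at hsupport
  split_ifs at hsupport
  exacts [hI hsupport.symm, univ_ne_empty hn hnm hsupport.symm]

theorem support_ne_empty (hA : IsGenericCentral A H) (x : A.PosFlat) :
    support H x.1.space ≠ ∅ := fun h => x.2 <| by
  rw [← hA.flat_support x.1, h, hA.flat_empty]

/-- The intersection of a nonempty set of hyperplanes of a generic central arrangement, as a flat
different from the bottom element. The value at `∅` is the intersection of all hyperplanes. -/
noncomputable def posFlat (hA : IsGenericCentral A H) (hn : 1 ≤ n) (hnm : n ≤ m)
    (I : Finset (Fin m)) : A.PosFlat :=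
  ⟨hA.flat (if I = ∅ then univ else I), hA.flat_ne_bot hn hnm (by
    split_ifs with h
    exacts [univ_ne_empty hn hnm, h])⟩

variable (hA : IsGenericCentral A H) (hn : 1 ≤ n) (hnm : n ≤ m)

theorem coe_posFlat {I : Finset (Fin m)} (hI : I ≠ ∅) : (hA.posFlat hn hnm I).1 = hA.flat I := by
  simp only [posFlat, if_neg hI]

theorem support_posFlat_of_lt {I : Finset (Fin m)} (hI : I ≠ ∅) (hlt : #I < n) :
    support H (hA.posFlat hn hnm I).1.space = I := by
  rw [hA.coe_posFlat hn hnm hI, hA.support_flat, if_pos hlt]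

theorem support_posFlat_univ : support H (hA.posFlat hn hnm univ).1.space = univ := by
  rw [hA.coe_posFlat hn hnm (univ_ne_empty hn hnm), hA.support_flat, ite_self]

theorem posFlat_support (x : A.PosFlat) : hA.posFlat hn hnm (support H x.1.space) = x :=
  Subtype.ext <| by rw [hA.coe_posFlat hn hnm (hA.support_ne_empty x), hA.flat_support]

theorem le_posFlat_univ (x : A.PosFlat) : x ≤ hA.posFlat hn hnm univ := by
  rw [← Subtype.coe_le_coe, hA.isTruncatedBoolean.le_iff, hA.support_posFlat_univ hn hnm]
  exact subset_univ _

theorem card_support_lt_of_ne {x : A.PosFlat} (hx : x ≠ hA.posFlat hn hnm univ) :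
    #(support H x.1.space) < n :=
  (hA.card_support_lt_or_eq_univ x.1).resolve_right fun h => hx <| by
    rw [← h, hA.posFlat_support hn hnm]

theorem varOf_inf {I : Finset (Fin m)} (hI : I ≠ ∅) :
    A.varOf (I.inf H) = A.var (hA.posFlat hn hnm I) := by
  rw [← varOf_space, hA.coe_posFlat hn hnm hI, flat_space]

section ProperChains

variable {C : Finset (Finset (Fin m))}

open Classical in
theorem image_posFlat_mem_flags (hC : C ∈ properChains (Fin m) n) :
    C.image (hA.posFlat hn hnm) ∈ A.flags := by
  obtain ⟨hproper, hchain⟩ := mem_properChains.1 hC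
  rw [mem_flags, coe_image]
  rintro _ ⟨I, hI, rfl⟩ _ ⟨J, hJ, rfl⟩ -
  simp only [← Subtype.coe_le_coe, hA.coe_posFlat hn hnm (hproper I hI).1,
    hA.coe_posFlat hn hnm (hproper J hJ).1]
  exact (hchain.total hI hJ).imp hA.flat_mono hA.flat_mono

open Classical in
theorem image_support_image_posFlat (hC : C ∈ properChains (Fin m) n) :
    (C.image (hA.posFlat hn hnm)).image (fun x => support H x.1.space) = C := by
  rw [image_image, image_congr (g := id) fun J hJ => ?_, image_id]
  obtain ⟨hJ, hJn⟩ := (mem_properChains.1 hC).1 J hJ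
  exact hA.support_posFlat_of_lt hn hnm hJ hJn

open Classical in
theorem posFlat_univ_notMem_image (hC : C ∈ properChains (Fin m) n) :
    hA.posFlat hn hnm univ ∉ C.image (hA.posFlat hn hnm) := fun h => by
  obtain ⟨J, hJ, hJ_univ⟩ := mem_image.1 h
  obtain ⟨hJ, hJn⟩ := (mem_properChains.1 hC).1 J hJ
  have hJ' := hA.support_posFlat_of_lt hn hnm hJ hJn
  rw [hJ_univ, hA.support_posFlat_univ hn hnm] at hJ'
  rw [← hJ', card_fin] at hJn
  omega

open Classical in
theorem insert_posFlat_univ_mem_flags_iff (Φ : Finset A.PosFlat) :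
    insert (hA.posFlat hn hnm univ) Φ ∈ A.flags ↔ Φ ∈ A.flags := by
  rw [mem_flags, mem_flags, coe_insert]
  exact ⟨fun h => h.mono (Set.subset_insert _ _), fun h =>
    h.insert fun x _ _ => Or.inr (hA.le_posFlat_univ hn hnm x)⟩

theorem image_support_mem_properChains {Φ : Finset A.PosFlat} (hΦ : Φ ∈ A.flags)
    (huniv : hA.posFlat hn hnm univ ∉ Φ) :
    Φ.image (fun x => support H x.1.space) ∈ properChains (Fin m) n := by
  refine mem_properChains.2 ⟨forall_mem_image.2 fun x hx => ⟨hA.support_ne_empty x,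
    hA.card_support_lt_of_ne hn hnm fun h => huniv (h ▸ hx)⟩, ?_⟩
  rw [coe_image]
  exact (mem_flags.1 hΦ).image_of_map_rel _ _ _ fun x y h => (hA.isTruncatedBoolean.le_iff _ _).1 h

open Classical in
theorem sum_flags {M : Type*} [AddCommMonoid M] (f : Finset A.PosFlat → M) :
    ∑ Φ ∈ A.flags, f Φ = ∑ C ∈ properChains (Fin m) n, (f (C.image (hA.posFlat hn hnm)) +
      f (insert (hA.posFlat hn hnm univ) (C.image (hA.posFlat hn hnm)))) := by
  rw [← sum_filter_not_add_sum_filter _ (hA.posFlat hn hnm univ ∈ ·),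
    sum_filter_mem_eq_sum_insert (hA.insert_posFlat_univ_mem_flags_iff hn hnm),
    ← sum_add_distrib]
  symm
  refine sum_nbij' (image (hA.posFlat hn hnm)) (image fun x => support H x.1.space)
    (fun C hC => mem_filter.2
      ⟨hA.image_posFlat_mem_flags hn hnm hC, hA.posFlat_univ_notMem_image hn hnm hC⟩)
    (fun Φ hΦ => hA.image_support_mem_properChains hn hnm (mem_filter.1 hΦ).1 (mem_filter.1 hΦ).2)
    (fun C hC => hA.image_support_image_posFlat hn hnm hC) (fun Φ _ => ?_) (fun _ _ => rfl)
  rw [image_image]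
  exact (image_congr fun x _ => hA.posFlat_support hn hnm x).trans image_id

open Classical in
theorem flagPoincare_eq_of_properChain (hC : C ∈ properChains (Fin m) n) {Φ : Finset A.PosFlat}
    (hΦ : Φ ∈ A.flags) (hCΦ : C.image (hA.posFlat hn hnm) ⊆ Φ)
    (hΦC : Φ ⊆ insert (hA.posFlat hn hnm univ) (C.image (hA.posFlat hn hnm))) :
    flagPoincare Φ =
      (1 + X) ^ #(C.sup id) * genericPoincare (n - #(C.sup id)) (m - #(C.sup id)) := by
  have hsup_lt := card_sup_id_lt hn hC
  have hsupport : support H (hA.flat (C.sup id)).space = C.sup id := by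
    rw [hA.support_flat, if_pos hsup_lt]
  have hmem : hA.flat (C.sup id) ∈ flagFlats Φ := by
    rcases C.eq_empty_or_nonempty with rfl | hne
    · exact mem_flagFlats.2 (Or.inl hA.flat_empty)
    · have hsup := sup_id_mem_of_mem_properChains hC hne
      exact mem_flagFlats.2 (Or.inr ⟨_, hCΦ (mem_image_of_mem _ hsup),
        hA.coe_posFlat hn hnm ((mem_properChains.1 hC).1 _ hsup).1⟩)
  rw [hA.flagPoincare_eq hnm (mem_flags.1 hΦ) hmem (by rwa [hsupport]) fun y hy => ?_, hsupport]
  rcases mem_insert.1 (hΦC hy) with rfl | hy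
  · exact Or.inr (hA.support_posFlat_univ hn hnm)
  · obtain ⟨J, hJ, rfl⟩ := mem_image.1 hy
    rw [hA.coe_posFlat hn hnm ((mem_properChains.1 hC).1 J hJ).1]
    exact Or.inl (hA.flat_mono (Finset.le_sup (f := id) hJ))

open Classical in
theorem prod_image_posFlat (hC : C ∈ properChains (Fin m) n) {M : Type*} [CommMonoid M]
    (f : A.PosFlat → M) :
    ∏ x ∈ C.image (hA.posFlat hn hnm), f x = ∏ J ∈ C, f (hA.posFlat hn hnm J) := by
  refine prod_image fun I hI J hJ hIJ => ?_
  have hproper := (mem_properChains.1 hC).1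
  rw [← hA.support_posFlat_of_lt hn hnm (hproper I hI).1 (hproper I hI).2, hIJ,
    hA.support_posFlat_of_lt hn hnm (hproper J hJ).1 (hproper J hJ).2]

end ProperChains

section FlagHilbertPoincare

include hA hn hnm

variable {t : Finset (Fin m) → A.RatFun} (ht : ∀ I, t I = A.varOf (I.inf H))

include ht

theorem intersectionVar_ne_one {I : Finset (Fin m)} (hI : I ≠ ∅) : t I ≠ 1 := by
  rw [ht, hA.varOf_inf hn hnm hI]
  exact A.var_ne_one _

theorem fHP_eq_sum_properChains :
    A.fHP = C (1 / (1 - t univ)) * ∑ D ∈ properChains (Fin m) n, (1 + X) ^ #(D.sup id) *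
      (genericPoincare (n - #(D.sup id)) (m - #(D.sup id))).map (Int.castRingHom A.RatFun) *
        C (∏ J ∈ D, t J / (1 - t J)) := by
  classical
  have hne : 1 - t univ ≠ 0 :=
    sub_ne_zero.2 (hA.intersectionVar_ne_one hn hnm ht (univ_ne_empty hn hnm)).symm
  have hgeom : (C (1 / (1 - t univ)) : A.RatFun[X]) = 1 + C (t univ / (1 - t univ)) := by
    rw [← C_1, ← C_add]
    congr 1
    field_simp
    ring
  rw [fHP, hA.sum_flags hn hnm, mul_sum]
  refine sum_congr rfl fun D hD => ?_
  have hflag := hA.image_posFlat_mem_flags hn hnm hD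
  have hprod : ∏ x ∈ D.image (hA.posFlat hn hnm), A.var x / (1 - A.var x) =
      ∏ J ∈ D, t J / (1 - t J) := by
    rw [hA.prod_image_posFlat hn hnm hD]
    exact prod_congr rfl fun J hJ => by
      rw [ht, hA.varOf_inf hn hnm ((mem_properChains.1 hD).1 J hJ).1]
  rw [hA.flagPoincare_eq_of_properChain hn hnm hD hflag subset_rfl (subset_insert _ _),
    hA.flagPoincare_eq_of_properChain hn hnm hD
      ((hA.insert_posFlat_univ_mem_flags_iff hn hnm _).2 hflag) (subset_insert _ _) subset_rfl,
    prod_insert (hA.posFlat_univ_notMem_image hn hnm hD), hprod, hgeom, C_mul, ht univ,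
    hA.varOf_inf hn hnm (univ_ne_empty hn hnm)]
  simp only [Polynomial.map_mul, Polynomial.map_pow, Polynomial.map_add, Polynomial.map_one, map_X]
  ring

theorem fHP_eq :
    A.fHP = C (1 / (1 - t univ)) * (1 + X) *
        ∑ k ∈ range n, ((m - 1).choose k : A.RatFun[X]) * X ^ k +
      ∑ ℓ ∈ Icc 1 (n - 1), ∑ k ∈ range (n - ℓ),
        C (1 / (1 - t univ)) * (1 + X) ^ (ℓ + 1) * ((m - ℓ - 1).choose k : A.RatFun[X]) * X ^ k *
          ∑ I ∈ powersetCard ℓ (univ : Finset (Fin m)), C (t I * weakOrderZeta I t) := by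
  have hpoincare {ℓ : ℕ} (hℓ : ℓ < n) :
      (genericPoincare (n - ℓ) (m - ℓ)).map (Int.castRingHom A.RatFun) =
        (1 + X) * ∑ k ∈ range (n - ℓ), ((m - ℓ - 1).choose k : A.RatFun[X]) * X ^ k := by
    rw [genericPoincare, if_neg (by omega)]
    simp [Polynomial.map_sum]
  rw [hA.fHP_eq_sum_properChains hn hnm ht, sum_properChains hn, mul_add, mul_sum]
  congr 1
  · simpa [mul_assoc] using congrArg (C (1 / (1 - t univ)) * ·) (hpoincare hn)
  refine sum_congr rfl fun ℓ hℓ => ?_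
  obtain ⟨hℓ1, hℓn⟩ := mem_Icc.1 hℓ
  have hfiber : ∀ I ∈ powersetCard ℓ (univ : Finset (Fin m)),
      ∑ D ∈ weakOrderChains I with I ∈ D, (1 + X) ^ #(D.sup id) *
        (genericPoincare (n - #(D.sup id)) (m - #(D.sup id))).map (Int.castRingHom A.RatFun) *
          C (∏ J ∈ D, t J / (1 - t J)) =
      (1 + X) ^ (ℓ + 1) * (∑ k ∈ range (n - ℓ), ((m - ℓ - 1).choose k : A.RatFun[X]) * X ^ k) *
        C (t I * weakOrderZeta I t) := fun I hI => by
    have hIℓ := (mem_powersetCard.1 hI).2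
    have hI0 : I ≠ ∅ := (card_pos.1 (by omega)).ne_empty
    rw [← sum_filter_mem_weakOrderChains hI0 (hA.intersectionVar_ne_one hn hnm ht hI0), map_sum,
      mul_sum]
    refine sum_congr rfl fun D hD => ?_
    rw [sup_id_eq_of_mem_weakOrderChains (mem_filter.1 hD).1 (mem_filter.1 hD).2, hIℓ,
      hpoincare (by omega)]
    ring
  rw [sum_congr rfl hfiber, ← mul_sum]
  generalize ∑ I ∈ powersetCard ℓ univ, C (t I * weakOrderZeta I t) = S
  simp only [mul_sum, sum_mul]
  exact sum_congr rfl fun k _ => by ring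

end FlagHilbertPoincare

end IsGenericCentral

end

/-! ### Haar measure on compact discrete valuation rings -/

section

open MeasureTheory Finset Topology IsLocalRing

section CompactLocalRing

variable {R : Type*} [CommRing R] [IsLocalRing R] [IsNoetherianRing R] [TopologicalSpace R]
  [IsTopologicalRing R] [CompactSpace R] [T2Space R]

theorem isAdic_maximalIdeal : IsAdic (maximalIdeal R) := by
  refine isAdic_iff.2 ⟨isOpen_maximalIdeal_pow R, fun U hU => ?_⟩
  refine exists_subset_nhds_of_isCompact (V := fun k => ((maximalIdeal R ^ k : Ideal R) : Set R))
    (Antitone.directed_ge fun _ _ h => Ideal.pow_le_pow_right h)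
    (fun _ => Ideal.isCompact_of_fg (IsNoetherian.noetherian _)) fun x hx => ?_
  have hx_inf : x ∈ (⨅ k : ℕ, maximalIdeal R ^ k : Ideal R) := by
    simpa [Submodule.mem_iInf] using hx
  rw [Ideal.iInf_pow_eq_bot_of_isLocalRing _ (maximalIdeal.isMaximal R).ne_top,
    Submodule.mem_bot] at hx_inf
  exact hx_inf ▸ hU

variable (R) in
theorem secondCountableTopology_of_compact_isLocalRing : SecondCountableTopology R := by
  have : (𝓝 (0 : R)).IsCountablyGenerated :=
    (isAdic_maximalIdeal (R := R)).hasBasis_nhds_zero.isCountablyGenerated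
  let := IsTopologicalAddGroup.rightUniformSpace R
  have : IsUniformAddGroup R := isUniformAddGroup_of_addCommGroup
  have := IsUniformAddGroup.uniformity_countably_generated (α := R)
  let := UniformSpace.pseudoMetricSpace R
  infer_instance

end CompactLocalRing

section AbsoluteValue

variable {o : Type*} [CommRing o] [IsDomain o] [IsDiscreteValuationRing o]

theorem dvrAbs_zero : dvrAbs (0 : o) = 0 := by simp [dvrAbs]

theorem dvrAbs_mul (x y : o) : dvrAbs (x * y) = dvrAbs x * dvrAbs y := by
  by_cases hx : x = 0
  · simp [hx, dvrAbs_zero]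
  by_cases hy : y = 0
  · simp [hy, dvrAbs_zero]
  have hvx := (IsDiscreteValuationRing.addVal_eq_top_iff (R := o)).not.2 hx
  have hvy := (IsDiscreteValuationRing.addVal_eq_top_iff (R := o)).not.2 hy
  rw [dvrAbs, dvrAbs, dvrAbs, if_neg hx, if_neg hy, if_neg (mul_ne_zero hx hy),
    IsDiscreteValuationRing.addVal_mul, ENat.toNat_add hvx hvy, pow_add]

theorem dvrAbs_of_irreducible {ϖ : o} (hϖ : Irreducible ϖ) :
    dvrAbs ϖ = (Nat.card (ResidueField o) : NNReal)⁻¹ := by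
  rw [dvrAbs, if_neg hϖ.ne_zero, IsDiscreteValuationRing.addVal_uniformizer hϖ]
  simp

theorem dvrAbs_of_notMem_maximalIdeal {x : o} (hx : x ∉ maximalIdeal o) : dvrAbs x = 1 := by
  have hunit : IsUnit x := by simpa using hx
  rw [dvrAbs, if_neg hunit.ne_zero, IsDiscreteValuationRing.addVal_eq_zero_iff.2 hunit]
  simp

theorem dvrAbs_le_one (x : o) : dvrAbs x ≤ 1 := by
  rw [dvrAbs]
  split_ifs
  · exact zero_le_one
  · exact pow_le_one₀ zero_le (Nat.cast_inv_le_one _)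

theorem mem_maximalIdeal_pow_iff {k : ℕ} {x : o} :
    x ∈ maximalIdeal o ^ k ↔ k ≤ IsDiscreteValuationRing.addVal o x := by
  obtain ⟨ϖ, hϖ⟩ := IsDiscreteValuationRing.exists_irreducible o
  rw [(IsDiscreteValuationRing.irreducible_iff_uniformizer ϖ).1 hϖ, Ideal.span_singleton_pow,
    Ideal.mem_span_singleton, ← IsDiscreteValuationRing.addVal_le_iff_dvd, hϖ.addVal_pow]

variable [TopologicalSpace o] [IsTopologicalRing o] [CompactSpace o] [T2Space o]
  [MeasurableSpace o] [BorelSpace o]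

theorem measurable_addVal : Measurable (IsDiscreteValuationRing.addVal o) := by
  refine measurable_to_countable' fun k => ?_
  induction k using ENat.recTopCoe with
  | top =>
    convert measurableSet_singleton (0 : o)
    ext x
    exact IsDiscreteValuationRing.addVal_eq_top_iff
  | coe k =>
    convert (isOpen_maximalIdeal_pow o k).measurableSet.diff
      (isOpen_maximalIdeal_pow o (k + 1)).measurableSet
    ext x
    simp only [Set.mem_preimage, Set.mem_singleton_iff, Set.mem_sdiff, SetLike.mem_coe, not_lt,
      mem_maximalIdeal_pow_iff, Nat.cast_add_one, ENat.add_one_le_iff (ENat.natCast_ne_top k)]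
    rw [and_comm, le_antisymm_iff]

theorem measurable_dvrAbs : Measurable (dvrAbs : o → NNReal) := by
  have hcomp : (dvrAbs : o → NNReal) = (fun a : ℕ∞ => if a = ⊤ then 0 else
      ((Nat.card (ResidueField o) : NNReal)⁻¹) ^ a.toNat) ∘ IsDiscreteValuationRing.addVal o := by
    classical
    funext x
    exact if_congr IsDiscreteValuationRing.addVal_eq_top_iff.symm rfl rfl
  rw [hcomp]
  exact Measurable.of_discrete.comp measurable_addVal

end AbsoluteValue

section HaarPi

variable (G : Type*) [AddGroup G] [TopologicalSpace G] [IsTopologicalAddGroup G] [CompactSpace G]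
  [MeasurableSpace G] [BorelSpace G] (κ : Type*) [Fintype κ]

/-- The Haar measure of total mass `1` on the `κ`-th power of a compact group `G`. -/
noncomputable def haarPi : Measure (κ → G) :=
  Measure.pi fun _ => Measure.addHaarMeasure (⊤ : TopologicalSpace.PositiveCompacts G)

instance isProbabilityMeasure_addHaarMeasure_top : IsProbabilityMeasure
    (Measure.addHaarMeasure (⊤ : TopologicalSpace.PositiveCompacts G)) :=
  ⟨Measure.addHaarMeasure_self (K₀ := (⊤ : TopologicalSpace.PositiveCompacts G))⟩

instance isProbabilityMeasure_haarPi : IsProbabilityMeasure (haarPi G κ) := by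
  unfold haarPi
  infer_instance

instance isAddHaarMeasure_haarPi [SecondCountableTopology G] :
    (haarPi G κ).IsAddHaarMeasure := by
  unfold haarPi
  infer_instance

end HaarPi

section MaximalIdealPower

variable {R : Type*} [CommRing R] [IsLocalRing R] [IsNoetherianRing R] [TopologicalSpace R]
  [IsTopologicalRing R] [CompactSpace R] [T2Space R] {κ : Type*}

theorem isOpen_forall_mem_maximalIdeal [Finite κ] :
    IsOpen {x : κ → R | ∀ i, x i ∈ maximalIdeal R} := by
  simp only [Set.ofPred_forall]
  exact isOpen_iInter_of_finite fun i => (isOpen_maximalIdeal R).preimage (continuous_apply i)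

variable [MeasurableSpace R] [BorelSpace R]

theorem measurableSet_forall_mem_maximalIdeal [Countable κ] :
    MeasurableSet {x : κ → R | ∀ i, x i ∈ maximalIdeal R} := by
  simp only [Set.ofPred_forall]
  exact MeasurableSet.iInter fun i =>
    measurable_pi_apply i (isOpen_maximalIdeal R).measurableSet

theorem addHaarMeasure_maximalIdeal :
    Measure.addHaarMeasure (⊤ : TopologicalSpace.PositiveCompacts R) (maximalIdeal R) =
      (Nat.card (ResidueField R) : ENNReal)⁻¹ := by
  have : Finite (R ⧸ (maximalIdeal R).toAddSubgroup) := inferInstanceAs (Finite (ResidueField R))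
  have : (maximalIdeal R).toAddSubgroup.FiniteIndex := AddSubgroup.finiteIndex_of_finite_quotient
  have hindex := AddSubgroup.index_mul_measure (maximalIdeal R).toAddSubgroup
    (isOpen_maximalIdeal R).measurableSet
    (Measure.addHaarMeasure (⊤ : TopologicalSpace.PositiveCompacts R))
  rw [measure_univ, mul_comm] at hindex
  exact ENNReal.eq_inv_of_mul_eq_one_left hindex

variable [Fintype κ]

theorem haarPi_forall_mem_maximalIdeal :
    haarPi R κ {x | ∀ i, x i ∈ maximalIdeal R} =
      ((Nat.card (ResidueField R) : ENNReal)⁻¹) ^ Fintype.card κ := by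
  have hpi : {x : κ → R | ∀ i, x i ∈ maximalIdeal R} =
      Set.univ.pi fun _ => (maximalIdeal R : Set R) := by
    ext x
    simp
  rw [hpi, haarPi, Measure.pi_pi, prod_congr rfl fun i _ => addHaarMeasure_maximalIdeal]
  simp

theorem integral_indicator_one_haarPi :
    ∫ x, {x : κ → R | ∀ i, x i ∈ maximalIdeal R}.indicator (fun _ => (1 : ℂ)) x ∂haarPi R κ =
      ((Nat.card (ResidueField R) : ℂ)⁻¹) ^ Fintype.card κ := by
  rw [integral_indicator measurableSet_forall_mem_maximalIdeal, setIntegral_const, measureReal_def,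
    haarPi_forall_mem_maximalIdeal]
  simp

end MaximalIdealPower

section UniformizerScaling

variable {o : Type*} [CommRing o] [IsDomain o] [IsDiscreteValuationRing o] {ϖ : o}
  (hϖ : Irreducible ϖ) {κ : Type*}

include hϖ

theorem range_uniformizer_smul :
    Set.range (fun x : κ → o => ϖ • x) = {x | ∀ i, x i ∈ maximalIdeal o} := by
  ext x
  rw [Set.mem_ofPred_eq, (IsDiscreteValuationRing.irreducible_iff_uniformizer ϖ).1 hϖ]
  simp only [Ideal.mem_span_singleton]
  constructor
  · rintro ⟨y, rfl⟩ i
    exact ⟨y i, rfl⟩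
  · intro hdvd
    choose y hy using hdvd
    exact ⟨y, funext fun i => (hy i).symm⟩

variable [TopologicalSpace o] [IsTopologicalRing o] [CompactSpace o] [T2Space o]

theorem isOpenEmbedding_uniformizer_smul [Finite κ] :
    IsOpenEmbedding fun x : κ → o => ϖ • x := by
  have hinj : Function.Injective fun x : κ → o => ϖ • x := fun x y h => funext fun i =>
    mul_left_cancel₀ hϖ.ne_zero (congrFun h i)
  refine ⟨((continuous_const_smul ϖ).isClosedEmbedding hinj).isEmbedding, ?_⟩
  rw [range_uniformizer_smul hϖ]
  exact isOpen_forall_mem_maximalIdeal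

variable [Fintype κ] [MeasurableSpace o] [BorelSpace o]

theorem comap_uniformizer_smul_haarPi :
    (haarPi o κ).comap (fun x : κ → o => ϖ • x) =
      ((Nat.card (ResidueField o) : NNReal)⁻¹) ^ Fintype.card κ • haarPi o κ := by
  have := secondCountableTopology_of_compact_isLocalRing o
  have hemb := isOpenEmbedding_uniformizer_smul hϖ (κ := κ)
  have hhaar : ((haarPi o κ).comap fun x : κ → o => ϖ • x).IsAddHaarMeasure :=
    Measure.IsAddHaarMeasure.comap (mH := inferInstance) _
      (f := DistribSMul.toAddMonoidHom (κ → o) ϖ) hemb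
  have hscale := Measure.isAddInvariant_eq_smul_of_compactSpace
    ((haarPi o κ).comap fun x : κ → o => ϖ • x) (haarPi o κ)
  have hmass := congrArg (· Set.univ) hscale
  simp only [Measure.smul_apply, measure_univ, ENNReal.smul_def, smul_eq_mul, mul_one,
    hemb.measurableEmbedding.comap_apply, Set.image_univ, range_uniformizer_smul hϖ,
    haarPi_forall_mem_maximalIdeal] at hmass
  rw [hscale]
  congr 1
  rw [← ENNReal.coe_inj, ← hmass, ENNReal.coe_pow,
    ENNReal.coe_inv (Nat.cast_ne_zero.2 Nat.card_pos.ne'), ENNReal.coe_natCast]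

theorem integral_indicator_haarPi (f : (κ → o) → ℂ) :
    ∫ x, {x : κ → o | ∀ i, x i ∈ maximalIdeal o}.indicator f x ∂haarPi o κ =
      ((Nat.card (ResidueField o) : ℂ)⁻¹) ^ Fintype.card κ * ∫ x, f (ϖ • x) ∂haarPi o κ := by
  have := secondCountableTopology_of_compact_isLocalRing o
  have hemb := (isOpenEmbedding_uniformizer_smul hϖ (κ := κ)).measurableEmbedding
  rw [integral_indicator measurableSet_forall_mem_maximalIdeal, ← range_uniformizer_smul hϖ,
    ← hemb.map_comap, hemb.integral_map, comap_uniformizer_smul_haarPi hϖ,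
    integral_smul_nnreal_measure, NNReal.smul_def, Complex.real_smul]
  push_cast
  rfl

end UniformizerScaling

end

/-! ### Zeta integrals of generic forms -/

section

open MeasureTheory Finset Topology IsLocalRing

theorem sum_powerset_neg_one_pow_mul_pow_min {ι k : Type*} [CommRing k] {W : Finset ι}
    (hW : W.Nonempty) (r : ℕ) (x : k) :
    ∑ K ∈ W.powerset, (-1 : k) ^ #K * x ^ min #K r =
      (1 - x) * ∑ j ∈ range r, (-1 : k) ^ j * ((#W - 1).choose j : k) * x ^ j := by
  classical
  obtain ⟨a, ha⟩ := hW
  -- Pair `K` with `insert a K`; the two terms cancel unless `#K < r`.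
  have hpair : ∀ K ∈ (W.erase a).powerset, (-1 : k) ^ #K * x ^ min #K r +
      (-1 : k) ^ #(insert a K) * x ^ min #(insert a K) r =
        if #K < r then (1 - x) * ((-1 : k) ^ #K * x ^ #K) else 0 := by
    intro K hK
    rw [card_insert_of_notMem fun haK => notMem_erase a W (mem_powerset.1 hK haK)]
    split_ifs with hKr
    · rw [min_eq_left hKr.le, min_eq_left (by omega)]
      ring
    · rw [min_eq_right (by omega), min_eq_right (by omega)]
      ring
  have hvanish : ∀ j ∈ range r, j ∉ range (#(W.erase a) + 1) →
      (#(W.erase a)).choose j • ((1 - x) * ((-1 : k) ^ j * x ^ j)) = 0 := fun j _ hj => by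
    rw [Nat.choose_eq_zero_of_lt (by simpa using hj), zero_smul]
  rw [← insert_erase ha, sum_powerset_insert (notMem_erase a W), ← sum_add_distrib,
    sum_congr rfl hpair,
    sum_powerset_apply_card fun j => if j < r then (1 - x) * ((-1 : k) ^ j * x ^ j) else 0,
    insert_erase ha, mul_sum, ← card_erase_of_mem ha]
  simp only [smul_ite, smul_zero, ← mem_range (n := r)]
  rw [sum_ite_mem, inter_comm, ← filter_mem_eq_inter, sum_filter_of_ne
    fun j hj hne => by_contra fun hj' => hne (hvanish j hj hj')]
  exact sum_congr rfl fun j _ => by rw [nsmul_eq_mul]; ring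

section MaxProd

variable {o : Type*} [CommRing o] [IsDomain o] [IsDiscreteValuationRing o] {ι : Type*}

/-- The product of the powers `(max_{j ∈ J} |y_j|) ^ S_J` over the `J ⊆ U` of a family `E`: the
integrand of the zeta function, restricted to the forms in `U`. -/
noncomputable def maxProd [DecidableEq ι] (E : Finset (Finset ι)) (S : Finset ι → ℂ)
    (U : Finset ι) (y : ι → o) : ℂ :=
  ∏ J ∈ E with J ⊆ U, (((J.sup fun j => dvrAbs (y j) : NNReal) : ℝ) : ℂ) ^ S J

open Classical in
/-- The indicator function of the vectors whose coordinates in `I` reduce to `0` in the residue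
field. -/
noncomputable def residueInd (I : Finset ι) (y : ι → o) : ℂ :=
  if ∀ i ∈ I, y i ∈ maximalIdeal o then 1 else 0

theorem dependsOn_residueInd (I : Finset ι) : DependsOn (residueInd (o := o) I) I := by
  intro y y' hy
  classical
  exact if_congr (forall₂_congr fun i hi => by rw [hy i hi]) rfl rfl

theorem norm_residueInd_le_one (I : Finset ι) (y : ι → o) : ‖residueInd I y‖ ≤ 1 := by
  rw [residueInd]
  split_ifs <;> simp

theorem residueInd_empty (y : ι → o) : residueInd ∅ y = 1 := by simp [residueInd]

theorem residueInd_mul_residueInd [DecidableEq ι] (I J : Finset ι) (y : ι → o) :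
    residueInd I y * residueInd J y = residueInd (I ∪ J) y := by
  classical
  simp only [residueInd, mem_union, or_imp, forall_and, ite_and, ite_mul, one_mul, zero_mul]

open Classical in
theorem sum_powerset_neg_one_pow_mul_residueInd (W : Finset ι) (y : ι → o) :
    ∑ K ∈ W.powerset, (-1 : ℂ) ^ #K * residueInd K y =
      if ∀ i ∈ W, y i ∉ maximalIdeal o then 1 else 0 := by
  have hresidueInd : ∀ K : Finset ι,
      (-1 : ℂ) ^ #K * residueInd K y = ∏ i ∈ K, -(if y i ∈ maximalIdeal o then 1 else 0) := by
    intro K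
    rw [prod_neg, prod_ite_zero, prod_const_one]
    rfl
  rw [sum_congr rfl fun K _ => hresidueInd K, ← prod_one_add, ← prod_const_one (s := W),
    ← prod_ite_zero]
  exact prod_congr rfl fun i _ => by split_ifs <;> simp_all

theorem residueInd_updateFinset [DecidableEq ι] (I : Finset ι) (y : ι → o) (x : I → o) :
    residueInd I (Function.updateFinset y I x) =
      {x : I → o | ∀ i, x i ∈ maximalIdeal o}.indicator (fun _ => (1 : ℂ)) x := by
  classical
  rw [residueInd, Set.indicator_apply]
  refine if_congr ?_ rfl rfl
  simp +contextual [Function.updateFinset]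

theorem measurable_residueInd [TopologicalSpace o] [IsTopologicalRing o] [CompactSpace o]
    [T2Space o] [MeasurableSpace o] [BorelSpace o] (I : Finset ι) :
    Measurable (residueInd (o := o) I) := by
  refine Measurable.ite ?_ measurable_const measurable_const
  simp only [Set.ofPred_forall]
  exact Finset.measurableSet_biInter I fun i _ =>
    measurable_pi_apply i (isOpen_maximalIdeal o).measurableSet

theorem sup_dvrAbs_uniformizer_mul {ϖ : o} (hϖ : Irreducible ϖ) (J : Finset ι) (y : ι → o) :
    (J.sup fun j => dvrAbs (ϖ * y j)) =
      (Nat.card (ResidueField o) : NNReal)⁻¹ * J.sup fun j => dvrAbs (y j) := by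
  rw [NNReal.mul_finset_sup]
  exact Finset.sup_congr rfl fun j _ => by rw [dvrAbs_mul, dvrAbs_of_irreducible hϖ]

variable [DecidableEq ι] {E : Finset (Finset ι)} {S : Finset ι → ℂ}

theorem dependsOn_maxProd (U : Finset ι) : DependsOn (maxProd (o := o) E S U) U := by
  intro y y' hy
  refine prod_congr rfl fun J hJ => ?_
  rw [Finset.sup_congr rfl fun j hj => by rw [hy j ((mem_filter.1 hJ).2 hj)]]

theorem norm_maxProd_le_one (hS : ∀ J ∈ E, 0 < (S J).re) (U : Finset ι) (y : ι → o) :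
    ‖maxProd E S U y‖ ≤ 1 := by
  rw [maxProd, norm_prod]
  refine prod_le_one (fun _ _ => norm_nonneg _) fun J hJ => ?_
  have hre := hS J (mem_filter.1 hJ).1
  have hmax : (J.sup fun j => dvrAbs (y j)) ≤ 1 := Finset.sup_le fun j _ => dvrAbs_le_one _
  rw [Complex.norm_cpow_eq_rpow_re_of_nonneg (NNReal.coe_nonneg _) hre.ne']
  exact Real.rpow_le_one (NNReal.coe_nonneg _) (by exact_mod_cast hmax) hre.le

theorem maxProd_eq_of_forall_notMem {I U : Finset ι} (hIU : I ⊆ U) {y : ι → o}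
    (hy : ∀ i ∈ U, i ∉ I → y i ∉ maximalIdeal o) : maxProd E S U y = maxProd E S I y := by
  refine (prod_subset (monotone_filter_right E fun J _ hJ => hJ.trans hIU)
    fun J hJ hJI => ?_).symm
  rw [mem_filter] at hJ hJI
  obtain ⟨j, hj, hjI⟩ := not_subset.1 fun hJI' => hJI ⟨hJ.1, hJI'⟩
  have hmax : (J.sup fun j => dvrAbs (y j)) = 1 := by
    refine le_antisymm (Finset.sup_le fun j _ => dvrAbs_le_one _) ?_
    rw [← dvrAbs_of_notMem_maximalIdeal (hy j (hJ.2 hj) hjI)]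
    exact Finset.le_sup (f := fun j => dvrAbs (y j)) hj
  rw [hmax, NNReal.coe_one, Complex.ofReal_one, Complex.one_cpow]

open Classical in
theorem sum_powerset_residueInd_mul_maxProd {I U : Finset ι} (hIU : I ⊆ U) (y : ι → o) :
    ∑ K ∈ (U \ I).powerset, (-1 : ℂ) ^ #K * (residueInd I y * maxProd E S I y * residueInd K y) =
      if ∀ i ∈ U, y i ∈ maximalIdeal o ↔ i ∈ I then maxProd E S U y else 0 := by
  simp only [mul_left_comm _ (residueInd I y * maxProd E S I y)]
  rw [← mul_sum, sum_powerset_neg_one_pow_mul_residueInd, residueInd]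
  have hiff : (∀ i ∈ U, y i ∈ maximalIdeal o ↔ i ∈ I) ↔
      (∀ i ∈ I, y i ∈ maximalIdeal o) ∧ ∀ i ∈ U \ I, y i ∉ maximalIdeal o := by
    grind
  rw [if_congr hiff rfl rfl, ite_and]
  split_ifs with hI hUI
  · rw [one_mul, mul_one, maxProd_eq_of_forall_notMem hIU
      fun i hi hiI => hUI i (mem_sdiff.2 ⟨hi, hiI⟩)]
  · rw [mul_zero]
  · rw [zero_mul, zero_mul]
  · rw [zero_mul, zero_mul]

theorem maxProd_uniformizer_smul {ϖ : o} (hϖ : Irreducible ϖ) (U : Finset ι) (y : ι → o) :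
    maxProd E S U (ϖ • y) =
      (∏ J ∈ E with J ⊆ U, (Nat.card (ResidueField o) : ℂ) ^ (-S J)) * maxProd E S U y := by
  rw [maxProd, maxProd, ← prod_mul_distrib]
  refine prod_congr rfl fun J _ => ?_
  simp only [Pi.smul_apply, smul_eq_mul, sup_dvrAbs_uniformizer_mul hϖ]
  rw [NNReal.coe_mul, Complex.ofReal_mul,
    Complex.mul_cpow_ofReal_nonneg (NNReal.coe_nonneg _) (NNReal.coe_nonneg _)]
  congr 1
  push_cast
  rw [Complex.cpow_neg, Complex.inv_cpow]
  exact (Complex.natCast_arg).trans_ne Real.pi_pos.ne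

variable [TopologicalSpace o] [IsTopologicalRing o] [CompactSpace o] [T2Space o]
  [MeasurableSpace o] [BorelSpace o]

theorem measurable_maxProd (U : Finset ι) : Measurable (maxProd (o := o) E S U) := by
  refine Finset.measurable_prod _ fun J _ => Measurable.pow_const ?_ _
  have hsup : Measurable (J.sup fun j (y : ι → o) => dvrAbs (y j)) :=
    J.sup_induction (p := Measurable) measurable_const (fun _ hf _ hg => hf.sup hg)
      fun j _ => measurable_dvrAbs.comp (measurable_pi_apply j)
  refine Complex.measurable_ofReal.comp (measurable_coe_nnreal_real.comp ?_)
  exact (funext fun y => J.sup_apply _ y : (J.sup _ : (ι → o) → NNReal) = _) ▸ hsup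

end MaxProd

section GenericForms

/-- Random variables `ℓ_i` with values in a compact ring of which any `n` are independent and
uniformly distributed, and linearly generate all others: the values of the forms defining a generic
central arrangement. Independence is stated for two complementary blocks of at most `n` of them. -/
structure GenericForms {o ι Ω : Type*} [CommRing o] [TopologicalSpace o] [IsTopologicalRing o]
    [CompactSpace o] [MeasurableSpace o] [BorelSpace o] [MeasurableSpace Ω] (μ : Measure Ω) (n : ℕ)
    (ℓ : Ω → ι → o) : Prop where
  measurable : Measurable ℓ
  measurePreserving : ∀ I J : Finset ι, Disjoint I J → #I + #J ≤ n →
    MeasurePreserving (fun z => (I.restrict (ℓ z), J.restrict (ℓ z))) μ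
      ((haarPi o I).prod (haarPi o J))
  span : ∀ K : Finset ι, #K = n → ∀ j, ∃ a : ι → o, ∀ z, ℓ z j = ∑ i ∈ K, a i * ℓ z i

namespace GenericForms

variable {o ι Ω : Type*} [CommRing o] [TopologicalSpace o] [IsTopologicalRing o] [CompactSpace o]
  [MeasurableSpace o] [BorelSpace o] [MeasurableSpace Ω] {μ : Measure Ω} {n : ℕ} {ℓ : Ω → ι → o}

theorem measurePreserving_restrict (h : GenericForms μ n ℓ) {I : Finset ι} (hI : #I ≤ n) :
    MeasurePreserving (fun z => I.restrict (ℓ z)) μ (haarPi o I) :=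
  measurePreserving_fst.comp (h.measurePreserving I ∅ (disjoint_empty_right I) (by simpa using hI))

theorem exists_subset_span (h : GenericForms μ n ℓ) (U : Finset ι) :
    ∃ K ⊆ U, #K = min #U n ∧ ∃ a : ι → ι → o, ∀ j ∈ U, ∀ z, ℓ z j = ∑ i ∈ K, a j i * ℓ z i := by
  classical
  rcases le_total #U n with hUn | hnU
  · refine ⟨U, subset_rfl, (min_eq_left hUn).symm, fun j => Pi.single j 1, fun j hj z => ?_⟩
    simp [Pi.single_apply, hj]
  · obtain ⟨K, hKU, hKn⟩ := exists_subset_card_eq hnU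
    choose a ha using h.span K hKn
    exact ⟨K, hKU, by omega, a, fun j _ => ha j⟩

section DependsOn

variable {f g : (ι → o) → ℂ} {I J : Finset ι}

theorem integral_comp_of_dependsOn [DecidableEq ι] (h : GenericForms μ n ℓ) (hI : #I ≤ n)
    (hf : Measurable f) (hfI : DependsOn f I) :
    ∫ z, f (ℓ z) ∂μ = ∫ x, f (Function.updateFinset 0 I x) ∂haarPi o I := by
  have hm := h.measurePreserving_restrict hI
  have hf_update : Measurable fun x : I → o => f (Function.updateFinset 0 I x) :=
    hf.comp measurable_updateFinset
  rw [← hm.map_eq, integral_map hm.measurable.aemeasurable hf_update.aestronglyMeasurable]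
  refine integral_congr_ae (.of_forall fun z => hfI fun i hi => ?_)
  simp_all [Function.updateFinset]

theorem integral_mul_of_dependsOn (h : GenericForms μ n ℓ) (hIJ : Disjoint I J)
    (hcard : #I + #J ≤ n) (hf : Measurable f) (hg : Measurable g) (hfI : DependsOn f I)
    (hgJ : DependsOn g J) :
    ∫ z, f (ℓ z) * g (ℓ z) ∂μ = (∫ z, f (ℓ z) ∂μ) * ∫ z, g (ℓ z) ∂μ := by
  classical
  have hm := h.measurePreserving I J hIJ hcard
  have hfg_update : Measurable fun p : (I → o) × (J → o) =>
      f (Function.updateFinset 0 I p.1) * g (Function.updateFinset 0 J p.2) :=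
    ((hf.comp measurable_updateFinset).comp measurable_fst).mul
      ((hg.comp measurable_updateFinset).comp measurable_snd)
  rw [h.integral_comp_of_dependsOn (by omega) hf hfI,
    h.integral_comp_of_dependsOn (by omega) hg hgJ, ← integral_prod_mul, ← hm.map_eq,
    integral_map hm.measurable.aemeasurable hfg_update.aestronglyMeasurable]
  refine integral_congr_ae (.of_forall fun z => congrArg₂ (· * ·) (hfI fun i hi => ?_)
    (hgJ fun i hi => ?_)) <;> simp_all [Function.updateFinset]

end DependsOn

variable [IsDomain o] [IsDiscreteValuationRing o]

theorem residueInd_eq_of_card_le (h : GenericForms μ n ℓ) {I J : Finset ι} (hI : n ≤ #I)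
    (hJ : n ≤ #J) (z : Ω) : residueInd I (ℓ z) = residueInd J (ℓ z) := by
  classical
  have hmem_of_card_le : ∀ I : Finset ι, n ≤ #I → (∀ i ∈ I, ℓ z i ∈ maximalIdeal o) →
      ∀ j, ℓ z j ∈ maximalIdeal o := by
    intro I hI hmem j
    obtain ⟨K, hKI, hKn⟩ := exists_subset_card_eq hI
    obtain ⟨a, ha⟩ := h.span K hKn j
    rw [ha]
    exact sum_mem fun i hi => Ideal.mul_mem_left _ _ (hmem i (hKI hi))
  exact if_congr ⟨fun hmem j _ => hmem_of_card_le I hI hmem j,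
    fun hmem i _ => hmem_of_card_le J hJ hmem i⟩ rfl rfl

theorem maxProd_eq_sum [DecidableEq ι] {E : Finset (Finset ι)} {S : Finset ι → ℂ}
    (h : GenericForms μ n ℓ) (U : Finset ι) (z : Ω) :
    maxProd E S U (ℓ z) = residueInd U (ℓ z) * maxProd E S U (ℓ z) +
      ∑ I ∈ U.powerset with I ≠ U ∧ #I < n, ∑ K ∈ (U \ I).powerset,
        (-1 : ℂ) ^ #K * (residueInd I (ℓ z) * maxProd E S I (ℓ z) * residueInd K (ℓ z)) := by
  classical
  set Z := U.filter fun i => ℓ z i ∈ maximalIdeal o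
  have hZU : Z ⊆ U := filter_subset _ _
  have hresidueInd : ∀ I ⊆ U, residueInd I (ℓ z) = if I ⊆ Z then 1 else 0 := fun I hI =>
    if_congr (by grind) rfl rfl
  have hZ_iff : ∀ I ∈ U.powerset.filter fun I => I ≠ U ∧ #I < n,
      (∀ i ∈ U, ℓ z i ∈ maximalIdeal o ↔ i ∈ I) ↔ I = Z := by
    grind
  rw [sum_congr rfl fun I hI => (sum_powerset_residueInd_mul_maxProd
      (mem_powerset.1 (mem_filter.1 hI).1) _).trans (if_congr (hZ_iff I hI) rfl rfl),
    sum_ite_eq', hresidueInd U subset_rfl]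
  by_cases hUZ : U ⊆ Z
  · simp [subset_antisymm hZU hUZ]
  · have hZ_ne : Z ≠ U := fun hZ_eq => hUZ hZ_eq.ge
    have hZ_card : #Z < n := by
      by_contra! hn
      have hind := h.residueInd_eq_of_card_le hn (hn.trans (card_le_card hZU)) z
      rw [hresidueInd Z hZU, hresidueInd U subset_rfl, if_pos subset_rfl, if_neg hUZ] at hind
      exact one_ne_zero hind
    rw [if_neg hUZ, zero_mul, zero_add,
      if_pos (mem_filter.2 ⟨mem_powerset.2 hZU, hZ_ne, hZ_card⟩)]

variable [T2Space o]

theorem integral_residueInd (h : GenericForms μ n ℓ) {J : Finset ι} (hJ : #J ≤ n) :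
    ∫ z, residueInd J (ℓ z) ∂μ = (Nat.card (ResidueField o) : ℂ)⁻¹ ^ #J := by
  classical
  rw [h.integral_comp_of_dependsOn hJ (measurable_residueInd J) (dependsOn_residueInd J)]
  simp only [residueInd_updateFinset]
  rw [integral_indicator_one_haarPi, Fintype.card_coe]

theorem integral_residueInd_mul_residueInd (h : GenericForms μ n ℓ) {I J : Finset ι}
    (hIJ : Disjoint I J) (hI : #I ≤ n) {f : (ι → o) → ℂ} (hf : Measurable f) (hfI : DependsOn f I) :
    ∫ z, residueInd I (ℓ z) * f (ℓ z) * residueInd J (ℓ z) ∂μ =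
      (Nat.card (ResidueField o) : ℂ)⁻¹ ^ min #J (n - #I) *
        ∫ z, residueInd I (ℓ z) * f (ℓ z) ∂μ := by
  classical
  -- Once `n` of the forms vanish in the residue field, so do all the others.
  obtain ⟨K, hKJ, hK⟩ := exists_subset_card_eq (min_le_left #J (n - #I))
  have hIK := disjoint_of_subset_right hKJ hIJ
  have hJK : ∀ z, residueInd I (ℓ z) * residueInd J (ℓ z) =
      residueInd I (ℓ z) * residueInd K (ℓ z) := by
    intro z
    rcases le_total #J (n - #I) with hle | hle
    · rw [eq_of_subset_of_card_le hKJ (by omega)]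
    · rw [residueInd_mul_residueInd, residueInd_mul_residueInd]
      refine h.residueInd_eq_of_card_le ?_ ?_ z
      · rw [card_union_of_disjoint hIJ]
        omega
      · rw [card_union_of_disjoint hIK]
        omega
  simp only [mul_right_comm _ (f _), hJK]
  simp only [mul_right_comm _ _ (f _)]
  rw [h.integral_mul_of_dependsOn (f := fun y => residueInd I y * f y) hIK (by omega)
    ((measurable_residueInd I).mul hf)
    (measurable_residueInd K) (fun _ _ hy => congrArg₂ (· * ·) (dependsOn_residueInd I hy) (hfI hy))
    (dependsOn_residueInd K), h.integral_residueInd (by omega), hK, mul_comm]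

theorem integral_residueInd_mul_of_card_le (h : GenericForms μ n ℓ) {ϖ : o} (hϖ : Irreducible ϖ)
    {I : Finset ι} (hI : #I ≤ n) {f : (ι → o) → ℂ} (hf : Measurable f) (hfI : DependsOn f I) :
    ∫ z, residueInd I (ℓ z) * f (ℓ z) ∂μ =
      (Nat.card (ResidueField o) : ℂ)⁻¹ ^ #I * ∫ z, f (ϖ • ℓ z) ∂μ := by
  classical
  have := secondCountableTopology_of_compact_isLocalRing o
  rw [h.integral_comp_of_dependsOn (f := fun y => residueInd I y * f y) hI
      ((measurable_residueInd I).mul hf)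
      fun _ _ hy => congrArg₂ (· * ·) (dependsOn_residueInd I hy) (hfI hy),
    h.integral_comp_of_dependsOn (f := fun y => f (ϖ • y)) hI
      (hf.comp (measurable_id.const_smul ϖ))
      fun _ _ hy => hfI fun i hi => congrArg (ϖ * ·) (hy i hi)]
  have hindicator : ∀ x : I → o, residueInd I (Function.updateFinset 0 I x) *
      f (Function.updateFinset 0 I x) = {x : I → o | ∀ i, x i ∈ maximalIdeal o}.indicator
        (fun x => f (Function.updateFinset 0 I x)) x := fun x => by
    rw [residueInd_updateFinset]
    simp only [Set.indicator_apply, ite_mul, one_mul, zero_mul]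
  have hupdate_smul : ∀ x : I → o, Function.updateFinset (fun _ : ι => (0 : o)) I (ϖ • x) =
      ϖ • Function.updateFinset (fun _ => 0) I x := fun x => by
    ext i
    by_cases hi : i ∈ I <;> simp [Function.updateFinset, hi]
  simp only [hindicator]
  rw [integral_indicator_haarPi hϖ, Fintype.card_coe]
  exact congrArg _ (integral_congr_ae (.of_forall fun x => congrArg f (hupdate_smul x)))

theorem integral_residueInd_mul (h : GenericForms μ n ℓ) {ϖ : o} (hϖ : Irreducible ϖ)
    {U : Finset ι} {f : (ι → o) → ℂ} (hf : Measurable f) (hfU : DependsOn f U) :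
    ∫ z, residueInd U (ℓ z) * f (ℓ z) ∂μ =
      (Nat.card (ResidueField o) : ℂ)⁻¹ ^ min #U n * ∫ z, f (ϖ • ℓ z) ∂μ := by
  have := secondCountableTopology_of_compact_isLocalRing o
  obtain ⟨K, hKU, hK, a, ha⟩ := h.exists_subset_span U
  have hresidueInd : ∀ z, residueInd U (ℓ z) = residueInd K (ℓ z) := fun z => by
    classical
    refine if_congr ⟨fun hmem i hi => hmem i (hKU hi), fun hmem j hj => ?_⟩ rfl rfl
    rw [ha j hj]
    exact sum_mem fun i hi => Ideal.mul_mem_left _ _ (hmem i hi)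
  set L : (ι → o) → ι → o := fun y j => ∑ i ∈ K, a j i * y i with hL
  have hL_meas : Measurable L := measurable_pi_lambda _ fun j =>
    Finset.measurable_sum _ fun i _ => (measurable_const_mul (a j i)).comp (measurable_pi_apply i)
  have hfL_dep : DependsOn (fun y => f (L y)) K := fun y y' hy =>
    congrArg f (funext fun j => sum_congr rfl fun i hi => by rw [hy i hi])
  have hL_smul : ∀ y, L (ϖ • y) = ϖ • L y := fun y => by
    ext j
    simp only [hL, Pi.smul_apply, smul_eq_mul, mul_sum, mul_left_comm]
  have hfL : ∀ z, f (ℓ z) = f (L (ℓ z)) := fun z => hfU fun j hj => ha j hj z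
  have hfL_smul : ∀ z, f (ϖ • ℓ z) = f (L (ϖ • ℓ z)) := fun z => by
    rw [hL_smul]
    exact hfU fun j hj => congrArg (ϖ * ·) (ha j hj z)
  simp only [hresidueInd, hfL, hfL_smul]
  rw [h.integral_residueInd_mul_of_card_le (f := fun y => f (L y)) hϖ
    (hK.trans_le (min_le_right _ _)) (hf.comp hL_meas) hfL_dep, hK]

variable [DecidableEq ι] {E : Finset (Finset ι)} {S : Finset ι → ℂ}

theorem integral_residueInd_mul_maxProd (h : GenericForms μ n ℓ) (U : Finset ι) :
    ∫ z, residueInd U (ℓ z) * maxProd E S U (ℓ z) ∂μ =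
      (Nat.card (ResidueField o) : ℂ)⁻¹ ^ min #U n *
        (∏ J ∈ E with J ⊆ U, (Nat.card (ResidueField o) : ℂ) ^ (-S J)) *
        ∫ z, maxProd E S U (ℓ z) ∂μ := by
  obtain ⟨ϖ, hϖ⟩ := IsDiscreteValuationRing.exists_irreducible o
  rw [h.integral_residueInd_mul hϖ (measurable_maxProd U) (dependsOn_maxProd U)]
  simp only [maxProd_uniformizer_smul hϖ]
  rw [integral_const_mul, mul_assoc]

theorem integrable_residueInd_mul_maxProd_mul_residueInd [IsFiniteMeasure μ]
    (h : GenericForms μ n ℓ) (hS : ∀ J ∈ E, 0 < (S J).re) (I J U : Finset ι) :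
    Integrable (fun z => residueInd I (ℓ z) * maxProd E S U (ℓ z) * residueInd J (ℓ z)) μ := by
  refine .of_bound (C := 1) ?_ (.of_forall fun z => ?_)
  · exact ((((measurable_residueInd I).comp h.measurable).mul
      ((measurable_maxProd U).comp h.measurable)).mul
      ((measurable_residueInd J).comp h.measurable)).aestronglyMeasurable
  · rw [norm_mul, norm_mul]
    exact mul_le_one₀ (mul_le_one₀ (norm_residueInd_le_one I _) (norm_nonneg _)
      (norm_maxProd_le_one hS U _)) (norm_nonneg _) (norm_residueInd_le_one J _)

theorem sum_powerset_integral_residueInd_mul_maxProd (h : GenericForms μ n ℓ) {I U : Finset ι}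
    (hIU : I ⊂ U) (hI : #I ≤ n) :
    ∑ K ∈ (U \ I).powerset, (-1 : ℂ) ^ #K *
        ∫ z, residueInd I (ℓ z) * maxProd E S I (ℓ z) * residueInd K (ℓ z) ∂μ =
      (1 - (Nat.card (ResidueField o) : ℂ)⁻¹) *
        ((∑ j ∈ range (n - #I), (-1 : ℂ) ^ j * ((#U - #I - 1).choose j : ℂ) *
          (Nat.card (ResidueField o) : ℂ)⁻¹ ^ j) *
        ∫ z, residueInd I (ℓ z) * maxProd E S I (ℓ z) ∂μ) := by
  have hterm : ∀ K ∈ (U \ I).powerset, (-1 : ℂ) ^ #K *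
      ∫ z, residueInd I (ℓ z) * maxProd E S I (ℓ z) * residueInd K (ℓ z) ∂μ =
      (-1 : ℂ) ^ #K * (Nat.card (ResidueField o) : ℂ)⁻¹ ^ min #K (n - #I) *
        ∫ z, residueInd I (ℓ z) * maxProd E S I (ℓ z) ∂μ := by
    intro K hK
    rw [mem_powerset, subset_sdiff] at hK
    rw [h.integral_residueInd_mul_residueInd hK.2.symm hI (measurable_maxProd I)
      (dependsOn_maxProd I), mul_assoc]
  rw [sum_congr rfl hterm, ← sum_mul, sum_powerset_neg_one_pow_mul_pow_min
    (sdiff_nonempty.2 (not_subset_of_ssubset hIU)), card_sdiff_of_subset hIU.subset, mul_assoc]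

theorem integral_maxProd [IsFiniteMeasure μ] (h : GenericForms μ n ℓ)
    (hS : ∀ J ∈ E, 0 < (S J).re) (U : Finset ι) :
    ∫ z, maxProd E S U (ℓ z) ∂μ = ∫ z, residueInd U (ℓ z) * maxProd E S U (ℓ z) ∂μ +
      (1 - (Nat.card (ResidueField o) : ℂ)⁻¹) * ∑ I ∈ U.powerset with I ≠ U ∧ #I < n,
        (∑ j ∈ range (n - #I), (-1 : ℂ) ^ j * ((#U - #I - 1).choose j : ℂ) *
          (Nat.card (ResidueField o) : ℂ)⁻¹ ^ j) *
        ∫ z, residueInd I (ℓ z) * maxProd E S I (ℓ z) ∂μ := by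
  have hintegrable := h.integrable_residueInd_mul_maxProd_mul_residueInd hS
  have hint_sum : ∀ I, Integrable (fun z => ∑ K ∈ (U \ I).powerset, (-1 : ℂ) ^ #K *
      (residueInd I (ℓ z) * maxProd E S I (ℓ z) * residueInd K (ℓ z))) μ := fun I =>
    integrable_finsetSum _ fun K _ => (hintegrable I K I).const_mul _
  rw [integral_congr_ae (.of_forall fun z => h.maxProd_eq_sum U z),
    integral_add (by simpa only [residueInd_empty, mul_one] using hintegrable U ∅ U)
      (integrable_finsetSum _ fun I _ => hint_sum I),
    integral_finsetSum _ fun I _ => hint_sum I, mul_sum]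
  congr 1
  refine sum_congr rfl fun I hI => ?_
  obtain ⟨hIU, hne, hcard⟩ := mem_filter.1 hI
  rw [integral_finsetSum _ fun K _ => (hintegrable I K I).const_mul _,
    ← h.sum_powerset_integral_residueInd_mul_maxProd ((mem_powerset.1 hIU).ssubset_of_ne hne)
      hcard.le]
  exact sum_congr rfl fun K _ => integral_const_mul _ _

end GenericForms

end GenericForms

end

/-! ### Topological limits -/

section

open Finset

section CompleteChains

variable {α : Type*}

theorem card_injOn_of_isChain {C : Finset (Finset α)} (hC : IsChain (· ⊆ ·) (C : Set (Finset α))) :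
    Set.InjOn Finset.card (C : Set (Finset α)) := by
  intro I hI J hJ hcard
  rcases hC.total hI hJ with hIJ | hJI
  · exact eq_of_subset_of_card_le hIJ hcard.ge
  · exact (eq_of_subset_of_card_le hJI hcard.le).symm

variable [DecidableEq α] {I J : Finset α} {C : Finset (Finset α)}

theorem card_le_of_mem_weakOrderChains (hC : C ∈ weakOrderChains I) : #C ≤ #I := by
  obtain ⟨hsub, hchain⟩ := mem_weakOrderChains.1 hC
  have hcard : C.image Finset.card ⊆ Icc 1 #I := image_subset_iff.2 fun J hJ =>
    mem_Icc.2 ⟨card_pos.2 (nonempty_iff_ne_empty.2 (hsub J hJ).1), card_le_card (hsub J hJ).2⟩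
  simpa [card_image_of_injOn (card_injOn_of_isChain hchain)] using card_le_card hcard

theorem mem_weakOrderChains_iff_of_subset (hJI : J ⊆ I) :
    C ∈ weakOrderChains J ↔ C ∈ weakOrderChains I ∧ C.sup id ⊆ J := by
  simp only [mem_weakOrderChains, Finset.sup_le_iff, id_eq]
  exact ⟨fun ⟨hsub, hchain⟩ =>
    ⟨⟨fun K hK => ⟨(hsub K hK).1, (hsub K hK).2.trans hJI⟩, hchain⟩, fun K hK => (hsub K hK).2⟩,
    fun ⟨⟨hsub, hchain⟩, hsup⟩ => ⟨fun K hK => ⟨(hsub K hK).1, hsup K hK⟩, hchain⟩⟩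

theorem sup_id_subset_of_mem_weakOrderChains (hC : C ∈ weakOrderChains I) : C.sup id ⊆ I :=
  ((mem_weakOrderChains_iff_of_subset subset_rfl).1 hC).2

theorem card_le_card_sup_id_of_mem_weakOrderChains (hC : C ∈ weakOrderChains I) :
    #C ≤ #(C.sup id) :=
  card_le_of_mem_weakOrderChains <| (mem_weakOrderChains_iff_of_subset
    (sup_id_subset_of_mem_weakOrderChains hC)).2 ⟨hC, subset_rfl⟩

theorem mem_of_mem_weakOrderChains_of_card_eq (hI : I ≠ ∅) (hC : C ∈ weakOrderChains I)
    (hcard : #C = #I) : I ∈ C := by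
  have hsup : C.sup id = I := eq_of_subset_of_card_le (sup_id_subset_of_mem_weakOrderChains hC)
    (hcard ▸ card_le_card_sup_id_of_mem_weakOrderChains hC)
  have hC_pos : 0 < #C := hcard ▸ card_pos.2 (nonempty_iff_ne_empty.2 hI)
  exact hsup ▸ sup_id_mem_of_isChain (mem_weakOrderChains.1 hC).2 (card_pos.1 hC_pos)

theorem sup_id_ssubset_of_notMem (hI : I ≠ ∅) (hC : C ∈ weakOrderChains I) (hIC : I ∉ C) :
    C.sup id ⊂ I := by
  refine (sup_id_subset_of_mem_weakOrderChains hC).ssubset_of_ne fun hsup => ?_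
  rcases C.eq_empty_or_nonempty with rfl | hne
  · exact hI hsup.symm
  · exact hIC (hsup ▸ sup_id_mem_of_isChain (mem_weakOrderChains.1 hC).2 hne)

theorem filter_sup_id_eq_weakOrderChains (hJI : J ⊆ I) (hcard : #J + 1 = #I) :
    {C ∈ weakOrderChains I | (I ∉ C ∧ #C + 1 = #I) ∧ C.sup id = J} =
      {C ∈ weakOrderChains J | #C = #J} := by
  ext C
  simp only [mem_filter, mem_weakOrderChains_iff_of_subset hJI]
  constructor
  · rintro ⟨hC, ⟨-, hCcard⟩, rfl⟩
    exact ⟨⟨hC, subset_rfl⟩, by omega⟩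
  · rintro ⟨⟨hC, hsup⟩, hCcard⟩
    have hsup_eq : C.sup id = J := eq_of_subset_of_card_le hsup
      (hCcard ▸ card_le_card_sup_id_of_mem_weakOrderChains hC)
    refine ⟨hC, ⟨fun hIC => ?_, by omega⟩, hsup_eq⟩
    rw [← hsup_eq, sup_id_eq_of_mem_weakOrderChains hC hIC] at hcard
    omega

variable {k : Type*} [CommSemiring k]

/-- The sum of the products of the weights of the members of `C` over the complete chains `C` of
nonempty subsets of `I`, those that have `#I` members. -/
noncomputable def completeChainSum (w : Finset α → k) (I : Finset α) : k :=
  ∑ C ∈ weakOrderChains I with #C = #I, ∏ J ∈ C, w J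

theorem completeChainSum_empty (w : Finset α → k) : completeChainSum w ∅ = 1 := by
  have hchains : {C ∈ weakOrderChains (∅ : Finset α) | #C = #(∅ : Finset α)} = {∅} := by
    ext C
    simp +contextual [mem_weakOrderChains]
  rw [completeChainSum, hchains, sum_singleton, prod_empty]

theorem completeChainSum_eq (w : Finset α → k) (hI : I ≠ ∅) :
    completeChainSum w I =
      w I * ∑ J ∈ I.powerset with #J + 1 = #I, completeChainSum w J := by
  have hmem : ∀ C ∈ weakOrderChains I, #C = #I ↔ I ∈ C ∧ #C = #I := fun C hC =>
    ⟨fun hcard => ⟨mem_of_mem_weakOrderChains_of_card_eq hI hC hcard, hcard⟩, And.right⟩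
  have hmaps : ∀ C ∈ weakOrderChains I, I ∉ C ∧ #C + 1 = #I →
      C.sup id ∈ I.powerset.filter fun J => #J + 1 = #I := by
    intro C hC ⟨hIC, hcard⟩
    have hlt := sup_id_ssubset_of_notMem hI hC hIC
    have hle := card_le_card_sup_id_of_mem_weakOrderChains hC
    exact mem_filter.2 ⟨mem_powerset.2 hlt.subset, by have := card_lt_card hlt; omega⟩
  rw [completeChainSum, filter_congr hmem, ← filter_filter, sum_filter,
    sum_filter_mem_eq_sum_insert (insert_mem_weakOrderChains_iff hI), ← sum_filter, filter_filter,
    filter_congr (q := fun C => I ∉ C ∧ #C + 1 = #I) (by grind), mul_sum,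
    ← sum_fiberwise_of_maps_to (g := fun C => C.sup id)
      fun C hC => hmaps C (mem_filter.1 hC).1 (mem_filter.1 hC).2]
  refine sum_congr rfl fun J hJ => ?_
  obtain ⟨hJI, hcard⟩ := mem_filter.1 hJ
  rw [filter_filter, completeChainSum,
    ← filter_sup_id_eq_weakOrderChains (mem_powerset.1 hJI) hcard, mul_sum]
  exact sum_congr rfl fun C hC => prod_insert (mem_filter.1 hC).2.1.1

end CompleteChains

theorem sum_range_neg_one_pow_mul_choose {k : Type*} [CommRing k] {N r : ℕ} (h : N < r) :
    ∑ j ∈ range r, (-1 : k) ^ j * (N.choose j : k) = if N = 0 then 1 else 0 := by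
  have hrange : ∑ j ∈ range (N + 1), (-1 : k) ^ j * (N.choose j : k) =
      ∑ j ∈ range r, (-1 : k) ^ j * (N.choose j : k) :=
    sum_subset (range_mono h) fun j _ hj => by
      rw [Nat.choose_eq_zero_of_lt (by simpa using hj), Nat.cast_zero, mul_zero]
  rw [← hrange]
  exact_mod_cast congrArg (Int.cast : ℤ → k) (Int.alternating_sum_range_choose (n := N))

section QPow

variable {k : Type*} [Field k]

theorem constantCoeff_qPow (a : k) : PowerSeries.constantCoeff (qPow a) = 1 := by
  rw [← PowerSeries.coeff_zero_eq_constantCoeff_apply, qPow, PowerSeries.coeff_mk]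
  simp

theorem coeff_one_qPow (a : k) : PowerSeries.coeff 1 (qPow a) = a := by simp [qPow]

end QPow

theorem coeff_one_prod_of_constantCoeff_eq_one {κ R : Type*} [CommRing R] {T : Finset κ}
    {f : κ → PowerSeries R} (hf : ∀ i ∈ T, PowerSeries.constantCoeff (f i) = 1) :
    PowerSeries.coeff 1 (∏ i ∈ T, f i) = ∑ i ∈ T, PowerSeries.coeff 1 (f i) := by
  classical
  induction T using Finset.induction_on with
  | empty => simp [PowerSeries.coeff_one]
  | insert i T hi ih =>
    rw [forall_mem_insert] at hf
    rw [prod_insert hi, sum_insert hi, PowerSeries.coeff_one_mul, ih hf.2, hf.1, map_prod,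
      prod_congr rfl hf.2, prod_const_one, mul_one, mul_one]

namespace HyperplaneArrangement

variable {F V : Type*} [Field F] [AddCommGroup V] [Module F V] (A : HyperplaneArrangement F V)

/-- The substitution `expand`, as a ring homomorphism. -/
noncomputable def expandHom : MvPolynomial (Option A.PosFlat) ℚ →+* PowerSeries A.RatFun :=
  MvPolynomial.eval₂Hom (algebraMap ℚ (PowerSeries A.RatFun))
    (fun i => i.elim (-qPow (-1)) fun x => qPow (-A.var x))

/-- The evaluation `evalAt`, as a ring homomorphism. -/
noncomputable def evalAtHom (q : ℕ) (s : A.PosFlat → ℂ) : MvPolynomial (Option A.PosFlat) ℚ →+* ℂ :=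
  MvPolynomial.eval₂Hom (algebraMap ℚ ℂ)
    (fun i => i.elim (-(q : ℂ)⁻¹) fun x => (q : ℂ) ^ (-s x))

theorem expandHom_X_none : A.expandHom (MvPolynomial.X none) = -qPow (-1) := by
  simp [expandHom]

theorem expandHom_X_some (x : A.PosFlat) :
    A.expandHom (MvPolynomial.X (some x)) = qPow (-A.var x) := by
  simp [expandHom]

theorem evalAtHom_X_none (q : ℕ) (s : A.PosFlat → ℂ) :
    A.evalAtHom q s (MvPolynomial.X none) = -(q : ℂ)⁻¹ := by
  simp [evalAtHom]

theorem evalAtHom_X_some (q : ℕ) (s : A.PosFlat → ℂ) (x : A.PosFlat) :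
    A.evalAtHom q s (MvPolynomial.X (some x)) = (q : ℂ) ^ (-s x) := by
  simp [evalAtHom]

/-- A family of numbers `g θ`, indexed like the parameters `q θ` and `s θ`, has the topological
limit `c` if it is given by a rational function `P / D` in `Y = -q⁻¹` and `T_x = q ^ (-s_x)` whose
expansion in `Q - 1` is a power series with constant term `c`. -/
def HasTopologicalLimit {Θ : Type*} (q : Θ → ℕ) (s : Θ → A.PosFlat → ℂ) (g : Θ → ℂ)
    (c : A.RatFun) : Prop :=
  ∃ (P D : MvPolynomial (Option A.PosFlat) ℚ) (z : PowerSeries A.RatFun), A.expandHom D ≠ 0 ∧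
    z * A.expandHom D = A.expandHom P ∧ PowerSeries.constantCoeff z = c ∧
    ∀ θ, A.evalAtHom (q θ) (s θ) D * g θ = A.evalAtHom (q θ) (s θ) P

namespace HasTopologicalLimit

variable {A} {Θ : Type*} {q : Θ → ℕ} {s : Θ → A.PosFlat → ℂ} {g g' : Θ → ℂ} {c c' : A.RatFun}

theorem of_poly (W : MvPolynomial (Option A.PosFlat) ℚ) :
    A.HasTopologicalLimit q s (fun θ => A.evalAtHom (q θ) (s θ) W)
      (PowerSeries.constantCoeff (A.expandHom W)) :=
  ⟨W, 1, A.expandHom W, by simp, by simp, rfl, by simp⟩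

theorem add (h : A.HasTopologicalLimit q s g c) (h' : A.HasTopologicalLimit q s g' c') :
    A.HasTopologicalLimit q s (fun θ => g θ + g' θ) (c + c') := by
  obtain ⟨P, D, z, hD, hz, rfl, hg⟩ := h
  obtain ⟨P', D', z', hD', hz', rfl, hg'⟩ := h'
  refine ⟨P * D' + P' * D, D * D', z + z', ?_, ?_, map_add _ _ _, fun θ => ?_⟩
  · rw [map_mul]
    exact mul_ne_zero hD hD'
  · simp only [map_add, map_mul, ← hz, ← hz']
    ring
  · simp only [map_add, map_mul, ← hg, ← hg']
    ring

theorem mul (h : A.HasTopologicalLimit q s g c) (h' : A.HasTopologicalLimit q s g' c') :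
    A.HasTopologicalLimit q s (fun θ => g θ * g' θ) (c * c') := by
  obtain ⟨P, D, z, hD, hz, rfl, hg⟩ := h
  obtain ⟨P', D', z', hD', hz', rfl, hg'⟩ := h'
  refine ⟨P * P', D * D', z * z', ?_, ?_, map_mul _ _ _, fun θ => ?_⟩
  · rw [map_mul]
    exact mul_ne_zero hD hD'
  · simp only [map_mul, ← hz, ← hz']
    ring
  · simp only [map_mul, ← hg, ← hg']
    ring

theorem sum {κ : Type*} {T : Finset κ} {g : Θ → κ → ℂ} {c : κ → A.RatFun}
    (h : ∀ i ∈ T, A.HasTopologicalLimit q s (fun θ => g θ i) (c i)) :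
    A.HasTopologicalLimit q s (fun θ => ∑ i ∈ T, g θ i) (∑ i ∈ T, c i) := by
  classical
  induction T using Finset.induction_on with
  | empty => simpa using of_poly (A := A) (q := q) (s := s) 0
  | insert i T hi ih =>
    simp only [sum_insert hi]
    rw [forall_mem_insert] at h
    exact h.1.add (ih h.2)

/-- L'Hôpital's rule for the expansion in `Q - 1`. -/
theorem div_of_constantCoeff_eq_zero {N D : MvPolynomial (Option A.PosFlat) ℚ}
    (hN : PowerSeries.constantCoeff (A.expandHom N) = 0)
    (hD : PowerSeries.constantCoeff (A.expandHom D) = 0)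
    (hD_coeff : PowerSeries.coeff 1 (A.expandHom D) ≠ 0)
    (hD_eval : ∀ θ, A.evalAtHom (q θ) (s θ) D ≠ 0) :
    A.HasTopologicalLimit q s
      (fun θ => A.evalAtHom (q θ) (s θ) N / A.evalAtHom (q θ) (s θ) D)
      (PowerSeries.coeff 1 (A.expandHom N) / PowerSeries.coeff 1 (A.expandHom D)) := by
  obtain ⟨a, ha⟩ := PowerSeries.X_dvd_iff.2 hN
  obtain ⟨b, hb⟩ := PowerSeries.X_dvd_iff.2 hD
  have ha_const : PowerSeries.constantCoeff a = PowerSeries.coeff 1 (A.expandHom N) := by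
    simp [ha]
  have hb_const : PowerSeries.constantCoeff b = PowerSeries.coeff 1 (A.expandHom D) := by
    simp [hb]
  have hb_inv : b⁻¹ * b = 1 := PowerSeries.inv_mul_cancel b (hb_const ▸ hD_coeff)
  refine ⟨N, D, a * b⁻¹, fun hzero => hD_coeff (by rw [hzero, map_zero]), ?_, ?_,
    fun θ => mul_div_cancel₀ _ (hD_eval θ)⟩
  · rw [ha, hb]
    linear_combination (a * PowerSeries.X) * hb_inv
  · rw [map_mul, PowerSeries.constantCoeff_inv, ha_const, hb_const, div_eq_mul_inv]

end HasTopologicalLimit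

section Monomials

variable {κ : Type*} (r : ℕ) (T : Finset κ) (v : κ → A.PosFlat)

/-- The monomial in `Y` and the `T_x` with value `q ^ (-r - ∑ s_x)`. -/
noncomputable def zetaMonomial : MvPolynomial (Option A.PosFlat) ℚ :=
  (-MvPolynomial.X none) ^ r * ∏ i ∈ T, MvPolynomial.X (some (v i))

theorem evalAtHom_zetaMonomial (q : ℕ) (s : A.PosFlat → ℂ) :
    A.evalAtHom q s (A.zetaMonomial r T v) = (q : ℂ)⁻¹ ^ r * ∏ i ∈ T, (q : ℂ) ^ (-s (v i)) := by
  simp [zetaMonomial, evalAtHom_X_none, evalAtHom_X_some]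

theorem expandHom_zetaMonomial :
    A.expandHom (A.zetaMonomial r T v) = qPow (-1) ^ r * ∏ i ∈ T, qPow (-A.var (v i)) := by
  simp [zetaMonomial, expandHom_X_none, expandHom_X_some]

theorem constantCoeff_expandHom_zetaMonomial :
    PowerSeries.constantCoeff (A.expandHom (A.zetaMonomial r T v)) = 1 := by
  simp [expandHom_zetaMonomial, constantCoeff_qPow]

theorem coeff_one_expandHom_zetaMonomial :
    PowerSeries.coeff 1 (A.expandHom (A.zetaMonomial r T v)) =
      -((r : A.RatFun) + ∑ i ∈ T, A.var (v i)) := by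
  rw [expandHom_zetaMonomial, PowerSeries.coeff_one_mul, PowerSeries.coeff_one_pow,
    coeff_one_prod_of_constantCoeff_eq_one fun i _ => constantCoeff_qPow _]
  simp only [coeff_one_qPow, map_pow, map_prod, constantCoeff_qPow, one_pow, prod_const_one,
    sum_neg_distrib]
  ring

theorem natCast_add_sum_var_ne_zero (hr : r ≠ 0) : (r : A.RatFun) + ∑ i ∈ T, A.var (v i) ≠ 0 := by
  have hpoly : (r : MvPolynomial A.PosFlat ℚ) + ∑ i ∈ T, MvPolynomial.X (v i) ≠ 0 := fun hzero => by
    simpa [hr] using congrArg (MvPolynomial.eval 0) hzero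
  simpa [var] using
    (map_ne_zero_iff _ (IsFractionRing.injective (MvPolynomial A.PosFlat ℚ) A.RatFun)).2 hpoly

theorem norm_evalAtHom_zetaMonomial_lt_one (hr : r ≠ 0) {q : ℕ} {s : A.PosFlat → ℂ} (hq : 2 ≤ q)
    (hs : ∀ x, 0 < (s x).re) : ‖A.evalAtHom q s (A.zetaMonomial r T v)‖ < 1 := by
  have hq_one : (1 : ℝ) < q := by exact_mod_cast hq
  rw [evalAtHom_zetaMonomial, norm_mul, norm_pow, norm_inv, Complex.norm_natCast, norm_prod]
  refine mul_lt_one_of_nonneg_of_lt_one_left (by positivity)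
    (pow_lt_one₀ (by positivity) (inv_lt_one_of_one_lt₀ hq_one) hr)
    (prod_le_one (fun _ _ => norm_nonneg _) fun i _ => ?_)
  rw [Complex.norm_natCast_cpow_of_pos (by omega)]
  exact Real.rpow_le_one_of_one_le_of_nonpos hq_one.le (by simpa using (hs _).le)

theorem one_sub_evalAtHom_zetaMonomial_ne_zero (hr : r ≠ 0) {q : ℕ} {s : A.PosFlat → ℂ}
    (hq : 2 ≤ q) (hs : ∀ x, 0 < (s x).re) : 1 - A.evalAtHom q s (A.zetaMonomial r T v) ≠ 0 := by
  refine sub_ne_zero.2 fun hone => ?_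
  simpa [← hone] using A.norm_evalAtHom_zetaMonomial_lt_one r T v hr hq hs

theorem hasTopologicalLimit_one_sub_inv_div {Θ : Type*} {q : Θ → ℕ} {s : Θ → A.PosFlat → ℂ}
    (hr : r ≠ 0) (hq : ∀ θ, 2 ≤ q θ) (hs : ∀ θ x, 0 < (s θ x).re) :
    A.HasTopologicalLimit q s
      (fun θ => (1 - (q θ : ℂ)⁻¹) / (1 - A.evalAtHom (q θ) (s θ) (A.zetaMonomial r T v)))
      ((r : A.RatFun) + ∑ i ∈ T, A.var (v i))⁻¹ := by
  have hlim := HasTopologicalLimit.div_of_constantCoeff_eq_zero (A := A) (q := q) (s := s)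
    (N := 1 + MvPolynomial.X none) (D := 1 - A.zetaMonomial r T v)
    (by simp [expandHom_X_none, constantCoeff_qPow])
    (by simp [constantCoeff_expandHom_zetaMonomial])
    (by simpa [coeff_one_expandHom_zetaMonomial, PowerSeries.coeff_one] using
      A.natCast_add_sum_var_ne_zero r T v hr)
    (fun θ => by
      simpa using A.one_sub_evalAtHom_zetaMonomial_ne_zero r T v hr (hq θ) (hs θ))
  simpa [expandHom_X_none, evalAtHom_X_none, coeff_one_expandHom_zetaMonomial, coeff_one_qPow,
    PowerSeries.coeff_one, ← sub_eq_add_neg] using hlim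

end Monomials

end HyperplaneArrangement

end

section

open Finset

namespace HyperplaneArrangement

variable {F V : Type*} [Field F] [AddCommGroup V] [Module F V] (A : HyperplaneArrangement F V)
  {ι : Type*} (n : ℕ) (E : Finset (Finset ι)) (v : Finset ι → A.PosFlat)

/-- The coefficient of the contribution of `I` to the zeta function of the forms in `U`, see
`IsRecursionSolution`, as a polynomial in `Y = -q⁻¹`. -/
noncomputable def recursionPoly (U I : Finset ι) : MvPolynomial (Option A.PosFlat) ℚ :=
  ∑ j ∈ range (n - #I), (-1) ^ j *
    ((#U - #I - 1).choose j : MvPolynomial (Option A.PosFlat) ℚ) * (-MvPolynomial.X none) ^ j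

theorem evalAtHom_recursionPoly (q : ℕ) (s : A.PosFlat → ℂ) (U I : Finset ι) :
    A.evalAtHom q s (A.recursionPoly n U I) = ∑ j ∈ range (n - #I),
      (-1 : ℂ) ^ j * ((#U - #I - 1).choose j : ℂ) * (q : ℂ)⁻¹ ^ j := by
  simp [recursionPoly, evalAtHom_X_none]

theorem constantCoeff_expandHom_recursionPoly (U I : Finset ι) :
    PowerSeries.constantCoeff (A.expandHom (A.recursionPoly n U I)) = ∑ j ∈ range (n - #I),
      (-1 : A.RatFun) ^ j * ((#U - #I - 1).choose j : A.RatFun) := by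
  simp [recursionPoly, expandHom_X_none, constantCoeff_qPow]

variable [DecidableEq ι]

/-- The recursion satisfied by the zeta functions `Z U` of the forms in `U`, where `G U` is the
part of the integral over the points at which all the forms in `U` reduce to zero. The second
equation scales these points by a uniformizer, the third one sorts all points by the set `I` of the
forms in `U` that reduce to zero there. -/
structure IsRecursionSolution (q : ℕ) (s : A.PosFlat → ℂ) (G Z : Finset ι → ℂ) : Prop where
  empty : G ∅ = 1
  eq_mul : ∀ U, G U = A.evalAtHom q s (A.zetaMonomial (min #U n) {J ∈ E | J ⊆ U} v) * Z U
  eq_add : ∀ U, Z U = G U + (1 - (q : ℂ)⁻¹) * ∑ I ∈ U.powerset with I ≠ U ∧ #I < n,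
    A.evalAtHom q s (A.recursionPoly n U I) * G I

/-- The weight of a set of forms in the topological zeta function. -/
noncomputable def topWeight (U : Finset ι) : A.RatFun :=
  ((min #U n : ℕ) + ∑ J ∈ E with J ⊆ U, A.var (v J))⁻¹

section Limit

variable {A n E v} {Θ : Type*} {q : Θ → ℕ} {s : Θ → A.PosFlat → ℂ} {G Z : Θ → Finset ι → ℂ}

theorem hasTopologicalLimit_of_forall_lt (hn : n ≠ 0)
    (hrec : ∀ θ, A.IsRecursionSolution n E v (q θ) (s θ) (G θ) (Z θ)) (hq : ∀ θ, 2 ≤ q θ)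
    (hs : ∀ θ x, 0 < (s θ x).re) {U : Finset ι} (hU : U.Nonempty) {c : Finset ι → A.RatFun}
    (hG : ∀ I ⊂ U, #I < n → A.HasTopologicalLimit q s (fun θ => G θ I) (c I)) :
    A.HasTopologicalLimit q s (fun θ => Z θ U) (A.topWeight n E v U *
      ∑ I ∈ U.powerset with I ≠ U ∧ #I < n, (∑ j ∈ range (n - #I),
        (-1 : A.RatFun) ^ j * ((#U - #I - 1).choose j : A.RatFun)) * c I) := by
  have hr : min #U n ≠ 0 := by have := hU.card_pos; omega
  have hlim := (A.hasTopologicalLimit_one_sub_inv_div (min #U n) {J ∈ E | J ⊆ U} v hr hq hs).mul <|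
    HasTopologicalLimit.sum (T := U.powerset.filter fun I => I ≠ U ∧ #I < n) fun I hI => by
      obtain ⟨hIU, hne, hcard⟩ := mem_filter.1 hI
      exact (HasTopologicalLimit.of_poly (A.recursionPoly n U I)).mul
        (hG I ((mem_powerset.1 hIU).ssubset_of_ne hne) hcard)
  simp only [constantCoeff_expandHom_recursionPoly] at hlim
  rw [topWeight]
  convert hlim using 2 with θ
  have hne := A.one_sub_evalAtHom_zetaMonomial_ne_zero (min #U n) {J ∈ E | J ⊆ U} v hr (hq θ) (hs θ)
  have hZ := (hrec θ).eq_add U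
  rw [(hrec θ).eq_mul U] at hZ
  field_simp
  linear_combination hZ

theorem hasTopologicalLimit_completeChainSum
    (hrec : ∀ θ, A.IsRecursionSolution n E v (q θ) (s θ) (G θ) (Z θ)) (hq : ∀ θ, 2 ≤ q θ)
    (hs : ∀ θ x, 0 < (s θ x).re) (U : Finset ι) (hU : #U < n) :
    A.HasTopologicalLimit q s (fun θ => G θ U) (completeChainSum (A.topWeight n E v) U) := by
  induction U using Finset.strongInduction with
  | H U ih =>
  rcases U.eq_empty_or_nonempty with rfl | hne
  · simpa [(hrec _).empty, completeChainSum_empty] using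
      HasTopologicalLimit.of_poly (A := A) (q := q) (s := s) 1
  have hZ := hasTopologicalLimit_of_forall_lt (by omega) hrec hq hs hne ih
  have hcoeff : ∀ I ∈ U.powerset.filter fun I => I ≠ U ∧ #I < n, (∑ j ∈ range (n - #I),
      (-1 : A.RatFun) ^ j * ((#U - #I - 1).choose j : A.RatFun)) *
        completeChainSum (A.topWeight n E v) I =
      if #I + 1 = #U then completeChainSum (A.topWeight n E v) I else 0 := by
    intro I hI
    obtain ⟨hIU, hne, -⟩ := mem_filter.1 hI
    have hcard := card_lt_card ((mem_powerset.1 hIU).ssubset_of_ne hne)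
    rw [sum_range_neg_one_pow_mul_choose (by omega), ite_mul, one_mul, zero_mul]
    exact if_congr (by omega) rfl rfl
  rw [sum_congr rfl hcoeff, ← sum_filter, filter_filter,
    filter_congr (q := fun I => #I + 1 = #U) (by grind), ← completeChainSum_eq _ hne.ne_empty] at hZ
  simpa [(hrec _).eq_mul U, constantCoeff_expandHom_zetaMonomial] using
    (HasTopologicalLimit.of_poly (A.zetaMonomial (min #U n) {J ∈ E | J ⊆ U} v)).mul hZ

theorem hasTopologicalLimit_univ [Fintype ι] (hn : n ≠ 0) (hnm : n ≤ Fintype.card ι)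
    (hrec : ∀ θ, A.IsRecursionSolution n E v (q θ) (s θ) (G θ) (Z θ)) (hq : ∀ θ, 2 ≤ q θ)
    (hs : ∀ θ x, 0 < (s θ x).re) :
    A.HasTopologicalLimit q s (fun θ => Z θ univ) (A.topWeight n E v univ *
      ∑ I with #I < n, (∑ j ∈ range (n - #I),
        (-1 : A.RatFun) ^ j * ((Fintype.card ι - #I - 1).choose j : A.RatFun)) *
          completeChainSum (A.topWeight n E v) I) := by
  have huniv : (univ : Finset ι).Nonempty := card_pos.1 (by rw [card_univ]; omega)
  have hproper : ∀ I ∈ (univ : Finset (Finset ι)), I ≠ univ ∧ #I < n ↔ #I < n := fun I _ =>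
    and_iff_right_of_imp fun hI => by
      rintro rfl
      exact hI.not_ge hnm
  have hZ := hasTopologicalLimit_of_forall_lt hn hrec hq hs huniv fun I _ =>
    hasTopologicalLimit_completeChainSum hrec hq hs I
  rwa [powerset_univ, filter_congr hproper, card_univ] at hZ

variable (A E v) in
/- Indexing a family by all the solutions of the recursion at once makes the rational function
independent of the solution. -/
theorem exists_mul_eq_of_isRecursionSolution [Fintype ι] (hn : n ≠ 0) (hnm : n ≤ Fintype.card ι) :
    ∃ (P D : MvPolynomial (Option A.PosFlat) ℚ) (z : PowerSeries A.RatFun), A.expandHom D ≠ 0 ∧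
      z * A.expandHom D = A.expandHom P ∧
      PowerSeries.constantCoeff z = A.topWeight n E v univ *
        ∑ I with #I < n, (∑ j ∈ range (n - #I),
          (-1 : A.RatFun) ^ j * ((Fintype.card ι - #I - 1).choose j : A.RatFun)) *
            completeChainSum (A.topWeight n E v) I ∧
      ∀ q s G Z, 2 ≤ q → (∀ x, 0 < (s x).re) → A.IsRecursionSolution n E v q s G Z →
        A.evalAtHom q s D * Z univ = A.evalAtHom q s P := by
  obtain ⟨P, D, z, hD, hz, hconst, heval⟩ := hasTopologicalLimit_univ
    (Θ := {θ : ℕ × (A.PosFlat → ℂ) × (Finset ι → ℂ) × (Finset ι → ℂ) // 2 ≤ θ.1 ∧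
      (∀ x, 0 < (θ.2.1 x).re) ∧ A.IsRecursionSolution n E v θ.1 θ.2.1 θ.2.2.1 θ.2.2.2})
    hn hnm (fun θ => θ.2.2.2) (fun θ => θ.2.1) (fun θ => θ.2.2.1)
  exact ⟨P, D, z, hD, hz, hconst, fun q s G Z hq hs hrec =>
    heval ⟨(q, s, G, Z), hq, hs, hrec⟩⟩

end Limit

end HyperplaneArrangement

end

/-! ### Integral models of generic central arrangements -/

section

open Finset HyperplaneArrangement

namespace HyperplaneArrangement

variable {F V : Type*} [Field F] [AddCommGroup V] [Module F V] {A : HyperplaneArrangement F V}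

theorem exists_flat_space_eq_of_mem_hyperplanes {X : AffineSubspace F V} (hX : X ∈ A.hyperplanes) :
    ∃ x : A.Flat, x.space = X :=
  ⟨⟨OrderDual.toDual X, A.nonempty X hX, {X}, by simpa, by simpa using A.le_ambient X hX⟩, rfl⟩

theorem exists_mem_hyperplanes_space_le {x : A.Flat} (hx : x ≠ ⊥) :
    ∃ X ∈ A.hyperplanes, x.space ≤ X := by
  obtain ⟨C, hC, hspace⟩ : ∃ C ⊆ A.hyperplanes, A.ambient ⊓ C.inf id = x.space := x.2.2
  obtain rfl | ⟨X, hX⟩ := C.eq_empty_or_nonempty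
  · refine absurd (Flat.space_injective A ?_) hx
    rw [← hspace, Flat.space_bot, inf_empty, inf_top_eq]
  · exact ⟨X, hC hX, hspace ▸ inf_le_right.trans (Finset.inf_le hX)⟩

theorem eq_of_mem_hyperplanes_of_le {X Y : AffineSubspace F V} (hX : X ∈ A.hyperplanes)
    (hY : Y ∈ A.hyperplanes) (h : X ≤ Y) : X = Y :=
  AffineSubspace.eq_of_direction_eq_of_nonempty_of_le
    (((A.covBy X hX).eq_or_eq (AffineSubspace.direction_le h) (A.covBy Y hY).le).resolve_right
      (A.covBy Y hY).lt.ne).symm (A.nonempty X hX) h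

theorem Flat.ne_bot_of_space_mem_hyperplanes {x : A.Flat} (hx : x.space ∈ A.hyperplanes) :
    x ≠ ⊥ := by
  rintro rfl
  exact (A.covBy _ hx).lt.ne rfl

theorem Flat.isAtom_iff {x : A.Flat} : IsAtom x ↔ x.space ∈ A.hyperplanes := by
  refine ⟨fun hx => ?_, fun hx => ⟨Flat.ne_bot_of_space_mem_hyperplanes hx, fun y hyx => ?_⟩⟩
  · obtain ⟨X, hX, hxX⟩ := exists_mem_hyperplanes_space_le hx.1
    obtain ⟨y, rfl⟩ := exists_flat_space_eq_of_mem_hyperplanes hX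
    rwa [← (hx.le_iff.1 hxX).resolve_left (Flat.ne_bot_of_space_mem_hyperplanes hX)]
  · by_contra hy
    obtain ⟨Y, hY, hyY⟩ := exists_mem_hyperplanes_space_le hy
    have hxy : x.space ≤ y.space := hyx.le
    have hYx : x.space = Y := eq_of_mem_hyperplanes_of_le hx hY (hxy.trans hyY)
    exact hyx.not_ge (hYx ▸ hyY : y.space ≤ x.space)

/-- The hyperplanes `X i` of `B` correspond to the hyperplanes `H i` of `A` under the isomorphism
`φ` of intersection posets. -/
structure IsCompatibleLabelling {F' V' ι : Type*} [Field F'] [AddCommGroup V'] [Module F' V']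
    {B : HyperplaneArrangement F' V'} (φ : B.Flat ≃o A.Flat) (H : ι → AffineSubspace F V)
    (X : ι → B.hyperplanes) : Prop where
  surjective : Function.Surjective X
  le_iff : ∀ (y : B.Flat) i, y.space ≤ (X i).1 ↔ (φ y).space ≤ H i

theorem exists_isCompatibleLabelling {F' V' ι : Type*} [Field F'] [AddCommGroup V'] [Module F' V']
    {B : HyperplaneArrangement F' V'} (φ : B.Flat ≃o A.Flat) {H : ι → AffineSubspace F V}
    (hH : ∀ X, X ∈ A.hyperplanes ↔ ∃ i, H i = X) :
    ∃ X : ι → B.hyperplanes, IsCompatibleLabelling φ H X := by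
  have hatom : ∀ i, ∃ y : B.Flat, y.space ∈ B.hyperplanes ∧ (φ y).space = H i := fun i => by
    have hi := (hH _).2 ⟨i, rfl⟩
    obtain ⟨x, hx⟩ := exists_flat_space_eq_of_mem_hyperplanes hi
    refine ⟨φ.symm x, Flat.isAtom_iff.1 ((φ.symm.isAtom_iff x).2 (Flat.isAtom_iff.2 (hx ▸ hi))), ?_⟩
    rw [φ.apply_symm_apply, hx]
  choose y hy hyH using hatom
  refine ⟨fun i => ⟨_, hy i⟩, fun ⟨Y, hY⟩ => ?_, fun z i => ?_⟩
  · obtain ⟨z, rfl⟩ := exists_flat_space_eq_of_mem_hyperplanes hY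
    obtain ⟨i, hi⟩ := (hH _).1 (Flat.isAtom_iff.1 ((φ.isAtom_iff z).2 (Flat.isAtom_iff.2 hY)))
    have hz : y i = z := φ.injective (Flat.space_injective A ((hyH i).trans hi))
    exact ⟨i, Subtype.ext (congrArg Flat.space hz)⟩
  · rw [← hyH, ← Flat.le_iff, ← Flat.le_iff, φ.le_iff_le]

end HyperplaneArrangement

namespace IsGenericCentral

variable {F : Type*} [Field F] {n m : ℕ} {A : HyperplaneArrangement F (Fin n → F)}
  {H : Fin m → AffineSubspace F (Fin n → F)} (hA : IsGenericCentral A H) {K V : Type*} [Field K]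
  [AddCommGroup V] [Module K V] {B : HyperplaneArrangement K V} {X : Fin m → B.hyperplanes}
  {φ : B.Flat ≃o A.Flat} (hX : IsCompatibleLabelling φ H X)

include hA hX

theorem exists_forall_mem_hyperplane : ∃ z, ∀ i, z ∈ (X i).1 := by
  obtain ⟨z, hz⟩ := (φ.symm (hA.flat univ)).2.1
  refine ⟨z, fun i => (hX.le_iff _ i).2 ?_ hz⟩
  rw [φ.apply_symm_apply, hA.flat_space]
  exact Finset.inf_le (mem_univ i)

theorem exists_mem_notMem_hyperplane {I : Finset (Fin m)} (hI : #I ≤ n) {i₀ : Fin m}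
    (hi₀ : i₀ ∈ I) : ∃ z, (∀ i ∈ I, i ≠ i₀ → z ∈ (X i).1) ∧ z ∉ (X i₀).1 := by
  let y := φ.symm (hA.flat (I.erase i₀))
  have hle : ∀ i, y.space ≤ (X i).1 ↔ i ∈ I.erase i₀ := fun i => by
    rw [hX.le_iff, φ.apply_symm_apply, ← mem_support, hA.support_flat,
      if_pos ((card_erase_lt_of_mem hi₀).trans_le hI)]
  obtain ⟨z, hz, hzi₀⟩ := SetLike.not_le_iff_exists.1 ((hle i₀).not.2 (notMem_erase _ _))
  exact ⟨z, fun i hi hne => (hle i).2 (mem_erase.2 ⟨hne, hi⟩) hz, hzi₀⟩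

theorem mem_hyperplane_of_forall_mem {I : Finset (Fin m)} (hI : n ≤ #I) {z : V}
    (hzB : z ∈ B.ambient) (hz : ∀ i ∈ I, z ∈ (X i).1) (j : Fin m) : z ∈ (X j).1 := by
  have hB : ∀ Y, Y ∈ B.hyperplanes ↔ ∃ i ∈ univ, B.ambient ⊓ (X i).1 = Y := fun Y => by
    simp only [inf_eq_right.2 (B.le_ambient _ (X _).2), mem_univ, true_and]
    refine ⟨fun hY => (hX.surjective ⟨Y, hY⟩).imp fun i hi => congrArg Subtype.val hi, ?_⟩
    rintro ⟨i, rfl⟩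
    exact (X i).2
  have hzI : z ∈ B.ambient ⊓ I.inf fun i => (X i).1 := ⟨hzB, mem_finset_inf.2 hz⟩
  obtain ⟨y, hy⟩ :=
    (HyperplaneArrangement.exists_flat_space_eq_iff hB).2 ⟨⟨z, hzI⟩, I, subset_univ I, rfl⟩
  have hsub : I ⊆ support H (φ y).space := fun i hi => by
    rw [mem_support, ← hX.le_iff, hy]
    exact inf_le_right.trans (Finset.inf_le hi)
  have huniv := (hA.card_support_lt_or_eq_univ (φ y)).resolve_left
    (hI.trans (card_le_card hsub)).not_gt
  refine (hX.le_iff y j).2 (mem_support.1 (huniv ▸ mem_univ j)) ?_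
  rwa [hy]

end IsGenericCentral

end

section

open Finset Matrix

section ClearDenominators

theorem exists_ne_zero_forall_dvd {M κ : Type*} [CommMonoidWithZero M] [NoZeroDivisors M]
    [Nontrivial M] [Finite κ] {P : κ → M → Prop} (h : ∀ k, ∃ e, e ≠ 0 ∧ P k e) :
    ∃ δ : M, δ ≠ 0 ∧ ∀ k, ∃ e, e ∣ δ ∧ P k e := by
  cases nonempty_fintype κ
  choose e he hP using h
  exact ⟨∏ k, e k, prod_ne_zero_iff.2 fun k _ => he k,
    fun k => ⟨e k, dvd_prod_of_mem e (mem_univ k), hP k⟩⟩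

theorem exists_ne_zero_algebraMap_eq_mul {R K κ : Type*} [CommRing R] [Nontrivial R] [CommRing K]
    [Algebra R K] [IsFractionRing R K] [Finite κ] (f : κ → K) :
    ∃ δ : R, δ ≠ 0 ∧ ∃ g : κ → R, ∀ k, algebraMap R K (g k) = algebraMap R K δ * f k := by
  obtain ⟨b, hb⟩ := IsLocalization.exist_integer_multiples_of_finite (nonZeroDivisors R) f
  choose g hg using hb
  exact ⟨b, nonZeroDivisors.ne_zero b.2, g, fun k => by rw [hg, Algebra.smul_def]⟩

variable {ι κ : Type*} [Fintype κ]

theorem exists_combination_of_forall_eq_zero {K : Type*} [Field K] {I : Finset ι} {j : ι}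
    {c : ι → K} {α : ι → κ → K} {z₀ : κ → K} (h₀ : ∀ i ∈ I, c i + α i ⬝ᵥ z₀ = 0)
    (h : ∀ z, (∀ i ∈ I, c i + α i ⬝ᵥ z = 0) → c j + α j ⬝ᵥ z = 0) :
    ∃ b : ι → K, α j = ∑ i ∈ I, b i • α i ∧ c j = ∑ i ∈ I, b i * c i := by
  classical
  have hker : ⨅ i : I, (dotProductEquiv K κ (α i)).ker ≤ (dotProductEquiv K κ (α j)).ker := by
    intro w hw
    simp only [Submodule.mem_iInf, LinearMap.mem_ker, dotProductEquiv_apply_apply] at hw ⊢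
    have hj := h (z₀ + w) fun i hi => by
      rw [dotProduct_add, hw ⟨i, hi⟩, add_zero, h₀ i hi]
    rwa [dotProduct_add, ← add_assoc, h z₀ h₀, zero_add] at hj
  have hspan : dotProductEquiv K κ (α j) ∈
      Submodule.span K ((fun i => dotProductEquiv K κ (α i)) '' I) := by
    rw [Set.image_eq_range]
    exact mem_span_of_iInf_ker_le_ker hker
  obtain ⟨b, hb⟩ := (Submodule.mem_span_image_finset_iff_exists_fun' K).1 hspan
  have hα : α j = ∑ i ∈ I, b i • α i := (dotProductEquiv K κ).injective <| by
    simp only [map_sum, map_smul, hb]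
  refine ⟨b, hα, ?_⟩
  rw [eq_neg_of_add_eq_zero_left (h z₀ h₀), hα, sum_dotProduct, ← sum_neg_distrib]
  exact sum_congr rfl fun i hi => by
    rw [eq_neg_of_add_eq_zero_left (h₀ i hi), smul_dotProduct, smul_eq_mul, mul_neg]

variable {R K : Type*} [CommRing R] [Nontrivial R] [Field K] [Algebra R K] [IsFractionRing R K]
  {c : ι → R} {α : ι → κ → R}

theorem exists_integral_combination [Finite ι] {I : Finset ι} {j : ι} {z₀ : κ → K}
    (h₀ : ∀ i ∈ I, algebraMap R K (c i) + (algebraMap R K ∘ α i) ⬝ᵥ z₀ = 0)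
    (h : ∀ z : κ → K, (∀ i ∈ I, algebraMap R K (c i) + (algebraMap R K ∘ α i) ⬝ᵥ z = 0) →
      algebraMap R K (c j) + (algebraMap R K ∘ α j) ⬝ᵥ z = 0) :
    ∃ δ : R, δ ≠ 0 ∧ ∃ a : ι → R,
      δ • α j = ∑ i ∈ I, a i • α i ∧ δ * c j = ∑ i ∈ I, a i * c i := by
  obtain ⟨b, hα, hc⟩ := exists_combination_of_forall_eq_zero h₀ h
  obtain ⟨δ, hδ, a, ha⟩ := exists_ne_zero_algebraMap_eq_mul (R := R) b
  have hinj := FaithfulSMul.algebraMap_injective R K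
  refine ⟨δ, hδ, a, funext fun k => hinj ?_, hinj ?_⟩
  · have hk := congrFun hα k
    simp only [Function.comp_apply, Finset.sum_apply, Pi.smul_apply, smul_eq_mul] at hk
    simp only [Finset.sum_apply, Pi.smul_apply, smul_eq_mul, map_mul, map_sum, ha, hk, mul_sum,
      mul_assoc]
  · simp only [map_mul, map_sum, ha, hc, mul_sum, mul_assoc]

theorem exists_integral_dual_vector [DecidableEq ι] {I : Finset ι} {i₀ : ι} {z₀ z : κ → K}
    (h₀ : ∀ i ∈ I, algebraMap R K (c i) + (algebraMap R K ∘ α i) ⬝ᵥ z₀ = 0)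
    (h : ∀ i ∈ I, i ≠ i₀ → algebraMap R K (c i) + (algebraMap R K ∘ α i) ⬝ᵥ z = 0)
    (hne : algebraMap R K (c i₀) + (algebraMap R K ∘ α i₀) ⬝ᵥ z ≠ 0) (hi₀ : i₀ ∈ I) :
    ∃ δ : R, δ ≠ 0 ∧ ∃ v : κ → R, ∀ i ∈ I, α i ⬝ᵥ v = if i = i₀ then δ else 0 := by
  obtain ⟨δ, hδ, v, hv⟩ := exists_ne_zero_algebraMap_eq_mul (R := R) (z - z₀)
  have hinj := FaithfulSMul.algebraMap_injective R K
  have hv' : algebraMap R K ∘ v = algebraMap R K δ • (z - z₀) := funext hv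
  have hdot : ∀ i ∈ I, algebraMap R K (α i ⬝ᵥ v) =
      algebraMap R K δ * (algebraMap R K (c i) + (algebraMap R K ∘ α i) ⬝ᵥ z) := fun i hi => by
    rw [RingHom.map_dotProduct, hv', dotProduct_smul, dotProduct_sub, smul_eq_mul]
    linear_combination algebraMap R K δ * -h₀ i hi
  refine ⟨α i₀ ⬝ᵥ v, fun hzero => ?_, v, fun i hi => ?_⟩
  · have hmul := hdot i₀ hi₀
    rw [hzero, map_zero, eq_comm] at hmul
    exact mul_ne_zero ((map_ne_zero_iff _ hinj).2 hδ) hne hmul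
  · split_ifs with hii₀
    · rw [hii₀]
    · exact hinj (by rw [hdot i hi, h i hi hii₀, mul_zero, map_zero])

end ClearDenominators

section DiscreteValuationRing

open IsLocalRing NumberField

variable {o o' : Type*} [CommRing o] [IsDomain o] [IsDiscreteValuationRing o]
  [CommRing o'] [IsDomain o'] [IsDiscreteValuationRing o'] [Algebra o o']

attribute [local instance] Ideal.Quotient.field

theorem injective_algebraMap_of_map_maximalIdeal_eq
    (h : (maximalIdeal o).map (algebraMap o o') = maximalIdeal o') :
    Function.Injective (algebraMap o o') := by
  rw [RingHom.injective_iff_ker_eq_bot]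
  by_contra hker
  have hmax : RingHom.ker (algebraMap o o') = maximalIdeal o :=
    eq_maximalIdeal ((RingHom.ker_isPrime _).isMaximal hker)
  exact IsDiscreteValuationRing.not_a_field o' (h.symm.trans ((Ideal.map_eq_bot_iff_le_ker _).2
    hmax.ge))

theorem IsUnramifiedOfDegree.natCard_residueField {f : ℕ} (h : IsUnramifiedOfDegree o o' f) :
    Nat.card (ResidueField o') = Nat.card (ResidueField o) ^ f := by
  obtain ⟨hfinite, hdegree, hmap⟩ := h
  have : FaithfulSMul o o' := (faithfulSMul_iff_algebraMap_injective o o').2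
    (injective_algebraMap_of_map_maximalIdeal_eq hmap)
  have : Module.IsTorsionFree o o' := inferInstance
  have : Module.Free o o' := inferInstance
  have : Module.Finite (o ⧸ maximalIdeal o) (o' ⧸ (maximalIdeal o).map (algebraMap o o')) :=
    Module.Finite.of_restrictScalars_finite o _ _
  have hcard := Module.natCard_eq_pow_finrank (K := o ⧸ maximalIdeal o)
    (V := o' ⧸ (maximalIdeal o).map (algebraMap o o'))
  rwa [finrank_quotient_map, hdegree, hmap] at hcard

theorem isUnit_algebraMap_of_ringChar_notMem {K : Type*} [Field K] [NumberField K]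
    [Algebra (𝓞 K) o] [Finite (ResidueField o)] {δ : 𝓞 K} (hδ : δ ≠ 0)
    (h : ringChar (ResidueField o) ∉ (Ideal.absNorm (Ideal.span {δ})).primeFactors) :
    IsUnit (algebraMap (𝓞 K) o δ) := by
  have hN : Ideal.absNorm (Ideal.span {δ}) ≠ 0 := by
    rwa [Ne, Ideal.absNorm_eq_zero_iff, Ideal.span_singleton_eq_bot]
  have hp : (ringChar (ResidueField o)).Prime := CharP.char_is_prime (ResidueField o) _
  obtain ⟨c, hc⟩ := Ideal.mem_span_singleton'.1 (Ideal.absNorm_mem (Ideal.span {δ}))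
  by_contra hunit
  have hres : residue o (algebraMap (𝓞 K) o δ) = 0 :=
    (residue_eq_zero_iff _).2 ((mem_maximalIdeal _).2 hunit)
  refine h (Nat.mem_primeFactors.2 ⟨hp, (ringChar.spec _ _).1 ?_, hN⟩)
  have hcast := congrArg (fun x => residue o (algebraMap (𝓞 K) o x)) hc
  simpa only [map_mul, map_natCast, hres, mul_zero, eq_comm] using hcast

end DiscreteValuationRing

end

section

open MeasureTheory Finset Matrix Topology IsLocalRing HyperplaneArrangement

section AffineForms

variable {ι κ : Type*} [Fintype κ]

theorem exists_forall_dotProduct_eq {o : Type*} [CommRing o] [DecidableEq ι] {I : Finset ι}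
    {α : ι → κ → o} (hdual : ∀ i₀ ∈ I, ∃ v, ∀ i ∈ I, α i ⬝ᵥ v = if i = i₀ then 1 else 0)
    (t : ι → o) : ∃ z, ∀ i ∈ I, α i ⬝ᵥ z = t i := by
  choose! v hv using hdual
  refine ⟨∑ i₀ ∈ I, t i₀ • v i₀, fun i hi => ?_⟩
  calc α i ⬝ᵥ ∑ i₀ ∈ I, t i₀ • v i₀ = ∑ i₀ ∈ I, t i₀ * if i = i₀ then 1 else 0 := by
        rw [dotProduct_sum]
        exact sum_congr rfl fun i₀ hi₀ => by rw [dotProduct_smul, smul_eq_mul, hv i₀ hi₀ i hi]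
    _ = t i := by simp only [mul_ite, mul_one, mul_zero, sum_ite_eq, if_pos hi]

variable {o : Type*} [CommRing o] [TopologicalSpace o] [IsTopologicalRing o] [CompactSpace o]
  [MeasurableSpace o] [BorelSpace o]

theorem measurePreserving_affineForms [SecondCountableTopology o] [DecidableEq ι]
    {I J : Finset ι} (c : ι → o) {α : ι → κ → o} (hIJ : Disjoint I J)
    (hsurj : ∀ t : ι → o, ∃ z, ∀ i ∈ I ∪ J, α i ⬝ᵥ z = t i) :
    MeasurePreserving (fun z => (I.restrict fun i => c i + α i ⬝ᵥ z,
      J.restrict fun i => c i + α i ⬝ᵥ z)) (haarPi o κ) ((haarPi o I).prod (haarPi o J)) := by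
  let g : (κ → o) →+ (I → o) × (J → o) :=
    { toFun := fun z => (fun i => α i ⬝ᵥ z, fun j => α j ⬝ᵥ z)
      map_zero' := by ext <;> simp
      map_add' := fun z w => by ext <;> simp [dotProduct_add] }
  have hcont : Continuous g := by
    refine .prodMk (continuous_pi fun i => ?_) (continuous_pi fun i => ?_) <;>
    exact continuous_const.dotProduct continuous_id
  have hgsurj : Function.Surjective g := by
    rintro ⟨x, y⟩
    obtain ⟨z, hz⟩ := hsurj fun i =>
      if hi : i ∈ I then x ⟨i, hi⟩ else if hi : i ∈ J then y ⟨i, hi⟩ else 0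
    refine ⟨z, Prod.ext (funext fun i => ?_) (funext fun j => ?_)⟩
    · exact (hz i (mem_union_left _ i.2)).trans (dif_pos i.2)
    · refine (hz j (mem_union_right _ j.2)).trans ?_
      rw [dif_neg fun hj => disjoint_left.1 hIJ hj j.2, dif_pos j.2]
  have hg : MeasurePreserving g (haarPi o κ) ((haarPi o I).prod (haarPi o J)) :=
    AddMonoidHom.measurePreserving hcont hgsurj (by rw [measure_univ, measure_univ])
  exact (measurePreserving_add_left _
    ((fun i : I => c i, fun j : J => c j) : (I → o) × (J → o))).comp hg

theorem genericForms_affineForms [SecondCountableTopology o] [Fintype ι] {n : ℕ}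
    {c : ι → o} {α : ι → κ → o} (hn : n ≤ Fintype.card ι)
    (hsurj : ∀ I : Finset ι, #I = n → ∀ t : ι → o, ∃ z, ∀ i ∈ I, α i ⬝ᵥ z = t i)
    (hspan : ∀ I : Finset ι, #I = n → ∀ j, ∃ a : ι → o,
      α j = ∑ i ∈ I, a i • α i ∧ c j = ∑ i ∈ I, a i * c i) :
    GenericForms (haarPi o κ) n fun z i => c i + α i ⬝ᵥ z where
  measurable := Continuous.measurable <| continuous_pi fun _ =>
    continuous_const.add (continuous_const.dotProduct continuous_id)
  measurePreserving I J hIJ hcard := by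
    classical
    obtain ⟨M, hM, hMn⟩ := exists_superset_card_eq
      ((card_union_of_disjoint hIJ).trans_le hcard) hn
    exact measurePreserving_affineForms c hIJ fun t =>
      (hsurj M hMn t).imp fun _ hz i hi => hz i (hM hi)
  span I hI j := by
    obtain ⟨a, hα, hc⟩ := hspan I hI j
    refine ⟨a, fun z => ?_⟩
    simp only [hc, hα, sum_dotProduct, smul_dotProduct, smul_eq_mul, mul_add, sum_add_distrib]

end AffineForms

section BaseChange

variable {ι κ R o : Type*} [CommRing R] [CommRing o] {f : R →+* o} {α : ι → κ → R} {δ : R}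

theorem exists_dual_vector_map_of_isUnit [Fintype κ] [DecidableEq ι] {I : Finset ι} {i₀ : ι}
    (hδ : IsUnit (f δ)) (h : ∃ v, ∀ i ∈ I, α i ⬝ᵥ v = if i = i₀ then δ else 0) :
    ∃ v, ∀ i ∈ I, (f ∘ α i) ⬝ᵥ v = if i = i₀ then 1 else 0 := by
  obtain ⟨v, hv⟩ := h
  obtain ⟨e, he⟩ := hδ.exists_left_inv
  refine ⟨e • (f ∘ v), fun i hi => ?_⟩
  rw [dotProduct_smul, ← RingHom.map_dotProduct, hv i hi, smul_eq_mul, apply_ite f, map_zero,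
    mul_ite, he, mul_zero]

theorem exists_combination_map_of_isUnit {I : Finset ι} {j : ι} {c : ι → R} (hδ : IsUnit (f δ))
    (h : ∃ a : ι → R, δ • α j = ∑ i ∈ I, a i • α i ∧ δ * c j = ∑ i ∈ I, a i * c i) :
    ∃ a : ι → o, f ∘ α j = ∑ i ∈ I, a i • (f ∘ α i) ∧ f (c j) = ∑ i ∈ I, a i * f (c i) := by
  obtain ⟨a, hα, hc⟩ := h
  obtain ⟨e, he⟩ := hδ.exists_left_inv
  have hcancel : ∀ {x : R} {y : ι → R}, δ * x = ∑ i ∈ I, a i * y i →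
      f x = ∑ i ∈ I, e * f (a i) * f (y i) := fun {x y} hxy => by
    calc f x = e * f (δ * x) := by rw [map_mul, ← mul_assoc, he, one_mul]
      _ = ∑ i ∈ I, e * f (a i) * f (y i) := by
        simp only [hxy, map_sum, map_mul, mul_sum, mul_assoc]
  refine ⟨fun i => e * f (a i), funext fun k => ?_, hcancel hc⟩
  rw [Finset.sum_apply]
  exact hcancel ((congrFun hα k).trans (Finset.sum_apply _ _ _))

end BaseChange

namespace IsGenericCentral

open NumberField

variable {F : Type*} [Field F] {n m : ℕ} {A : HyperplaneArrangement F (Fin n → F)}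
  {H : Fin m → AffineSubspace F (Fin n → F)} (hA : IsGenericCentral A H) {K : Type*} [Field K]
  [NumberField K] {d : ℕ} {B : HyperplaneArrangement K (Fin d → K)} (L : B.IntegralForms)
  {X : Fin m → B.hyperplanes} {φ : B.Flat ≃o A.Flat} (hX : IsCompatibleLabelling φ H X)

include hA hX

theorem exists_dual_coeff : ∃ δ : 𝓞 K, δ ≠ 0 ∧ ∀ p : {p : Finset (Fin m) × Fin m //
    #p.1 = n ∧ p.2 ∈ p.1}, ∃ e, e ∣ δ ∧
      ∃ v, ∀ i ∈ p.1.1, L.coeff (X i) ⬝ᵥ v = if i = p.1.2 then e else 0 := by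
  refine exists_ne_zero_forall_dvd fun ⟨⟨I, i₀⟩, hI, hi₀⟩ => ?_
  obtain ⟨z₀, hz₀⟩ := hA.exists_forall_mem_hyperplane hX
  obtain ⟨z, hz, hzi₀⟩ := hA.exists_mem_notMem_hyperplane hX hI.le hi₀
  exact exists_integral_dual_vector (K := K) (c := fun i => L.const (X i))
    (fun i _ => (L.mem_iff _ _).1 (hz₀ i)) (fun i hi hne => (L.mem_iff _ _).1 (hz i hi hne))
    ((L.mem_iff _ _).not.1 hzi₀) hi₀

theorem exists_combination_coeff (hB : B.ambient = ⊤) : ∃ δ : 𝓞 K, δ ≠ 0 ∧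
    ∀ p : {I : Finset (Fin m) // #I = n} × Fin m, ∃ e, e ∣ δ ∧ ∃ a : Fin m → 𝓞 K,
      e • L.coeff (X p.2) = ∑ i ∈ p.1.1, a i • L.coeff (X i) ∧
        e * L.const (X p.2) = ∑ i ∈ p.1.1, a i * L.const (X i) := by
  refine exists_ne_zero_forall_dvd fun ⟨⟨I, hI⟩, j⟩ => ?_
  obtain ⟨z₀, hz₀⟩ := hA.exists_forall_mem_hyperplane hX
  refine exists_integral_combination (K := K) (c := fun i => L.const (X i))
    (α := fun i => L.coeff (X i)) (fun i _ => (L.mem_iff _ _).1 (hz₀ i)) fun z hz => ?_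
  exact (L.mem_iff _ _).1 (hA.mem_hyperplane_of_forall_mem hX hI.ge (hB ▸ trivial)
    (fun i hi => (L.mem_iff _ _).2 (hz i hi)) j)

/- The primes to be avoided are those dividing a common denominator of the dual vectors and the
linear relations of the forms over `K`. -/
theorem exists_genericForms (hnm : n ≤ m) (hB : B.ambient = ⊤) : ∃ δ : 𝓞 K, δ ≠ 0 ∧
    ∀ (o : Type) [CommRing o] [IsDomain o] [IsDiscreteValuationRing o] [TopologicalSpace o]
      [IsTopologicalRing o] [CompactSpace o] [T2Space o] [MeasurableSpace o] [BorelSpace o]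
      [Algebra (𝓞 K) o], IsUnit (algebraMap (𝓞 K) o δ) →
      GenericForms (haarPi o (Fin d)) n fun z i => L.eval (X i) z := by
  obtain ⟨δ₁, hδ₁, hdual⟩ := hA.exists_dual_coeff L hX
  obtain ⟨δ₂, hδ₂, hcomb⟩ := hA.exists_combination_coeff L hX hB
  refine ⟨δ₁ * δ₂, mul_ne_zero hδ₁ hδ₂, fun o => ?_⟩
  intros _ _ _ _ _ _ _ _ _ _ hunit
  have := secondCountableTopology_of_compact_isLocalRing o
  have isUnit_of_dvd : ∀ {e : 𝓞 K}, e ∣ δ₁ * δ₂ → IsUnit (algebraMap (𝓞 K) o e) :=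
    fun he => isUnit_of_dvd_unit (map_dvd _ he) hunit
  refine genericForms_affineForms (c := fun i => algebraMap (𝓞 K) o (L.const (X i)))
    (α := fun i => algebraMap (𝓞 K) o ∘ L.coeff (X i)) (by rwa [Fintype.card_fin])
    (fun I hI => exists_forall_dotProduct_eq fun i₀ hi₀ => ?_) (fun I hI j => ?_)
  · obtain ⟨e, he, hv⟩ := hdual ⟨⟨I, i₀⟩, hI, hi₀⟩
    exact exists_dual_vector_map_of_isUnit (isUnit_of_dvd (he.mul_right _)) hv
  · obtain ⟨e, he, ha⟩ := hcomb ⟨⟨I, hI⟩, j⟩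
    exact exists_combination_map_of_isUnit (α := fun i => L.coeff (X i))
      (c := fun i => L.const (X i)) (isUnit_of_dvd (he.mul_left _)) ha

end IsGenericCentral

end

/-! ### The zeta functions of generic central arrangements -/

section

open MeasureTheory Finset IsLocalRing NumberField HyperplaneArrangement

/-- The sets of hyperplanes of a generic central arrangement that contain a given flat different
from the bottom element, see `IsGenericCentral.support_mem_flatSupports`. -/
def flatSupports (n m : ℕ) : Finset (Finset (Fin m)) :=
  univ.filter fun J => J ≠ ∅ ∧ (#J < n ∨ J = univ)

theorem mem_flatSupports {n m : ℕ} {J : Finset (Fin m)} :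
    J ∈ flatSupports n m ↔ J ≠ ∅ ∧ (#J < n ∨ J = univ) :=
  mem_filter_univ J

namespace IsGenericCentral

variable {F : Type*} [Field F] {n m : ℕ} {A : HyperplaneArrangement F (Fin n → F)}
  {H : Fin m → AffineSubspace F (Fin n → F)}

theorem support_mem_flatSupports (hA : IsGenericCentral A H) (x : A.PosFlat) :
    support H x.1.space ∈ flatSupports n m :=
  mem_flatSupports.2 ⟨hA.support_ne_empty x, hA.card_support_lt_or_eq_univ x.1⟩

theorem support_posFlat (hA : IsGenericCentral A H) (hn : 1 ≤ n) (hnm : n ≤ m)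
    {J : Finset (Fin m)} (hJ : J ∈ flatSupports n m) :
    support H (hA.posFlat hn hnm J).1.space = J := by
  obtain ⟨hne, hlt | rfl⟩ := mem_flatSupports.1 hJ
  · exact hA.support_posFlat_of_lt hn hnm hne hlt
  · exact hA.support_posFlat_univ hn hnm

theorem prod_posFlat {M : Type*} [CommMonoid M] (hA : IsGenericCentral A H) (hn : 1 ≤ n)
    (hnm : n ≤ m) (f : A.PosFlat → M) :
    ∏ x, f x = ∏ J ∈ flatSupports n m, f (hA.posFlat hn hnm J) :=
  prod_bij' (fun x _ => support H x.1.space) (fun J _ => hA.posFlat hn hnm J)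
    (fun x _ => hA.support_mem_flatSupports x) (fun _ _ => mem_univ _)
    (fun x _ => hA.posFlat_support hn hnm x) (fun _ hJ => hA.support_posFlat hn hnm hJ)
    fun x _ => by rw [hA.posFlat_support hn hnm x]

end IsGenericCentral

section AnalyticZeta

variable {F V : Type*} [Field F] [AddCommGroup V] [Module F V] {A : HyperplaneArrangement F V}
  {K : Type*} [Field K] {d : ℕ} {B : HyperplaneArrangement K (Fin d → K)} {φ : B.Flat ≃o A.Flat}

theorem bijective_posMap (φ : B.Flat ≃o A.Flat) : Function.Bijective (posMap φ) :=
  ⟨fun _ _ h => Subtype.ext (φ.injective (congrArg Subtype.val h)),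
    fun y => ⟨⟨φ.symm y.1, by simpa using y.2⟩, Subtype.ext (φ.apply_symm_apply y.1)⟩⟩

theorem HyperplaneArrangement.IsCompatibleLabelling.maxAbs_eq {ι : Type*} [Fintype ι]
    {H : ι → AffineSubspace F V} {X : ι → B.hyperplanes} (hX : IsCompatibleLabelling φ H X)
    (L : B.IntegralForms)
    {o : Type*} [CommRing o] [IsDomain o] [IsDiscreteValuationRing o] [Algebra (𝓞 K) o]
    (x : B.PosFlat) (z : Fin d → o) : L.maxAbs x z =
      (support H (posMap φ x).1.space).sup fun i => dvrAbs (L.eval (X i) z) := by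
  classical
  have hmem : ∀ i, i ∈ support H (posMap φ x).1.space ↔ x.1.space ≤ (X i).1 := fun i => by
    rw [mem_support, hX.le_iff, posMap]
  refine le_antisymm (Finset.sup_le fun Y hY => ?_) (Finset.sup_le fun i hi => ?_)
  · obtain ⟨i, rfl⟩ := hX.surjective Y
    exact Finset.le_sup (f := fun i => dvrAbs (L.eval (X i) z))
      ((hmem i).2 (mem_filter.1 hY).2)
  · exact Finset.le_sup (f := fun Y => dvrAbs (L.eval Y z))
      (mem_filter.2 ⟨mem_univ _, (hmem i).1 hi⟩)

end AnalyticZeta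

namespace IsGenericCentral

variable {F : Type*} [Field F] {n m : ℕ} {A : HyperplaneArrangement F (Fin n → F)}
  {H : Fin m → AffineSubspace F (Fin n → F)}

theorem analyticZeta_eq (hA : IsGenericCentral A H) (hn : 1 ≤ n) (hnm : n ≤ m)
    {K : Type*} [Field K] {d : ℕ} {B : HyperplaneArrangement K (Fin d → K)}
    {X : Fin m → B.hyperplanes} {φ : B.Flat ≃o A.Flat} (hX : IsCompatibleLabelling φ H X)
    (L : B.IntegralForms) (o : Type*) [CommRing o] [IsDomain o] [IsDiscreteValuationRing o]
    [TopologicalSpace o] [IsTopologicalRing o] [CompactSpace o] [Algebra (𝓞 K) o]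
    [hM : MeasurableSpace o] [hborel : BorelSpace o] (s : A.PosFlat → ℂ) :
    L.analyticZeta o (fun x => s (posMap φ x)) =
      ∫ z, maxProd (flatSupports n m) (fun J => s (hA.posFlat hn hnm J)) univ
        (fun i => L.eval (X i) z) ∂haarPi o (Fin d) := by
  obtain rfl : hM = borel o := hborel.measurable_eq
  rw [HyperplaneArrangement.IntegralForms.analyticZeta, haarPi]
  refine integral_congr_ae (.of_forall fun z => ?_)
  let w : A.PosFlat → ℂ := fun y =>
    ((((support H y.1.space).sup fun i => dvrAbs (L.eval (X i) z) : NNReal) : ℝ) : ℂ) ^ s y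
  calc ∏ x : B.PosFlat, (((L.maxAbs x z : NNReal) : ℝ) : ℂ) ^ s (posMap φ x)
      = ∏ x : B.PosFlat, w (posMap φ x) := prod_congr rfl fun x _ => by rw [hX.maxAbs_eq]
    _ = ∏ y, w y := (bijective_posMap φ).prod_comp w
    _ = ∏ J ∈ flatSupports n m, w (hA.posFlat hn hnm J) := hA.prod_posFlat hn hnm w
    _ = maxProd (flatSupports n m) (fun J => s (hA.posFlat hn hnm J)) univ
        (fun i => L.eval (X i) z) := by
      rw [maxProd, filter_true_of_mem fun _ _ => subset_univ _]
      exact prod_congr rfl fun J hJ => by simp only [w, hA.support_posFlat hn hnm hJ]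

end IsGenericCentral

theorem GenericForms.isRecursionSolution {F V : Type*} [Field F] [AddCommGroup V] [Module F V]
    {A : HyperplaneArrangement F V} {ι o Ω : Type*} [DecidableEq ι] [CommRing o] [IsDomain o]
    [IsDiscreteValuationRing o] [TopologicalSpace o] [IsTopologicalRing o] [CompactSpace o]
    [T2Space o] [MeasurableSpace o] [BorelSpace o] [MeasurableSpace Ω] {μ : Measure Ω}
    [IsProbabilityMeasure μ] {n : ℕ} {ℓ : Ω → ι → o} (h : GenericForms μ n ℓ)
    {E : Finset (Finset ι)} (hE : ∅ ∉ E) (v : Finset ι → A.PosFlat) {s : A.PosFlat → ℂ}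
    (hs : ∀ x, 0 < (s x).re) :
    A.IsRecursionSolution n E v (Nat.card (ResidueField o)) s
      (fun U => ∫ z, residueInd U (ℓ z) * maxProd E (fun J => s (v J)) U (ℓ z) ∂μ)
      (fun U => ∫ z, maxProd E (fun J => s (v J)) U (ℓ z) ∂μ) where
  empty := by
    have hsub : E.filter (· = ∅) = ∅ := filter_eq_empty_iff.2 fun J hJ hJ_empty =>
      hE (hJ_empty ▸ hJ)
    simp [residueInd_empty, maxProd, hsub]
  eq_mul U := by
    rw [evalAtHom_zetaMonomial]
    exact h.integral_residueInd_mul_maxProd U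
  eq_add U := by
    simp only [evalAtHom_recursionPoly]
    exact h.integral_maxProd (fun J _ => hs (v J)) U

namespace IsGenericCentral

variable {F : Type*} [Field F] {n m : ℕ} {A : HyperplaneArrangement F (Fin n → F)}
  {H : Fin m → AffineSubspace F (Fin n → F)}

theorem isTopologicalZeta (hA : IsGenericCentral A H) (hn : 1 ≤ n) (hnm : n ≤ m) :
    A.IsTopologicalZeta (A.topWeight n (flatSupports n m) (hA.posFlat hn hnm) univ *
      ∑ I : Finset (Fin m) with #I < n,
        (∑ j ∈ range (n - #I), (-1 : A.RatFun) ^ j * ((m - #I - 1).choose j : A.RatFun)) *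
          completeChainSum (A.topWeight n (flatSupports n m) (hA.posFlat hn hnm)) I) := by
  obtain ⟨P, D, w, hD, hw, hconst, heval⟩ := A.exists_mul_eq_of_isRecursionSolution
    (n := n) (flatSupports n m) (hA.posFlat hn hnm) (by omega) (by rwa [Fintype.card_fin])
  rw [Fintype.card_fin] at hconst
  intro K _ _ d B hB φ L
  obtain ⟨X, hX⟩ := exists_isCompatibleLabelling φ hA.mem_hyperplanes
  obtain ⟨δ, hδ, hgeneric⟩ := hA.exists_genericForms L hX hnm hB
  refine ⟨(Ideal.absNorm (Ideal.span {δ})).primeFactors, fun o => ?_⟩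
  intro _ _ _ _ _ _ _ _ hchar
  refine ⟨P, D, fun f _ o' => ?_, hD, w, hw, hconst⟩
  intro _ _ _ _ _ _ _ _ _ _ hunramified s hs
  let _ : MeasurableSpace o' := borel o'
  have _ : BorelSpace o' := ⟨rfl⟩
  have hunit : IsUnit (algebraMap (𝓞 K) o' δ) := by
    rw [IsScalarTower.algebraMap_apply (𝓞 K) o o']
    exact (isUnit_algebraMap_of_ringChar_notMem hδ hchar).map _
  rw [hA.analyticZeta_eq hn hnm hX, ← hunramified.natCard_residueField]
  exact heval _ s _ _ Finite.one_lt_card hs <|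
    (hgeneric o' hunit).isRecursionSolution (fun h => (mem_flatSupports.1 h).1 rfl) _ hs

theorem sum_flatSupports {M : Type*} [AddCommGroup M] (hn : 1 ≤ n) (hnm : n ≤ m)
    (f : Finset (Fin m) → M) : ∑ J ∈ flatSupports n m, f J =
      f univ + ∑ r ∈ Icc 1 (n - 1), ∑ J ∈ powersetCard r univ, f J := by
  have hinsert : flatSupports n m =
      insert univ ((univ.filter fun J : Finset (Fin m) => #J < n).erase ∅) := by
    ext J
    have hne := IsGenericCentral.univ_ne_empty hn hnm
    simp only [mem_flatSupports, mem_insert, mem_erase, mem_filter_univ]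
    grind
  have huniv : univ ∉ (univ.filter fun J : Finset (Fin m) => #J < n).erase ∅ := by
    simpa using fun _ => hnm
  have hempty : (∅ : Finset (Fin m)) ∈ univ.filter fun J : Finset (Fin m) => #J < n := by
    rwa [mem_filter_univ, card_empty]
  have hsum := sum_filter_card_lt hn f
  rw [← add_sum_erase _ f hempty] at hsum
  rw [hinsert, sum_insert huniv, add_left_cancel hsum]

section TopologicalZeta

variable (hA : IsGenericCentral A H) (hn : 1 ≤ n) (hnm : n ≤ m) {t : Finset (Fin m) → A.RatFun}
  (ht : ∀ I, t I = A.varOf (I.inf H))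

include ht

theorem topWeight_posFlat {J : Finset (Fin m)} (hJ : #J < n) :
    A.topWeight n (flatSupports n m) (hA.posFlat hn hnm) J =
      ((#J : A.RatFun) + ∑ M ∈ J.powerset.erase ∅, t M)⁻¹ := by
  have hsub : (flatSupports n m).filter (· ⊆ J) = J.powerset.erase ∅ := by
    ext M
    simp only [mem_filter, mem_flatSupports, mem_erase, mem_powerset]
    exact ⟨fun hM => ⟨hM.1.1, hM.2⟩,
      fun hM => ⟨⟨hM.1, Or.inl ((card_le_card hM.2).trans_lt hJ)⟩, hM.2⟩⟩
  rw [topWeight, hsub, min_eq_left hJ.le]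
  congr 2
  exact sum_congr rfl fun M hM => by rw [ht, hA.varOf_inf hn hnm (mem_erase.1 hM).1]

theorem topWeight_posFlat_univ :
    A.topWeight n (flatSupports n m) (hA.posFlat hn hnm) univ =
      ((n : A.RatFun) + t univ + ∑ r ∈ Icc 1 (n - 1), ∑ J ∈ powersetCard r univ, t J)⁻¹ := by
  rw [topWeight, filter_true_of_mem fun _ _ => subset_univ _, card_univ, Fintype.card_fin,
    min_eq_right hnm, add_assoc, ← sum_flatSupports hn hnm]
  congr 2
  exact sum_congr rfl fun J hJ => by rw [ht, hA.varOf_inf hn hnm (mem_flatSupports.1 hJ).1]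

theorem completeChainSum_topWeight {I : Finset (Fin m)} (hI : #I < n) :
    completeChainSum (A.topWeight n (flatSupports n m) (hA.posFlat hn hnm)) I =
      ∑ C ∈ weakOrderChains I with #C = #I,
        (∏ J ∈ C, ((#J : A.RatFun) + ∑ M ∈ J.powerset.erase ∅, t M))⁻¹ := by
  refine sum_congr rfl fun C hC => ?_
  rw [← prod_inv_distrib]
  refine prod_congr rfl fun J hJ => hA.topWeight_posFlat hn hnm ht (lt_of_le_of_lt ?_ hI)
  exact card_le_card ((mem_weakOrderChains.1 (mem_filter.1 hC).1).1 J hJ).2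

include hA hn hnm in
theorem exists_isTopologicalZeta_mul_eq :
    ∃ Z : A.RatFun, A.IsTopologicalZeta Z ∧
      Z * ((n : A.RatFun) + t univ + ∑ r ∈ Icc 1 (n - 1), ∑ J ∈ powersetCard r univ, t J) =
        ∑ k ∈ range n, (-1 : A.RatFun) ^ k * ((m - 1).choose k : A.RatFun) +
          ∑ ℓ ∈ Icc 1 (n - 1), ∑ I ∈ powersetCard ℓ (univ : Finset (Fin m)),
            ∑ C ∈ weakOrderChains I with #C = ℓ,
              (∑ k ∈ range (n - ℓ), (-1 : A.RatFun) ^ k * ((m - ℓ - 1).choose k : A.RatFun)) /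
                ∏ J ∈ C, ((#J : A.RatFun) + ∑ M ∈ J.powerset.erase ∅, t M) := by
  refine ⟨_, hA.isTopologicalZeta hn hnm, ?_⟩
  have hne : A.topWeight n (flatSupports n m) (hA.posFlat hn hnm) univ ≠ 0 := by
    have hmin : min #(univ : Finset (Fin m)) n ≠ 0 := by simp; omega
    exact inv_ne_zero (A.natCast_add_sum_var_ne_zero _ _ _ hmin)
  rw [← inv_inv ((n : A.RatFun) + _ + _), ← hA.topWeight_posFlat_univ hn hnm ht, mul_right_comm,
    mul_inv_cancel₀ hne, one_mul, sum_filter_card_lt hn, completeChainSum_empty, card_empty,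
    Nat.sub_zero, Nat.sub_zero, mul_one]
  congr 1
  refine sum_congr rfl fun ℓ hℓ => sum_congr rfl fun I hI => ?_
  obtain rfl := (mem_powersetCard.1 hI).2
  have hIn : #I < n := by have := mem_Icc.1 hℓ; omega
  simp only [hA.completeChainSum_topWeight hn hnm ht hIn, mul_sum, div_eq_mul_inv]

end TopologicalZeta

end IsGenericCentral

end

theorem mainTheorem11_general {F : Type*} [Field F] {n m : ℕ} (hn : 1 ≤ n) (hnm : n ≤ m)
    (A : HyperplaneArrangement F (Fin n → F)) (H : Fin m → AffineSubspace F (Fin n → F))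
    (hA : IsGenericCentral A H)
    (t : Finset (Fin m) → A.RatFun) (ht : ∀ I, t I = A.varOf (I.inf H))
    (t₁ : A.RatFun) (ht₁ : t₁ = A.varOf (Finset.univ.inf H)) :
    A.fHP =
        Polynomial.C (1 / (1 - t₁)) * (1 + Polynomial.X) *
            ∑ k ∈ Finset.range n, ((m - 1).choose k : Polynomial A.RatFun) * Polynomial.X ^ k +
          ∑ ℓ ∈ Finset.Icc 1 (n - 1), ∑ k ∈ Finset.range (n - ℓ),
            Polynomial.C (1 / (1 - t₁)) * (1 + Polynomial.X) ^ (ℓ + 1) *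
              ((m - ℓ - 1).choose k : Polynomial A.RatFun) * Polynomial.X ^ k *
              ∑ I ∈ Finset.powersetCard ℓ (Finset.univ : Finset (Fin m)),
                Polynomial.C (t I * weakOrderZeta I t) ∧
      ∃ Z : A.RatFun, A.IsTopologicalZeta Z ∧
        Z * ((n : A.RatFun) + t₁ + ∑ r ∈ Finset.Icc 1 (n - 1),
            ∑ J ∈ Finset.powersetCard r (Finset.univ : Finset (Fin m)), t J) =
          ∑ k ∈ Finset.range n, (-1 : A.RatFun) ^ k * ((m - 1).choose k : A.RatFun) +
            ∑ ℓ ∈ Finset.Icc 1 (n - 1),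
              ∑ I ∈ Finset.powersetCard ℓ (Finset.univ : Finset (Fin m)),
                ∑ C ∈ (weakOrderChains I).filter (fun C => C.card = ℓ),
                  (∑ k ∈ Finset.range (n - ℓ),
                      (-1 : A.RatFun) ^ k * ((m - ℓ - 1).choose k : A.RatFun)) /
                    ∏ J ∈ C, ((J.card : A.RatFun) + ∑ M ∈ J.powerset.erase ∅, t M) := by
  obtain rfl : t₁ = t Finset.univ := ht₁.trans (ht _).symm
  exact ⟨hA.fHP_eq hn hnm ht, hA.exists_isTopologicalZeta_mul_eq hn hnm ht⟩

theorem mainTheorem11 {F : Type*} [Field F] {n m : ℕ} (hn : 1 ≤ n) (hnm : n ≤ m)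
    (A : HyperplaneArrangement F (Fin n → F)) (H : Fin m → AffineSubspace F (Fin n → F))
    (hA : IsGenericCentral A H)
    (t : Finset (Fin m) → A.RatFun) (ht : ∀ I, t I = A.varOf (I.inf H))
    (t₁ : A.RatFun) (ht₁ : t₁ = A.varOf (Finset.univ.inf H)) :
    A.fHP =
        Polynomial.C (1 / (1 - t₁)) * (1 + Polynomial.X) *
            ∑ k ∈ Finset.range n, ((m - 1).choose k : Polynomial A.RatFun) * Polynomial.X ^ k +
          ∑ ℓ ∈ Finset.Icc 1 (n - 1), ∑ k ∈ Finset.range (n - ℓ),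
            Polynomial.C (1 / (1 - t₁)) * (1 + Polynomial.X) ^ (ℓ + 1) *
              ((m - ℓ - 1).choose k : Polynomial A.RatFun) * Polynomial.X ^ k *
              ∑ I ∈ Finset.powersetCard ℓ (Finset.univ : Finset (Fin m)),
                Polynomial.C (t I * weakOrderZeta I t) ∧
      (CharZero F →
        ∃ Z : A.RatFun, A.IsTopologicalZeta Z ∧
          Z * ((n : A.RatFun) + t₁ + ∑ r ∈ Finset.Icc 1 (n - 1),
              ∑ J ∈ Finset.powersetCard r (Finset.univ : Finset (Fin m)), t J) =
            ∑ k ∈ Finset.range n, (-1 : A.RatFun) ^ k * ((m - 1).choose k : A.RatFun) +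
              ∑ ℓ ∈ Finset.Icc 1 (n - 1),
                ∑ I ∈ Finset.powersetCard ℓ (Finset.univ : Finset (Fin m)),
                  ∑ C ∈ (weakOrderChains I).filter (fun C => C.card = ℓ),
                    (∑ k ∈ Finset.range (n - ℓ),
                        (-1 : A.RatFun) ^ k * ((m - ℓ - 1).choose k : A.RatFun)) /
                      ∏ J ∈ C, ((J.card : A.RatFun) + ∑ M ∈ J.powerset.erase ∅, t M)) :=
  have ⟨hfHP, hzeta⟩ := mainTheorem11_general hn hnm A H hA t ht t₁ ht₁
  ⟨hfHP, fun _ => hzeta⟩
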